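/- **Setting.** Let $\nu$ be a compactly supported probability measure on $\mathbb R$ and let $[\sigma_-,\sigma_+]$ be the convex hull of $\operatorname{supp}\nu$. Let $r_n$ ($n\ge1$) be non-negative integers with $r_{3n-2}>0$, $r_{3n}>0$, and let $\mathbb G=\bigsqcup_{n\ge1}R_n$ with $\#R_n=r_n$. The $n$-th shell is $S_n=R_{3n-2}\sqcup R_{3n-1}\sqcup R_{3n}$. Every vertex of $R_{3n}$ is joined to every vertex of $R_{3n+1}$ by an edge of weight $(r_{3n}r_{3n+1})^{-1/2}$; the edge weights inside $S_n$ are given by a real symmetric matrix $A_n$; there are no other edges. Let $\mathcal A$ be the resulting adjacency operator. The Anderson model is $\mathcal H_\omega=\mathcal A+\mathcal V_\omega$ on $\ell^2(\mathbb G)$, where $(\mathcal V_\omega\psi)(x)=\omega_x\psi(x)$ and the $\omega_x$, $x\in\mathbb G$, are independent with law $\nu$ (i.e. $\omega$ is distributed according to the product measure $\nu^{\otimes\mathbb G}$). "Purely absolutely continuous in $B$" means that the spectral measures of all $\psi\in\ell^2(\mathbb G)$, restricted to the Borel set $B$, are absolutely continuous with respect to Lebesgue measure. **Example 1 (stretched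 antitree $\mathbb S_{\mathbf s}$).** Here $r_{3n-1}=0$, $r_{3n-2}=r_{3n}=s_n\ge1$ and $A_n=\begin{pmatrix}\mathbf 0&\mathbf 1\\ \mathbf 1&\mathbf 0\end{pmatrix}$ with $s_n\times s_n$ blocks ($\mathbf 1$ the identity). Let $I_-$ (resp. $I_+$) be the set of $\lambda\in\mathbb R$ with $|\lambda-x|<1$ (resp. $|\lambda-x|>1$) for all $x\in\operatorname{supp}\nu$; for $\lambda\in I_-\cup I_+$ let $$\alpha^{\mathbb S}_\lambda=\iint\frac{x'-\lambda}{(x'-\lambda)(x-\lambda)-1}\,d\nu(x)\,d\nu(x'),\qquad \beta^{\mathbb S}_\lambda=\iint\frac{1}{(x'-\lambda)(x-\lambda)-1}\,d\nu(x)\,d\nu(x'),$$ $$I_{\mathbb S,\nu}=\Big\{\lambda\in I_+\cup I_-:\ \beta^{\mathbb S}_\lambda\ne0,\ \big|\beta^{\mathbb S}_\lambda+[1-(\alpha^{\mathbb S}_\lambda)^2]/\beta^{\mathbb S}_\lambda\big|<2\Big\}.$$ **Example 2 (partial antitree $\mathbb A_{\mathbf r}(\vec k,O,\mathbf a)$).**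 Let $k_1,k_3\ge1$, $k_2\ge0$, $k=k_1+k_2+k_3$; either $k_2=0$ and $r_{3n-1}=0$ for all $n$, or $k_2>0$ and $r_{3n-1}>0$ for all $n$. For $j=1,2,3$ and all $n$, $R_{3n-3+j}$ is split into $k_j$ subsets $R_{3n-3+j,1},\dots,R_{3n-3+j,k_j}$ of equal size $r_{3n-3+j}/k_j$. Let $O$ be a real orthogonal $k\times k$ matrix, $\mathbf a$ a real diagonal $k\times k$ matrix, and $A_n=O_n\mathbf aO_n^*$, where $O_n:\mathbb C^k\to\ell^2(S_n)$ has the entries $(O_n)_{xm}=\sqrt{k_j/r_{3n-3+j}}\;O_{\ell+k_1+\dots+k_{j-1},\,m}$ for $x\in R_{3n-3+j,\ell}$. Let $\Upsilon,\Phi\in\mathbb C^k$ be the unit vectors with $\Upsilon_i=k_1^{-1/2}$ for $i\le k_1$, $\Upsilon_i=0$ otherwise, and $\Phi_i=k_3^{-1/2}$ for $i>k_1+k_2$, $\Phi_i=0$ otherwise. Let $I_0$ be the set of $\lambda\in\mathbb R\setminus[\sigma_-,\sigma_+]$ such that for every diagonal $k\times k$ matrix $D$ with entries in $[\sigma_-,\sigma_+]$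 the matrix $D-\lambda+O\mathbf aO^*$ is invertible and $\Upsilon^*(D-\lambda+O\mathbf aO^*)^{-1}\Phi\neq0$. With $h_\lambda=\big(\int(x-\lambda)^{-1}d\nu(x)\big)^{-1}$ let $$\begin{pmatrix}\alpha^{\mathbb A}_\lambda&\beta^{\mathbb A}_\lambda\\ \beta^{\mathbb A}_\lambda&\delta^{\mathbb A}_\lambda\end{pmatrix}=\begin{pmatrix}\Upsilon^*\\ \Phi^*\end{pmatrix}(h_\lambda\mathbf 1+O\mathbf aO^*)^{-1}\begin{pmatrix}\Upsilon&\Phi\end{pmatrix},\qquad I_{\mathbb A,\nu}=\Big\{\lambda\in I_0:\ \big|\beta^{\mathbb A}_\lambda+[1-\alpha^{\mathbb A}_\lambda\delta^{\mathbb A}_\lambda]/\beta^{\mathbb A}_\lambda\big|<2\Big\}.$$ **Theorem.** In both examples $\mathcal H_\omega$ is almost surely a bounded self-adjoint operator, and the following holds. (i) In Example 1 assume $\sum_{n}s_n^{-1}<\infty$. Then, almost surely, $I_{\mathbb S,\nu}\subset\operatorname{spec}(\mathcal H_\omega)$, and the spectrum of $\mathcal H_\omega$ is purely absolutely continuous in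 $I_{\mathbb S,\nu}\setminus E_\omega$. Here $E_\omega$ is the (countable) set of those eigenvalues of $\mathcal H_\omega$ in $I_+\cap[\sigma_-,\sigma_+]$ that have an eigenfunction with finite support. In particular, almost surely the spectrum is purely absolutely continuous in $I_{\mathbb S,\nu}\setminus\big(I_+\cap[\sigma_-,\sigma_+]\big)$, which is all of $I_{\mathbb S,\nu}$ if $\operatorname{supp}\nu$ is an interval or $\sigma_+-\sigma_-\le2$. (ii) In Example 2 assume $\sum_n\min(r_{3n-2},r_{3n})^{-1}<\infty$ if $k_2=0$, and $\sum_n\min(r_{3n-2},r_{3n-1},r_{3n})^{-1}<\infty$ if $k_2>0$. Then, almost surely, $I_{\mathbb A,\nu}\subset\operatorname{spec}(\mathcal H_\omega)$ and the spectrum of $\mathcal H_\omega$ is purely absolutely continuous in $I_{\mathbb A,\nu}$. -/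

import Mathlib

open MeasureTheory

noncomputable section

namespace PartialAntitree

/-! ### Partial antitrees

Shells are indexed by `n : ℕ` starting at `0`. The shell `n` is the disjoint union of the three
layers `(n, 0)`, `(n, 1)`, `(n, 2)`, where the layer `(n, j)` has `r n j` vertices. -/

/-- The vertex set of a partial antitree with layer sizes `r`. -/
abbrev Vertex (r : ℕ → Fin 3 → ℕ) : Type := Σ n : ℕ, Σ j : Fin 3, Fin (r n j)

/-- The edges between consecutive shells: every vertex of the last layer of a shell is joined to
every vertex of the first layer of the next shell, with weight one over the geometric mean of
the sizes of the two layers. -/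
def coupling (r : ℕ → Fin 3 → ℕ) (x y : Vertex r) : ℝ :=
  if (x.2.1 = 2 ∧ y.2.1 = 0 ∧ y.1 = x.1 + 1) ∨ (y.2.1 = 2 ∧ x.2.1 = 0 ∧ x.1 = y.1 + 1) then
    (√(r x.1 x.2.1) * √(r y.1 y.2.1))⁻¹
  else 0

/-- Layer sizes of the stretched antitree: the first and last layer of the shell `n` have `s n`
vertices each, the middle layer is empty. -/
def stretchedSizes (s : ℕ → ℕ) (n : ℕ) : Fin 3 → ℕ := ![s n, 0, s n]

/-- Edge weights of the stretched antitree: besides the edges between consecutive shells, the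
`i`-th vertex of the first layer of a shell is joined, with weight one, to the `i`-th vertex of
the last layer of the same shell. -/
def stretchedAdj (s : ℕ → ℕ) (x y : Vertex (stretchedSizes s)) : ℝ :=
  coupling (stretchedSizes s) x y +
    if x.1 = y.1 ∧ ((x.2.1 = 0 ∧ y.2.1 = 2) ∨ (x.2.1 = 2 ∧ y.2.1 = 0)) ∧
        (x.2.2 : ℕ) = (y.2.2 : ℕ) then 1 else 0

/-- The index set of cardinality `k 0 + k 1 + k 2` of the connecting modes. -/
abbrev Mode (k : Fin 3 → ℕ) : Type := Σ j : Fin 3, Fin (k j)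

/-- The entry `(x, m)` of the isometry `O_n`, where `n` is the shell of `x`; the vertex `x` of the
layer `(n, j)` lies in the part of that layer with the label `part n j x`. -/
def modeEntry (r : ℕ → Fin 3 → ℕ) (k : Fin 3 → ℕ) (part : ∀ n j, Fin (r n j) → Fin (k j))
    (O : Matrix (Mode k) (Mode k) ℝ) (x : Vertex r) (m : Mode k) : ℝ :=
  √((k x.2.1 : ℝ) / (r x.1 x.2.1 : ℝ)) * O ⟨x.2.1, part x.1 x.2.1 x.2.2⟩ m

/-- Edge weights of the partial antitree with homogeneous connecting modes: inside the shell `n`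
the weights are the entries of `O_n a O_nᵀ`. -/
def modeAdj (r : ℕ → Fin 3 → ℕ) (k : Fin 3 → ℕ) (part : ∀ n j, Fin (r n j) → Fin (k j))
    (O : Matrix (Mode k) (Mode k) ℝ) (a : Mode k → ℝ) (x y : Vertex r) : ℝ :=
  coupling r x y +
    if x.1 = y.1 then ∑ m, modeEntry r k part O x m * a m * modeEntry r k part O y m else 0

/-! ### Operators and their spectral measures -/

/-- The Hilbert space of square summable functions on `G`. -/
abbrev L2 (G : Type) : Type := lp (fun _ : G => ℂ) 2

/-- `H` is the operator `(H ψ)(x) = ∑ y, A x y ψ(y) + v x ψ(x)`: the sum of the adjacency operator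
with the edge weights `A` (each `x` has only finitely many neighbours in the graphs used here) and
of the multiplication by the potential `v`. -/
def IsSchrodinger {G : Type} (A : G → G → ℝ) (v : G → ℝ) (H : L2 G →L[ℂ] L2 G) : Prop :=
  ∀ (ψ : L2 G) (x : G), H ψ x = ∑' y, (A x y : ℂ) * ψ y + (v x : ℂ) * ψ x

/-- `μ` is the spectral measure of `ψ` for the bounded self-adjoint operator `H`:
`⟨ψ, f(H) ψ⟩ = ∫ f dμ` for bounded continuous `f`. -/
def IsSpectralMeasure {E : Type} [NormedAddCommGroup E] [InnerProductSpace ℂ E] [CompleteSpace E]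
    (H : E →L[ℂ] E) (ψ : E) (μ : Measure ℝ) : Prop :=
  IsFiniteMeasure μ ∧ ∀ f : BoundedContinuousFunction ℝ ℝ,
    inner ℂ ψ (cfc (f : ℝ → ℝ) H ψ) = ((∫ t, f t ∂μ : ℝ) : ℂ)

/-- The spectrum of `H` in `B` is purely absolutely continuous: all spectral measures restricted
to `B` are absolutely continuous with respect to Lebesgue measure. -/
def PurelyACOn {E : Type} [NormedAddCommGroup E] [InnerProductSpace ℂ E] [CompleteSpace E]
    (H : E →L[ℂ] E) (B : Set ℝ) : Prop :=
  ∀ ψ : E, ∃ μ : Measure ℝ, IsSpectralMeasure H ψ μ ∧ μ.restrict B ≪ volume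

/-- The eigenvalues of `H` that have an eigenfunction with finite support. -/
def finSuppEigenvalues {G : Type} (H : L2 G →L[ℂ] L2 G) : Set ℝ :=
  {t | ∃ ψ : L2 G, ψ ≠ 0 ∧ {x | ψ x ≠ 0}.Finite ∧ H ψ = (t : ℂ) • ψ}

/-! ### Energy regions -/

/-- The energies with distance less than one to every point of the support of `ν`. -/
def IMinus (ν : Measure ℝ) : Set ℝ := {t | ∀ x ∈ ν.support, |t - x| < 1}

/-- The energies with distance more than one to every point of the support of `ν`. -/
def IPlus (ν : Measure ℝ) : Set ℝ := {t | ∀ x ∈ ν.support, 1 < |t - x|}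

def alphaS (ν : Measure ℝ) (t : ℝ) : ℝ :=
  ∫ p : ℝ × ℝ, (p.2 - t) / ((p.2 - t) * (p.1 - t) - 1) ∂(ν.prod ν)

def betaS (ν : Measure ℝ) (t : ℝ) : ℝ :=
  ∫ p : ℝ × ℝ, 1 / ((p.2 - t) * (p.1 - t) - 1) ∂(ν.prod ν)

/-- The set `I_{S,ν}`. -/
def IS (ν : Measure ℝ) : Set ℝ :=
  {t | t ∈ IPlus ν ∪ IMinus ν ∧ betaS ν t ≠ 0 ∧
    |betaS ν t + (1 - alphaS ν t ^ 2) / betaS ν t| < 2}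

/-- The unit vector `Υ`. -/
def upsilon (k : Fin 3 → ℕ) (m : Mode k) : ℝ := if m.1 = 0 then 1 / √(k 0) else 0

/-- The unit vector `Φ`. -/
def phi (k : Fin 3 → ℕ) (m : Mode k) : ℝ := if m.1 = 2 then 1 / √(k 2) else 0

/-- The matrix `O a Oᵀ` for the diagonal matrix with diagonal `a`. -/
def modeMatrix (k : Fin 3 → ℕ) (O : Matrix (Mode k) (Mode k) ℝ) (a : Mode k → ℝ) :
    Matrix (Mode k) (Mode k) ℝ :=
  O * Matrix.diagonal a * O.transpose

/-- The set `I_0`: energies `t` outside the convex hull of the support of `ν` such that for each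
diagonal matrix `D` with entries in that convex hull, `D - t + O a Oᵀ` is invertible with
`Υᵀ (D - t + O a Oᵀ)⁻¹ Φ ≠ 0`. -/
def I0 (ν : Measure ℝ) (k : Fin 3 → ℕ) (O : Matrix (Mode k) (Mode k) ℝ) (a : Mode k → ℝ) :
    Set ℝ :=
  {t | t ∉ convexHull ℝ ν.support ∧ ∀ D : Mode k → ℝ, (∀ m, D m ∈ convexHull ℝ ν.support) →
    IsUnit (Matrix.diagonal (fun m => D m - t) + modeMatrix k O a) ∧
    upsilon k ⬝ᵥ
      ((Matrix.diagonal (fun m => D m - t) + modeMatrix k O a)⁻¹.mulVec (phi k)) ≠ 0}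

/-- The harmonic average of `x - t`. -/
def harmonicAvg (ν : Measure ℝ) (t : ℝ) : ℝ := (∫ x, (x - t)⁻¹ ∂ν)⁻¹

/-- The matrix `(h_t 1 + O a Oᵀ)⁻¹`. -/
def greenA (ν : Measure ℝ) (k : Fin 3 → ℕ) (O : Matrix (Mode k) (Mode k) ℝ) (a : Mode k → ℝ)
    (t : ℝ) : Matrix (Mode k) (Mode k) ℝ :=
  (harmonicAvg ν t • (1 : Matrix (Mode k) (Mode k) ℝ) + modeMatrix k O a)⁻¹

def alphaA (ν : Measure ℝ) (k : Fin 3 → ℕ) (O : Matrix (Mode k) (Mode k) ℝ) (a : Mode k → ℝ)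
    (t : ℝ) : ℝ :=
  upsilon k ⬝ᵥ ((greenA ν k O a t).mulVec (upsilon k))

def betaA (ν : Measure ℝ) (k : Fin 3 → ℕ) (O : Matrix (Mode k) (Mode k) ℝ) (a : Mode k → ℝ)
    (t : ℝ) : ℝ :=
  upsilon k ⬝ᵥ ((greenA ν k O a t).mulVec (phi k))

def deltaA (ν : Measure ℝ) (k : Fin 3 → ℕ) (O : Matrix (Mode k) (Mode k) ℝ) (a : Mode k → ℝ)
    (t : ℝ) : ℝ :=
  phi k ⬝ᵥ ((greenA ν k O a t).mulVec (phi k))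

/-- The set `I_{A,ν}`. For `t ∈ I_0` the number `h_t` lies in the convex hull of the support of
`ν` translated by `-t`, hence `betaA ν k O a t ≠ 0` there. -/
def IA (ν : Measure ℝ) (k : Fin 3 → ℕ) (O : Matrix (Mode k) (Mode k) ℝ) (a : Mode k → ℝ) :
    Set ℝ :=
  {t | t ∈ I0 ν k O a ∧
    |betaA ν k O a t + (1 - alphaA ν k O a t * deltaA ν k O a t) / betaA ν k O a t| < 2}

end PartialAntitree

end

/-!
# Absolutely continuous spectrum for Anderson models on antitrees

Consecutive shells are joined by an operator of rank one, the normalized indicator of the last layer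
of one shell against that of the first layer of the next. A solution of `(H - z) u = ψ` is therefore
described, beyond the support of `ψ`, by its components along these indicators, and each shell acts
on the resulting vectors of `ℂ²` by a transfer matrix of determinant one. Its entries are made from
three Green numbers `α`, `β`, `δ` of the shell: the matrix elements of its resolvent between the
indicators (`bond_succ_eq_transfer`).

*From transfer matrices to spectrum.* Let `M` be the inverse of the imaginary part of the energy. If
the products of the first `M` transfer matrices are bounded on average, a solution cannot decay
before the shell `M`, so that its values at the edge of the support of `ψ` are controlled by
`‖u‖² / M` (`sqNorm_bond_le`). Conversely `‖u‖² / M`, which is the Poisson integral of the spectral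
measure of `ψ`, is controlled by these values: the first shells with a dissipative boundary term
form an invertible finite system, unless the energy is an eigenvalue with a finitely supported
eigenfunction (`ker_dissipative`, `poisson_le_of_bond`). The two bounds together keep the Poisson
integrals bounded in `L²` of an interval of energies along a sequence of heights tending to zero,
which makes the spectral measure absolutely continuous there
(`restrict_absolutelyContinuous_of_poissonIntegral`, `HasBoundedTail.locally_ac`). The same
estimates exclude a spectral gap (`HasBoundedTail.mem_spectrum`).

*Bounding the products.* In both examples the Green numbers are smooth functions of averages of
independent random variables. So they concentrate at real limits with a bias and a mean square
deviation of the order of the reciprocal size of the shell, up to the imaginary part of the energy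
(`Conc`, `Conc.average`). The condition that the trace has modulus less than two makes the limiting
transfer matrix elliptic, that is, it preserves a definite quadratic form (`qform_transfer`,
`sqNorm_le_qform`). The mean of the square of this form grows in the shell `n` at most by a factor
`1 + C (e n + η)`, where `e n` is the rate for the shell and `η` the imaginary part of the energy
(`exists_lintegral_qform_transfer_le`). It is essential that the linear term in the deviation
disappears in the mean. By independence, the mean fourth power of the product of `m ≤ 1 / η`
transfer matrices is at most of the order `exp (C (∑ e n + 1))`, and with Tonelli's theorem
and Fatou's lemma this turns into an almost sure bound along a sequence of heights
(`exists_lintegral_growth_sq_le`, `ae_frequently_lintegral_avgGrowth_le`).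

*The examples.* On the stretched antitree a shell decouples into matched pairs of vertices, and the
Green numbers are averages over the pairs. There `β` may vanish in single shells, but almost surely
it is bounded away from zero in the late ones (`CoeffConc.ae_eventually_le_norm`); only the latter
is needed for the transfer matrices. Eigenfunctions with finite support require a zero of some `β`,
which happens only if the pair determinants change sign, that is, in `I₊` and inside the convex hull
of the support (`notMem_finSuppEigenvalues_stretched`). On a partial antitree the span of the
connecting modes reduces a shell to a finite matrix whose diagonal consists of the harmonic means of
`ω x - z` over the parts (`mode_shell_equations`). Such a mean is again of the form `D - t` with `D`
in the convex hull of the support. By compactness the condition defining `I_0` thus bounds `β` and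
the determinant from below in all shells (`exists_le_norm_det`, `exists_isModeNbhd`), which also
excludes eigenfunctions with finite support.
-/

noncomputable section

namespace PartialAntitree

open Filter Topology Set ProbabilityTheory
open scoped ENNReal NNReal

/-! ### Spectral measures of bounded self-adjoint operators -/

section SpectralMeasure

variable {E : Type} [NormedAddCommGroup E] [InnerProductSpace ℂ E] [CompleteSpace E]
  {H : E →L[ℂ] E}

lemma inner_cfc_eq_norm_sq (H : E →L[ℂ] E) (ψ : E) {f : ℝ → ℝ} (hf : Continuous f)
    (h0 : ∀ t, 0 ≤ f t) :
    inner ℂ ψ (cfc f H ψ) = ((‖cfc (fun t => √(f t)) H ψ‖ ^ 2 : ℝ) : ℂ) := by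
  have h1 : cfc f H = cfc (fun t => √(f t)) H * cfc (fun t => √(f t)) H := by
    rw [← cfc_mul (fun t => √(f t)) (fun t => √(f t)) H
      (by fun_prop) (by fun_prop)]
    congr 1
    ext t
    exact (Real.mul_self_sqrt (h0 t)).symm
  have hs : IsSelfAdjoint (cfc (fun t => √(f t)) H) := cfc_predicate _ _
  have h2 := hs.isSymmetric
  rw [h1, mul_apply_eq_comp]
  have h3 := h2 ψ (cfc (fun t => √(f t)) H ψ)
  simp only [ContinuousLinearMap.coe_coe] at h3
  rw [← h3, inner_self_eq_norm_sq_to_K]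
  norm_cast

lemma inner_cfc_re (H : E →L[ℂ] E) (ψ : E) (f : ℝ → ℝ) :
    inner ℂ ψ (cfc f H ψ) = (((inner ℂ ψ (cfc f H ψ)).re : ℝ) : ℂ) := by
  have hs : IsSelfAdjoint (cfc f H) := cfc_predicate _ _
  have h3 := hs.isSymmetric ψ ψ
  simp only [ContinuousLinearMap.coe_coe] at h3
  apply Complex.ext
  · simp
  · have : (inner ℂ ψ (cfc f H ψ)).im = -(inner ℂ ψ (cfc f H ψ)).im := by
      conv_lhs => rw [← h3, ← inner_conj_symm]
      rw [Complex.conj_im]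
    simp only [Complex.ofReal_im]
    linarith

/-- A continuous cutoff function: one on `[-n, n]`, zero outside `[-(n + 1), n + 1]`. -/
def cutoff (n : ℕ) (t : ℝ) : ℝ := max 0 (min 1 (n + 1 - |t|))

lemma continuous_cutoff (n : ℕ) : Continuous (cutoff n) := by
  unfold cutoff; fun_prop

lemma cutoff_nonneg (n : ℕ) (t : ℝ) : 0 ≤ cutoff n t := le_max_left _ _

lemma cutoff_le_one (n : ℕ) (t : ℝ) : cutoff n t ≤ 1 :=
  max_le zero_le_one (min_le_left _ _)

lemma cutoff_eq_one {n : ℕ} {t : ℝ} (h : |t| ≤ n) : cutoff n t = 1 := by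
  unfold cutoff
  rw [min_eq_left (by linarith)]
  simp

lemma hasCompactSupport_cutoff_mul (n : ℕ) (f : ℝ → ℝ) :
    HasCompactSupport (fun t => cutoff n t * f t) := by
  apply HasCompactSupport.intro (isCompact_Icc (a := -(n + 1 : ℝ)) (b := n + 1))
  intro t ht
  have : (n : ℝ) + 1 < |t| := by
    by_contra! h
    exact ht ⟨by linarith [neg_abs_le t], by linarith [le_abs_self t]⟩
  have : cutoff n t = 0 := by
    unfold cutoff
    exact max_eq_left ((min_le_right _ _).trans (by linarith))
  simp [this]

/-- The positive functional `f ↦ ⟨ψ, f(H) ψ⟩` on compactly supported continuous functions. -/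
def spectralFunctional (H : E →L[ℂ] E) (ψ : E) :
    CompactlySupportedContinuousMap ℝ ℝ →ₚ[ℝ] ℝ where
  toFun f := (inner ℂ ψ (cfc (f : ℝ → ℝ) H ψ)).re
  map_add' f g := by
    have : cfc (fun x => f x + g x) H = cfc (f : ℝ → ℝ) H + cfc (g : ℝ → ℝ) H :=
      cfc_add (a := H) (f := f) (g := g) f.continuous.continuousOn g.continuous.continuousOn
    have h2 : ((f + g : CompactlySupportedContinuousMap ℝ ℝ) : ℝ → ℝ) = fun x => f x + g x := rfl
    rw [h2, this, add_apply, inner_add_right, Complex.add_re]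
  map_smul' c f := by
    have : cfc (fun x => c * f x) H = c • cfc (f : ℝ → ℝ) H :=
      cfc_const_mul c f H f.continuous.continuousOn
    have h2 : ((c • f : CompactlySupportedContinuousMap ℝ ℝ) : ℝ → ℝ) = fun x => c * f x := rfl
    rw [h2, this, smul_apply, ← Complex.coe_smul, inner_smul_right]
    simp
  monotone' f g hfg := by
    have hd : cfc (fun x => g x - f x) H = cfc (g : ℝ → ℝ) H - cfc (f : ℝ → ℝ) H :=
      cfc_sub (a := H) (f := g) (g := f) g.continuous.continuousOn f.continuous.continuousOn
    have h := inner_cfc_eq_norm_sq H ψ (f := fun x => g x - f x)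
      (g.continuous.sub f.continuous) (fun t => sub_nonneg.2 (hfg t))
    rw [hd, sub_apply, inner_sub_right] at h
    have h' := congrArg Complex.re h
    rw [Complex.sub_re, Complex.ofReal_re] at h'
    have := sq_nonneg ‖cfc (fun t => √(g t - f t)) H ψ‖
    change (inner ℂ ψ (cfc (f : ℝ → ℝ) H ψ)).re ≤ (inner ℂ ψ (cfc (g : ℝ → ℝ) H ψ)).re
    linarith

/-- The spectral measure comes from the Riesz–Markov–Kakutani theorem, applied to the functional
`f ↦ ⟨ψ, f(H) ψ⟩` on the functions with compact support; a cutoff that is one on the spectrum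
extends the formula to all bounded continuous functions. -/
lemma exists_isSpectralMeasure (H : E →L[ℂ] E) (ψ : E) :
    ∃ μ : Measure ℝ, IsSpectralMeasure H ψ μ := by
  set Λ := spectralFunctional H ψ with hΛ
  set μ := RealRMK.rieszMeasure Λ with hμ
  obtain ⟨R, hR⟩ : ∃ R : ℕ, ∀ t ∈ spectrum ℝ H, |t| ≤ R := by
    have hc : IsCompact (spectrum ℝ H) := ContinuousFunctionalCalculus.isCompact_spectrum H
    obtain ⟨C, hC⟩ := hc.isBounded.exists_norm_le
    obtain ⟨n, hn⟩ := exists_nat_ge C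
    exact ⟨n, fun t ht => (hC t ht).trans hn⟩
  have hcut : ∀ (f : ℝ → ℝ) (n : ℕ), R ≤ n → cfc (fun t => cutoff n t * f t) H = cfc f H := by
    intro f n hn
    apply cfc_congr
    intro t ht
    have : |t| ≤ n := (hR t ht).trans (by exact_mod_cast hn)
    simp [cutoff_eq_one this]
  let cm : (f : BoundedContinuousFunction ℝ ℝ) → ℕ → CompactlySupportedContinuousMap ℝ ℝ :=
    fun f n => ⟨⟨fun t => cutoff n t * f t, (continuous_cutoff n).mul f.continuous⟩,
      hasCompactSupport_cutoff_mul n f⟩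
  have hcm : ∀ (f : BoundedContinuousFunction ℝ ℝ) (n : ℕ), R ≤ n →
      ∫ t, cutoff n t * f t ∂μ = (inner ℂ ψ (cfc (f : ℝ → ℝ) H ψ)).re := by
    intro f n hn
    have h1 := RealRMK.integral_rieszMeasure Λ (cm f n)
    rw [← hcut f n hn]
    exact h1
  have hfin : IsFiniteMeasure μ := by
    let one : BoundedContinuousFunction ℝ ℝ := BoundedContinuousFunction.const ℝ 1
    set c := (inner ℂ ψ (cfc (one : ℝ → ℝ) H ψ)).re with hc
    have hle : ∀ n : ℕ, R ≤ n → μ (Icc (-(n : ℝ)) n) ≤ ENNReal.ofReal c := by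
      intro n hn
      have h1 := RealRMK.rieszMeasure_le_of_eq_one Λ (f := cm one n)
        (fun x => mul_nonneg (cutoff_nonneg n x) zero_le_one)
        (isCompact_Icc (a := -(n : ℝ)) (b := n))
        (fun x hx => by
          change cutoff n x * 1 = 1
          rw [cutoff_eq_one (abs_le.2 hx), mul_one])
      refine h1.trans (le_of_eq ?_)
      rw [← RealRMK.integral_rieszMeasure Λ (cm one n)]
      exact congrArg _ (hcm one n hn)
    refine ⟨lt_of_le_of_lt ?_ (ENNReal.ofReal_lt_top (r := c))⟩
    have hU : (univ : Set ℝ) = ⋃ n : ℕ, Icc (-((n + R : ℕ) : ℝ)) ((n + R : ℕ) : ℝ) := by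
      symm
      rw [eq_univ_iff_forall]
      intro x
      obtain ⟨n, hn⟩ := exists_nat_ge |x|
      refine mem_iUnion.2 ⟨n, ?_⟩
      have : |x| ≤ ((n + R : ℕ) : ℝ) := hn.trans (by exact_mod_cast Nat.le_add_right _ _)
      exact abs_le.1 this
    rw [hU, Monotone.measure_iUnion]
    · exact iSup_le fun n => hle _ (Nat.le_add_left _ _)
    · intro m n hmn
      have : ((m + R : ℕ) : ℝ) ≤ ((n + R : ℕ) : ℝ) := by exact_mod_cast Nat.add_le_add_right hmn R
      exact Icc_subset_Icc (by linarith) this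
  refine ⟨μ, hfin, fun f => ?_⟩
  rw [inner_cfc_re H ψ f]
  congr 1
  have hlim : Tendsto (fun n : ℕ => ∫ t, cutoff n t * f t ∂μ) atTop (𝓝 (∫ t, f t ∂μ)) := by
    apply tendsto_integral_of_dominated_convergence (fun _ => ‖f‖)
    · intro n
      exact ((continuous_cutoff n).mul f.continuous).aestronglyMeasurable
    · exact integrable_const _
    · intro n
      refine ae_of_all _ fun t => ?_
      rw [norm_mul, Real.norm_of_nonneg (cutoff_nonneg n t)]
      calc cutoff n t * ‖f t‖ ≤ 1 * ‖f t‖ :=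
            mul_le_mul_of_nonneg_right (cutoff_le_one n t) (norm_nonneg _)
        _ ≤ ‖f‖ := by rw [one_mul]; exact f.norm_coe_le_norm t
    · refine ae_of_all _ fun t => ?_
      obtain ⟨n, hn⟩ := exists_nat_ge |t|
      apply tendsto_const_nhds.congr'
      filter_upwards [eventually_ge_atTop n] with m hm
      rw [cutoff_eq_one (hn.trans (by exact_mod_cast hm)), one_mul]
  refine tendsto_nhds_unique (tendsto_const_nhds.congr' ?_) hlim
  filter_upwards [eventually_ge_atTop R] with n hn
  exact (hcm f n hn).symm

lemma IsSpectralMeasure.measure_univ (hH : IsSelfAdjoint H) {ψ : E} {μ : Measure ℝ}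
    (h : IsSpectralMeasure H ψ μ) :
    μ univ = ENNReal.ofReal (‖ψ‖ ^ 2) := by
  have := h.1
  have h1 := h.2 (BoundedContinuousFunction.const ℝ 1)
  have h2 : cfc (⇑(BoundedContinuousFunction.const ℝ (1 : ℝ))) H = 1 := by
    have : (⇑(BoundedContinuousFunction.const ℝ (1 : ℝ))) = fun _ => (1 : ℝ) := rfl
    rw [this, cfc_const_one ℝ H]
  rw [h2, one_apply_eq_self, inner_self_eq_norm_sq_to_K] at h1
  simp only [BoundedContinuousFunction.const_apply, integral_const, smul_eq_mul, mul_one] at h1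
  have h3 : ‖ψ‖ ^ 2 = μ.real univ := by
    apply Complex.ofReal_injective
    push_cast
    exact h1
  rw [h3, ofReal_measureReal]

/-- The parallelogram law for spectral measures bounds the one of `ψ` by those of `φ`
and `ψ - φ`. -/
lemma IsSpectralMeasure.le_add {ψ φ : E} {μ μ₁ μ₂ : Measure ℝ}
    (h : IsSpectralMeasure H ψ μ) (h₁ : IsSpectralMeasure H φ μ₁)
    (h₂ : IsSpectralMeasure H (ψ - φ) μ₂) (s : Set ℝ) : μ s ≤ 2 * μ₁ s + 2 * μ₂ s := by
  obtain ⟨μ₃, h₃⟩ := exists_isSpectralMeasure H (φ - (ψ - φ))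
  have := h.1; have := h₁.1; have := h₂.1; have := h₃.1
  have key : μ + μ₃ = (2 : ℝ≥0) • μ₁ + (2 : ℝ≥0) • μ₂ := by
    apply ext_of_forall_integral_eq_of_IsFiniteMeasure
    intro f
    have e : ∀ (ν : Measure ℝ) [IsFiniteMeasure ν], Integrable f ν := fun ν _ => f.integrable ν
    rw [integral_add_measure (e _) (e _), integral_add_measure ((e _)) ((e _)),
      integral_smul_nnreal_measure, integral_smul_nnreal_measure]
    have q := h.2 f
    have q1 := h₁.2 f
    have q2 := h₂.2 f
    have q3 := h₃.2 f
    have : ψ = φ + (ψ - φ) := by abel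
    rw [this] at q
    simp only [NNReal.smul_def, NNReal.coe_ofNat, smul_eq_mul]
    have : ((∫ t, f t ∂μ + ∫ t, f t ∂μ₃ : ℝ) : ℂ)
        = ((2 * ∫ t, f t ∂μ₁ + 2 * ∫ t, f t ∂μ₂ : ℝ) : ℂ) := by
      push_cast
      rw [← q, ← q1, ← q2, ← q3, map_add (cfc (f : ℝ → ℝ) H) φ (ψ - φ),
        map_sub (cfc (f : ℝ → ℝ) H) φ (ψ - φ)]
      simp only [inner_add_left, inner_add_right, inner_sub_left, inner_sub_right]
      ring
    exact_mod_cast this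
  calc μ s ≤ (μ + μ₃) s := by simp
    _ = 2 * μ₁ s + 2 * μ₂ s := by
      rw [key]; simp [Measure.nnreal_smul_coe_apply]

/-- Pure absolute continuity has to be checked only for a dense set of vectors. -/
lemma purelyACOn_of_dense (hH : IsSelfAdjoint H) {B : Set ℝ} {D : Set E} (hD : Dense D)
    (h : ∀ φ ∈ D, ∀ μ : Measure ℝ, IsSpectralMeasure H φ μ → μ.restrict B ≪ volume) :
    PurelyACOn H B := by
  intro ψ
  obtain ⟨μ, hμ⟩ := exists_isSpectralMeasure H ψ
  refine ⟨μ, hμ, Measure.AbsolutelyContinuous.mk fun s hs hs0 => ?_⟩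
  rw [Measure.restrict_apply hs]
  refine le_antisymm (ENNReal.le_of_forall_pos_le_add fun ε hε _ => ?_) bot_le
  rw [zero_add]
  have hδ : 0 < √((ε : ℝ) / 2) := Real.sqrt_pos.2 (by positivity)
  obtain ⟨φ, hφ, hφD⟩ := hD.exists_dist_lt ψ hδ
  obtain ⟨μ₁, h₁⟩ := exists_isSpectralMeasure H φ
  obtain ⟨μ₂, h₂⟩ := exists_isSpectralMeasure H (ψ - φ)
  have e1 : μ₁ (s ∩ B) = 0 := by
    rw [← Measure.restrict_apply hs]; exact h φ hφ μ₁ h₁ hs0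
  have e2 : μ₂ (s ∩ B) ≤ ENNReal.ofReal (ε / 2) := by
    refine (measure_mono (subset_univ _)).trans ?_
    rw [h₂.measure_univ hH]
    apply ENNReal.ofReal_le_ofReal
    rw [dist_eq_norm] at hφD
    calc ‖ψ - φ‖ ^ 2 ≤ √((ε : ℝ) / 2) ^ 2 :=
          pow_le_pow_left₀ (norm_nonneg _) hφD.le 2
      _ = (ε : ℝ) / 2 := Real.sq_sqrt (by positivity)
  calc μ (s ∩ B) ≤ 2 * μ₁ (s ∩ B) + 2 * μ₂ (s ∩ B) := hμ.le_add h₁ h₂ _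
    _ ≤ 2 * 0 + 2 * ENNReal.ofReal (ε / 2) := by rw [e1]; gcongr
    _ = ε := by
      rw [mul_zero, zero_add, ← ENNReal.ofReal_ofNat, ← ENNReal.ofReal_mul (by norm_num)]
      rw [mul_div_cancel₀ _ (by norm_num)]
      exact ENNReal.ofReal_coe_nnreal

/-- The Poisson integral of the spectral measure is the squared norm of the resolvent applied to
the vector, times the imaginary part of the energy. -/
lemma IsSpectralMeasure.poisson (hH : IsSelfAdjoint H) {ψ u : E} {μ : Measure ℝ}
    (h : IsSpectralMeasure H ψ μ) {l η : ℝ} (hη : 0 < η)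
    (hu : H u - ((l : ℂ) + η * Complex.I) • u = ψ) :
    ∫⁻ t, ENNReal.ofReal (η / ((t - l) ^ 2 + η ^ 2)) ∂μ = ENNReal.ofReal (η * ‖u‖ ^ 2) := by
  have := h.1
  have hpos : ∀ t : ℝ, 0 < (t - l) ^ 2 + η ^ 2 := fun t => by positivity
  have hcont : Continuous fun t : ℝ => η / ((t - l) ^ 2 + η ^ 2) :=
    continuous_const.div (by fun_prop) fun t => (hpos t).ne'
  let f : BoundedContinuousFunction ℝ ℝ := BoundedContinuousFunction.ofNormedAddCommGroup
    (fun t : ℝ => η / ((t - l) ^ 2 + η ^ 2)) hcont (1 / η) (fun t => by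
      rw [Real.norm_of_nonneg (div_nonneg hη.le (hpos t).le), div_le_div_iff₀ (hpos t) hη]
      nlinarith [sq_nonneg (t - l)])
  have hint := h.2 f
  set F := cfc (f : ℝ → ℝ) H with hF
  have hS : IsSelfAdjoint (H - algebraMap ℝ (E →L[ℂ] E) l) :=
    hH.sub (IsSelfAdjoint.algebraMap _ (IsSelfAdjoint.all l))
  set S := H - algebraMap ℝ (E →L[ℂ] E) l with hSdef
  have hScfc : S = cfc (fun t : ℝ => t - l) H := by
    rw [cfc_sub (a := H) (f := fun t => t) (g := fun _ => l) (by fun_prop) (by fun_prop),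
      cfc_id' ℝ H, cfc_const l H]
  have hSF : F * S = S * F := by rw [hScfc, hF]; exact (cfc_commute_cfc _ _ _)
  have hSSF : S * S * F + (η ^ 2) • F = η • (1 : E →L[ℂ] E) := by
    have hfc : ContinuousOn (f : ℝ → ℝ) (spectrum ℝ H) := f.continuous.continuousOn
    rw [hScfc, hF, ← cfc_mul (fun t : ℝ => t - l) (fun t : ℝ => t - l) H (by fun_prop)
      (by fun_prop), ← cfc_mul (fun t : ℝ => (t - l) * (t - l)) f H (by fun_prop) hfc,
      ← cfc_const_mul (η ^ 2) f H hfc,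
      ← cfc_add (a := H) (f := fun t : ℝ => (t - l) * (t - l) * f t)
        (g := fun t => η ^ 2 * f t) (by fun_prop) (by fun_prop)]
    have : ∀ t : ℝ, (t - l) * (t - l) * f t + η ^ 2 * f t = η := by
      intro t
      change (t - l) * (t - l) * (η / ((t - l) ^ 2 + η ^ 2))
        + η ^ 2 * (η / ((t - l) ^ 2 + η ^ 2)) = η
      have := (hpos t).ne'
      field_simp
    simp only [this]
    rw [cfc_const η H, Algebra.algebraMap_eq_smul_one]
  have hψ : ψ = S u - ((η : ℂ) * Complex.I) • u := by
    rw [← hu, hSdef, sub_apply, Algebra.algebraMap_eq_smul_one,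
      smul_apply, one_apply_eq_self, ← Complex.coe_smul,
      add_smul]
    abel
  have hsym := hS.isSymmetric
  have hsym' : ∀ x y, inner ℂ (S x) y = inner ℂ x (S y) := fun x y => hsym x y
  have e1 : F ψ = S (F u) - ((η : ℂ) * Complex.I) • F u := by
    rw [hψ, map_sub, map_smul]
    congr 1
    exact congrArg (fun A : E →L[ℂ] E => A u) hSF
  have e2 : S (S (F u)) + ((η : ℂ) ^ 2) • F u = (η : ℂ) • u := by
    have := congrArg (fun A : E →L[ℂ] E => A u) hSSF
    simp only [add_apply, mul_apply_eq_comp,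
      smul_apply, one_apply_eq_self] at this
    rw [← Complex.coe_smul, ← Complex.coe_smul] at this
    rw [← this]; push_cast; rfl
  have e3 : inner ℂ ψ (F ψ) = ((η * ‖u‖ ^ 2 : ℝ) : ℂ) := by
    have e4 : inner ℂ ψ (F ψ) = inner ℂ u (S (S (F u)) + ((η : ℂ) ^ 2) • F u) := by
      rw [e1]
      conv_lhs => rw [hψ]
      simp only [inner_sub_left, inner_sub_right, inner_add_right, inner_smul_left,
        inner_smul_right, hsym', map_mul, Complex.conj_ofReal, Complex.conj_I]
      ring_nf
      rw [Complex.I_sq]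
      ring
    rw [e4, e2, inner_smul_right, inner_self_eq_norm_sq_to_K]
    push_cast
    rfl
  rw [e3] at hint
  have hint' : η * ‖u‖ ^ 2 = ∫ t, f t ∂μ := by exact_mod_cast hint
  rw [hint', ofReal_integral_eq_lintegral_ofReal (f.integrable μ)
    (ae_of_all _ fun t => div_nonneg hη.le (hpos t).le)]
  rfl

end SpectralMeasure

/-! ### Absolute continuity from square integrable Poisson integrals -/

/-- The Poisson integral of `μ` at the point `l + iη`. -/
def poissonIntegral (μ : Measure ℝ) (η l : ℝ) : ℝ≥0∞ :=
  ∫⁻ t, ENNReal.ofReal (η / ((t - l) ^ 2 + η ^ 2)) ∂μ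

lemma measurable_poissonKernel (η : ℝ) :
    Measurable fun p : ℝ × ℝ => ENNReal.ofReal (η / ((p.2 - p.1) ^ 2 + η ^ 2)) := by
  fun_prop

lemma measurable_poissonIntegral (μ : Measure ℝ) [IsFiniteMeasure μ] (η : ℝ) :
    Measurable (poissonIntegral μ η) :=
  (measurable_poissonKernel η).lintegral_prod_right'

/-- The Poisson kernel has mass at least one on the interval with the radius `η`. -/
lemma one_le_lintegral_poissonKernel {U : Set ℝ} {t η : ℝ} (hη : 0 < η)
    (h : Icc (t - η) (t + η) ⊆ U) :
    1 ≤ ∫⁻ l in U, ENNReal.ofReal (η / ((t - l) ^ 2 + η ^ 2)) := by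
  calc (1 : ℝ≥0∞) = ∫⁻ _ in Icc (t - η) (t + η), ENNReal.ofReal (1 / (2 * η)) := by
        rw [setLIntegral_const, Real.volume_Icc, ← ENNReal.ofReal_mul (by positivity)]
        rw [show 1 / (2 * η) * (t + η - (t - η)) = 1 by field_simp; ring, ENNReal.ofReal_one]
    _ ≤ ∫⁻ l in Icc (t - η) (t + η), ENNReal.ofReal (η / ((t - l) ^ 2 + η ^ 2)) := by
        apply setLIntegral_mono' measurableSet_Icc
        intro l hl
        apply ENNReal.ofReal_le_ofReal
        rw [div_le_div_iff₀ (by positivity) (by positivity)]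
        have : (t - l) ^ 2 ≤ η ^ 2 := by
          apply sq_le_sq' <;> linarith [hl.1, hl.2]
        nlinarith
    _ ≤ _ := lintegral_mono_set h

/-- If the Poisson integrals of a finite measure stay bounded in `L²(J)` along a sequence
approaching the real axis, then the measure is absolutely continuous on `J`: the measure of an
open subset `U` is at most the limit inferior of the integrals of the Poisson integrals
over `U`. -/
lemma restrict_absolutelyContinuous_of_poissonIntegral {μ : Measure ℝ} [IsFiniteMeasure μ]
    {J : Set ℝ} (hJ : IsOpen J) {L : ℝ≥0}
    (h : ∃ᶠ M : ℕ in atTop, ∫⁻ l in J, poissonIntegral μ (1 / (M : ℝ)) l ^ 2 ≤ L) :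
    μ.restrict J ≪ volume := by
  have key : ∀ U : Set ℝ, IsOpen U → U ⊆ J → ∀ k : ℝ≥0, 0 < k →
      μ U ≤ k * volume U + L / k := by
    intro U hU hUJ k hk
    -- splitting at the level `k` trades the `L²` bound for a bound by the volume of `U`
    have hAG : ∀ x : ℝ≥0∞, x ≤ k + x ^ 2 / k := by
      intro x
      rcases le_total x k with h1 | h1
      · exact h1.trans le_self_add
      · refine le_trans ?_ le_add_self
        rw [ENNReal.le_div_iff_mul_le (Or.inl (by simpa using hk.ne')) (Or.inl (by simp)), sq]
        gcongr
    have step1 : μ U ≤ liminf (fun M : ℕ =>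
        ∫⁻ t in U, (∫⁻ l in U, ENNReal.ofReal ((1 / (M : ℝ)) /
          ((t - l) ^ 2 + (1 / (M : ℝ)) ^ 2))) ∂μ) atTop := by
      calc μ U = ∫⁻ _ in U, 1 ∂μ := by simp
        _ ≤ ∫⁻ t in U, liminf (fun M : ℕ => (∫⁻ l in U, ENNReal.ofReal ((1 / (M : ℝ)) /
          ((t - l) ^ 2 + (1 / (M : ℝ)) ^ 2)))) atTop ∂μ := by
            apply setLIntegral_mono' hU.measurableSet
            intro t ht
            obtain ⟨δ, hδ, hb⟩ := Metric.isOpen_iff.1 hU t ht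
            refine le_liminf_of_le (by isBoundedDefault) ?_
            obtain ⟨n, hn⟩ := exists_nat_one_div_lt hδ
            filter_upwards [eventually_ge_atTop (n + 1)] with M hM
            have hM0 : (0 : ℝ) < M := by
              have : 0 < M := by omega
              exact_mod_cast this
            apply one_le_lintegral_poissonKernel (by positivity)
            intro x hx
            apply hb
            rw [Metric.mem_ball, Real.dist_eq, abs_lt]
            have : 1 / (M : ℝ) ≤ 1 / ((n : ℝ) + 1) := by
              apply one_div_le_one_div_of_le (by positivity)
              exact_mod_cast hM
            constructor <;> linarith [hx.1, hx.2]
        _ ≤ _ := by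
            apply lintegral_liminf_le
            intro M
            have := (measurable_poissonKernel (1 / (M : ℝ))).comp measurable_swap
            exact this.lintegral_prod_right'
    refine step1.trans (liminf_le_of_frequently_le' ?_)
    refine h.mono fun M hM => ?_
    have hm := measurable_poissonKernel (1 / (M : ℝ))
    calc ∫⁻ t in U, (∫⁻ l in U, ENNReal.ofReal ((1 / (M : ℝ)) /
          ((t - l) ^ 2 + (1 / (M : ℝ)) ^ 2))) ∂μ
        = ∫⁻ l in U, ∫⁻ t in U, ENNReal.ofReal ((1 / (M : ℝ)) /
          ((t - l) ^ 2 + (1 / (M : ℝ)) ^ 2)) ∂μ := by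
          rw [lintegral_lintegral_swap]
          exact (hm.comp measurable_swap).aemeasurable
      _ ≤ ∫⁻ l in U, poissonIntegral μ (1 / (M : ℝ)) l := by
          apply lintegral_mono
          intro l
          exact setLIntegral_le_lintegral _ _
      _ ≤ ∫⁻ l in U, (k + poissonIntegral μ (1 / (M : ℝ)) l ^ 2 / k) :=
          lintegral_mono fun l => hAG _
      _ = k * volume U + (∫⁻ l in U, poissonIntegral μ (1 / (M : ℝ)) l ^ 2) / k := by
          rw [lintegral_add_left measurable_const, setLIntegral_const]
          simp only [div_eq_mul_inv]
          rw [lintegral_mul_const _ ((measurable_poissonIntegral μ _).pow_const 2)]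
      _ ≤ k * volume U + L / k := by
          gcongr
          exact (lintegral_mono_set hUJ).trans hM
  refine Measure.AbsolutelyContinuous.mk fun s hs hs0 => ?_
  rw [Measure.restrict_apply hs]
  -- a null set has a neighbourhood of volume less than `1 / k²`; then let `k` tend to infinity
  have hb : ∀ n : ℕ, μ (s ∩ J) ≤ ((1 + L) / ((n : ℝ≥0) + 1) : ℝ≥0) := by
    intro n
    set k : ℝ≥0 := n + 1 with hk
    have hk0 : 0 < k := by positivity
    obtain ⟨U, hsU, hUo, hU⟩ := (s ∩ J).exists_isOpen_lt_of_lt (μ := volume)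
      (((k ^ 2)⁻¹ : ℝ≥0) : ℝ≥0∞) (by
        rw [measure_mono_null inter_subset_left hs0]
        exact_mod_cast (by positivity : (0 : ℝ≥0) < (k ^ 2)⁻¹))
    calc μ (s ∩ J) ≤ μ (U ∩ J) := measure_mono (subset_inter hsU inter_subset_right)
      _ ≤ k * volume (U ∩ J) + L / k := key _ (hUo.inter hJ) inter_subset_right k hk0
      _ ≤ k * ((k ^ 2)⁻¹ : ℝ≥0) + L / k := by
          gcongr
          exact (measure_mono inter_subset_left).trans hU.le
      _ = ((1 + L) / k : ℝ≥0) := by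
          rw [← ENNReal.coe_div hk0.ne', ← ENNReal.coe_mul, ← ENNReal.coe_add]
          congr 1
          field_simp
  have hlim : Tendsto (fun n : ℕ => (((1 + L) / ((n : ℝ≥0) + 1) : ℝ≥0) : ℝ≥0∞)) atTop (𝓝 0) := by
    rw [← ENNReal.coe_zero, ENNReal.tendsto_coe]
    have h1 : Tendsto (fun n : ℕ => 1 / ((n : ℝ≥0) + 1)) atTop (𝓝 0) :=
      tendsto_one_div_add_atTop_nhds_zero_nat
    have h2 := h1.const_mul (1 + L)
    simpa [div_eq_mul_inv] using h2
  exact le_antisymm (ge_of_tendsto' hlim hb) bot_le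

lemma restrict_absolutelyContinuous_of_locally {μ : Measure ℝ} {B : Set ℝ}
    (h : ∀ t ∈ B, ∃ J ∈ 𝓝 t, μ.restrict J ≪ volume) : μ.restrict B ≪ volume := by
  refine Measure.AbsolutelyContinuous.mk fun s hs hs0 => ?_
  rw [Measure.restrict_apply hs]
  refine measure_null_of_locally_null _ fun t ht => ?_
  obtain ⟨J, hJ, hac⟩ := h t ht.2
  refine ⟨s ∩ B ∩ J, inter_mem self_mem_nhdsWithin (mem_nhdsWithin_of_mem_nhds hJ), ?_⟩
  have := hac hs0
  rw [Measure.restrict_apply hs] at this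
  exact measure_mono_null (by intro x hx; exact ⟨hx.1.1, hx.2⟩) this

/-! ### Schrödinger operators as bounded operators -/

section Schur

variable {G : Type}

/-- The Schur test with weights, for symmetric kernels with finite rows. -/
lemma sum_norm_sq_le_of_schur [DecidableEq G] {K : G → G → ℝ} {w : G → ℝ} {N : G → Finset G}
    {c : ℝ}
    (hw : ∀ x, 0 < w x) (hsym : ∀ x y, K x y = K y x) (hN : ∀ x, ∀ y ∉ N x, K x y = 0)
    (hK : ∀ x, ∑ y ∈ N x, |K x y| * w y ≤ c * w x) (ψ : L2 G) (s : Finset G) :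
    ∑ x ∈ s, ‖∑ y ∈ N x, (K x y : ℂ) * ψ y‖ ^ 2 ≤ c ^ 2 * ‖ψ‖ ^ 2 := by
  have hrow : ∀ x (t : Finset G), ∑ y ∈ t, |K x y| * w y ≤ c * w x := by
    intro x t
    refine le_trans ?_ (hK x)
    have h1 : ∑ y ∈ t, |K x y| * w y = ∑ y ∈ t ∩ N x, |K x y| * w y := by
      symm
      apply Finset.sum_subset Finset.inter_subset_left
      intro y hy hy'
      rw [hN x y (fun h => hy' (Finset.mem_inter.2 ⟨hy, h⟩))]
      simp
    rw [h1]
    exact Finset.sum_le_sum_of_subset_of_nonneg Finset.inter_subset_right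
      fun y _ _ => mul_nonneg (abs_nonneg _) (hw y).le
  rcases s.eq_empty_or_nonempty with rfl | ⟨x0, _⟩
  · simp only [Finset.sum_empty]; positivity
  have hc : 0 ≤ c := by
    have h0 : 0 ≤ ∑ y ∈ N x0, |K x0 y| * w y :=
      Finset.sum_nonneg fun y _ => mul_nonneg (abs_nonneg _) (hw y).le
    exact nonneg_of_mul_nonneg_left (h0.trans (hK x0)) (hw x0)
  set t := s.biUnion N with ht
  have h1 : ∀ x ∈ s, ‖∑ y ∈ N x, (K x y : ℂ) * ψ y‖ ^ 2
      ≤ c * w x * ∑ y ∈ t, |K x y| * (‖ψ y‖ ^ 2 / w y) := by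
    intro x hx
    have e1 : ∑ y ∈ N x, (K x y : ℂ) * ψ y = ∑ y ∈ t, (K x y : ℂ) * ψ y := by
      apply Finset.sum_subset (Finset.subset_biUnion_of_mem N hx)
      intro y _ hy
      rw [hN x y hy]; simp
    have e2 : ‖∑ y ∈ t, (K x y : ℂ) * ψ y‖ ≤ ∑ y ∈ t, |K x y| * ‖ψ y‖ := by
      refine (norm_sum_le _ _).trans (le_of_eq ?_)
      refine Finset.sum_congr rfl fun y _ => ?_
      rw [norm_mul, Complex.norm_real, Real.norm_eq_abs]
    rw [e1]
    calc ‖∑ y ∈ t, (K x y : ℂ) * ψ y‖ ^ 2 ≤ (∑ y ∈ t, |K x y| * ‖ψ y‖) ^ 2 :=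
          pow_le_pow_left₀ (norm_nonneg _) e2 2
      _ = (∑ y ∈ t, √(|K x y| * w y) * √(|K x y| * (‖ψ y‖ ^ 2 / w y))) ^ 2 := by
          congr 1
          refine Finset.sum_congr rfl fun y _ => ?_
          rw [← Real.sqrt_mul (mul_nonneg (abs_nonneg _) (hw y).le)]
          have : |K x y| * w y * (|K x y| * (‖ψ y‖ ^ 2 / w y)) = (|K x y| * ‖ψ y‖) ^ 2 := by
            have := (hw y).ne'
            field_simp
          rw [this, Real.sqrt_sq (by positivity)]
      _ ≤ (∑ y ∈ t, √(|K x y| * w y) ^ 2) * ∑ y ∈ t, √(|K x y| * (‖ψ y‖ ^ 2 / w y)) ^ 2 :=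
          Finset.sum_mul_sq_le_sq_mul_sq _ _ _
      _ = (∑ y ∈ t, |K x y| * w y) * ∑ y ∈ t, |K x y| * (‖ψ y‖ ^ 2 / w y) := by
          congr 1 <;> refine Finset.sum_congr rfl fun y _ => ?_
          · exact Real.sq_sqrt (mul_nonneg (abs_nonneg _) (hw y).le)
          · exact Real.sq_sqrt (mul_nonneg (abs_nonneg _) (div_nonneg (sq_nonneg _) (hw y).le))
      _ ≤ _ := by
          apply mul_le_mul_of_nonneg_right (hrow x t)
          exact Finset.sum_nonneg fun y _ =>
            mul_nonneg (abs_nonneg _) (div_nonneg (sq_nonneg _) (hw y).le)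
  calc ∑ x ∈ s, ‖∑ y ∈ N x, (K x y : ℂ) * ψ y‖ ^ 2
      ≤ ∑ x ∈ s, c * w x * ∑ y ∈ t, |K x y| * (‖ψ y‖ ^ 2 / w y) := Finset.sum_le_sum h1
    _ = ∑ y ∈ t, c * (‖ψ y‖ ^ 2 / w y) * ∑ x ∈ s, |K y x| * w x := by
        simp only [Finset.mul_sum]
        rw [Finset.sum_comm]
        refine Finset.sum_congr rfl fun y _ => Finset.sum_congr rfl fun x _ => ?_
        rw [hsym y x]; ring
    _ ≤ ∑ y ∈ t, c * (‖ψ y‖ ^ 2 / w y) * (c * w y) := by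
        refine Finset.sum_le_sum fun y _ => ?_
        apply mul_le_mul_of_nonneg_left (hrow y s)
        exact mul_nonneg hc (div_nonneg (sq_nonneg _) (hw y).le)
    _ = c ^ 2 * ∑ y ∈ t, ‖ψ y‖ ^ 2 := by
        rw [Finset.mul_sum]
        refine Finset.sum_congr rfl fun y _ => ?_
        have := (hw y).ne'
        field_simp
    _ ≤ c ^ 2 * ‖ψ‖ ^ 2 := by
        apply mul_le_mul_of_nonneg_left _ (sq_nonneg c)
        have := lp.sum_rpow_le_norm_rpow (p := 2) (by norm_num) ψ t
        simpa using this

/-- The operator with a kernel that satisfies the weighted Schur test. The weights matter: the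
blocks between two layers have many small entries, and the row sums need not be bounded. -/
lemma exists_clm_of_schur {K : G → G → ℝ} {w : G → ℝ} {N : G → Finset G} {c : ℝ}
    (hw : ∀ x, 0 < w x) (hc : 0 ≤ c) (hsym : ∀ x y, K x y = K y x)
    (hN : ∀ x, ∀ y ∉ N x, K x y = 0)
    (hK : ∀ x, ∑ y ∈ N x, |K x y| * w y ≤ c * w x) :
    ∃ T : L2 G →L[ℂ] L2 G, ∀ (ψ : L2 G) (x : G), T ψ x = ∑ y ∈ N x, (K x y : ℂ) * ψ y := by
  classical
  have hs := fun ψ s => sum_norm_sq_le_of_schur hw hsym hN hK ψ s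
  have hmem : ∀ ψ : L2 G, Memℓp (fun x => ∑ y ∈ N x, (K x y : ℂ) * ψ y) 2 := by
    intro ψ
    apply memℓp_gen' (C := c ^ 2 * ‖ψ‖ ^ 2)
    intro s
    simpa using hs ψ s
  let L : L2 G →ₗ[ℂ] L2 G :=
    { toFun := fun ψ => ⟨fun x => ∑ y ∈ N x, (K x y : ℂ) * ψ y, hmem ψ⟩
      map_add' := fun φ ψ => by
        ext x
        change ∑ y ∈ N x, (K x y : ℂ) * (φ y + ψ y)
          = ∑ y ∈ N x, (K x y : ℂ) * φ y + ∑ y ∈ N x, (K x y : ℂ) * ψ y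
        simp only [mul_add, Finset.sum_add_distrib]
      map_smul' := fun a ψ => by
        ext x
        simp only [lp.coeFn_smul, Pi.smul_apply, smul_eq_mul, RingHom.id_apply]
        rw [Finset.mul_sum]
        exact Finset.sum_congr rfl fun y _ => by ring }
  refine ⟨L.mkContinuous c fun ψ => ?_, fun ψ x => rfl⟩
  apply lp.norm_le_of_forall_sum_le (p := 2) (by norm_num) (by positivity)
  intro s
  have := hs ψ s
  simp only [ENNReal.toReal_ofNat, Real.rpow_ofNat]
  rw [mul_pow]
  exact this

lemma exists_isSchrodinger {A : G → G → ℝ} {w v : G → ℝ} {N : G → Finset G} {c c' : ℝ}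
    (hw : ∀ x, 0 < w x) (hc : 0 ≤ c) (hsym : ∀ x y, A x y = A y x)
    (hN : ∀ x, ∀ y ∉ N x, A x y = 0)
    (hA : ∀ x, ∑ y ∈ N x, |A x y| * w y ≤ c * w x) (hc' : 0 ≤ c') (hv : ∀ x, |v x| ≤ c') :
    ∃ H, IsSchrodinger A v H := by
  classical
  obtain ⟨T, hT⟩ := exists_clm_of_schur hw hc hsym hN hA
  obtain ⟨V, hV⟩ := exists_clm_of_schur (K := fun x y => if x = y then v x else 0)
    (w := fun _ : G => (1 : ℝ)) (N := fun x => {x}) (c := c') (fun _ => one_pos) hc'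
    (fun x y => by
      by_cases h : x = y
      · simp [h]
      · simp [h, Ne.symm h])
    (fun x y hy => by
      have : x ≠ y := fun h => hy (by simp [h])
      simp [this])
    (fun x => by simpa using hv x)
  refine ⟨T + V, fun ψ x => ?_⟩
  rw [add_apply, lp.coeFn_add, Pi.add_apply, hT, hV,
    tsum_eq_sum (s := N x) (fun y hy => by rw [hN x y hy]; simp)]
  simp

lemma IsSchrodinger.isSelfAdjoint {A : G → G → ℝ} {v : G → ℝ} {N : G → Finset G}
    {H : L2 G →L[ℂ] L2 G} (hH : IsSchrodinger A v H) (hsym : ∀ x y, A x y = A y x)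
    (hN : ∀ x, ∀ y ∉ N x, A x y = 0) : IsSelfAdjoint H := by
  classical
  rw [ContinuousLinearMap.isSelfAdjoint_iff']
  ext ψ x
  have h1 : (ContinuousLinearMap.adjoint H ψ) x
      = inner ℂ (lp.single (E := fun _ : G => ℂ) 2 x (1 : ℂ))
        (ContinuousLinearMap.adjoint H ψ) := by
    rw [lp.inner_single_left]; simp
  rw [h1, ContinuousLinearMap.adjoint_inner_right, lp.inner_eq_tsum, hH]
  have h2 : ∀ y, (H (lp.single (E := fun _ : G => ℂ) 2 x (1 : ℂ))) y
      = (A y x : ℂ) + if y = x then (v x : ℂ) else 0 := by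
    intro y
    rw [hH, tsum_eq_single x]
    · by_cases h : y = x
      · subst h; simp [lp.single_apply]
      · simp [lp.single_apply, h]
    · intro z hz
      simp [lp.single_apply, hz]
  have h3 : ∀ y, inner ℂ ((H (lp.single (E := fun _ : G => ℂ) 2 x (1 : ℂ))) y) (ψ y)
      = ψ y * (A y x : ℂ) + if y = x then ψ y * (v x : ℂ) else 0 := by
    intro y
    rw [h2, RCLike.inner_apply, map_add, Complex.conj_ofReal, mul_add]
    by_cases h : y = x <;> simp [h]
  rw [tsum_congr h3, Summable.tsum_add]
  · congr 1
    · exact tsum_congr fun y => by rw [hsym y x]; ring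
    · rw [tsum_eq_single x]
      · simp [mul_comm]
      · intro y hy; simp [hy]
  · apply summable_of_ne_finset_zero (s := N x)
    intro y hy; rw [hsym y x, hN x y hy]; simp
  · apply summable_of_ne_finset_zero (s := {x})
    intro y hy; simp at hy; simp [hy]

end Schur

/-! ### Shells and the action of the operator on them -/

/-- The vertices of the shell `n`. -/
abbrev Shell (r : ℕ → Fin 3 → ℕ) (n : ℕ) : Type := Σ j : Fin 3, Fin (r n j)

/-- The vertices of the first `N` shells. -/
def shells (r : ℕ → Fin 3 → ℕ) (N : ℕ) : Finset (Vertex r) :=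
  (Finset.range N).sigma fun _ => Finset.univ

lemma mem_shells {r : ℕ → Fin 3 → ℕ} {N : ℕ} {x : Vertex r} : x ∈ shells r N ↔ x.1 < N := by
  simp [shells]

/-- The normalized indicator function of the layer `j` of the shell `n`; for `j = 0` and `j = 2`
these are the vectors through which the shell is coupled to its neighbours. -/
def layerVec (r : ℕ → Fin 3 → ℕ) (n : ℕ) (j : Fin 3) (s : Shell r n) : ℝ :=
  if s.1 = j then (√(r n j))⁻¹ else 0

/-- The component of a function on a shell along the normalized indicator of a layer. -/
def layerComp (r : ℕ → Fin 3 → ℕ) (n : ℕ) (j : Fin 3) (f : Shell r n → ℂ) : ℂ :=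
  ∑ s, (layerVec r n j s : ℂ) * f s

/-- The pair formed by the component along the first layer of the shell `n` and the component
along the last layer of the preceding shell (zero for `n = 0`). -/
def bond {r : ℕ → Fin 3 → ℕ} (f : Vertex r → ℂ) : ℕ → ℂ × ℂ
  | 0 => (layerComp r 0 0 fun s => f ⟨0, s⟩, 0)
  | n + 1 => (layerComp r (n + 1) 0 fun s => f ⟨n + 1, s⟩, layerComp r n 2 fun s => f ⟨n, s⟩)

/-- Matrices of edge weights inside the shells. -/
structure IsShellMatrix (r : ℕ → Fin 3 → ℕ) (C : Vertex r → Vertex r → ℝ) : Prop where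
  symm : ∀ x y, C x y = C y x
  block : ∀ x y, x.1 ≠ y.1 → C x y = 0
  bound : ∃ κ : ℝ, 0 ≤ κ ∧ ∀ n (s : Shell r n),
    ∑ t : Shell r n, |C ⟨n, s⟩ ⟨n, t⟩| * (√(r n t.1))⁻¹ ≤ κ * (√(r n s.1))⁻¹

section ShellAction

variable {r : ℕ → Fin 3 → ℕ}

lemma layerVec_nonneg (n : ℕ) (j : Fin 3) (s : Shell r n) : 0 ≤ layerVec r n j s := by
  unfold layerVec; split_ifs <;> positivity

lemma layerVec_le (n : ℕ) (j : Fin 3) (s : Shell r n) : layerVec r n j s ≤ (√(r n s.1))⁻¹ := by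
  unfold layerVec
  split_ifs with h
  · rw [h]
  · positivity

lemma sum_layerVec_weight (n : ℕ) (j : Fin 3) :
    ∑ s : Shell r n, layerVec r n j s * (√(r n s.1))⁻¹ ≤ 1 := by
  rw [Fintype.sum_sigma, Finset.sum_eq_single j]
  · simp only [layerVec, if_true, Finset.sum_const, Finset.card_univ, Fintype.card_fin,
      nsmul_eq_mul]
    rw [← mul_inv, Real.mul_self_sqrt (Nat.cast_nonneg _)]
    exact mul_inv_le_one
  · intro i _ hi; simp [layerVec, hi]
  · simp

lemma layerComp_layerVec {n : ℕ} {j : Fin 3} (h : 0 < r n j) :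
    layerComp r n j (fun s => (layerVec r n j s : ℂ)) = 1 := by
  unfold layerComp
  rw [Fintype.sum_sigma, Finset.sum_eq_single j]
  · simp only [layerVec, if_true, Finset.sum_const, Finset.card_univ, Fintype.card_fin,
      nsmul_eq_mul]
    have h1 : (√(r n j) : ℝ) * √(r n j) = r n j := Real.mul_self_sqrt (Nat.cast_nonneg _)
    have h2 : ((r n j : ℕ) : ℝ) ≠ 0 := by exact_mod_cast h.ne'
    rw [← Complex.ofReal_mul, ← mul_inv, h1]
    rw [← Complex.ofReal_natCast, ← Complex.ofReal_mul, mul_inv_cancel₀ h2, Complex.ofReal_one]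
  · intro i _ hi; simp [layerVec, hi]
  · simp

lemma coupling_eq (n m : ℕ) (s : Shell r n) (t : Shell r m) :
    coupling r ⟨n, s⟩ ⟨m, t⟩ = (if m = n + 1 then layerVec r n 2 s * layerVec r m 0 t else 0) +
      if n = m + 1 then layerVec r n 0 s * layerVec r m 2 t else 0 := by
  obtain ⟨j, s⟩ := s
  obtain ⟨i, t⟩ := t
  unfold coupling layerVec
  dsimp only
  by_cases h1 : m = n + 1
  · have h2 : ¬ n = m + 1 := by omega
    subst h1
    by_cases hj : j = 2 <;> by_cases hi : i = 0 <;> simp [h2, hj, hi, mul_comm]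
  · by_cases h2 : n = m + 1
    · subst h2
      by_cases hj : j = 0 <;> by_cases hi : i = 2 <;> simp [h1, hj, hi, mul_comm]
    · simp [h1, h2]

lemma coupling_symm (x y : Vertex r) : coupling r x y = coupling r y x := by
  unfold coupling
  rw [mul_comm (√(r x.1 x.2.1))]
  congr 1
  exact propext or_comm

lemma sum_coupling (f : Vertex r → ℂ) (n : ℕ) (s : Shell r n) :
    ∑ y ∈ shells r (n + 2), (coupling r ⟨n, s⟩ y : ℂ) * f y
      = layerVec r n 0 s * (bond f n).2 + layerVec r n 2 s * (bond f (n + 1)).1 := by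
  unfold shells
  rw [Finset.sum_sigma]
  simp only [coupling_eq, Complex.ofReal_add, add_mul, Finset.sum_add_distrib]
  rw [add_comm]
  congr 1
  · cases n with
    | zero =>
      simp [bond]
    | succ n =>
      rw [Finset.sum_eq_single n]
      · simp [bond, layerComp, Finset.mul_sum, mul_assoc]
      · intro m _ hm
        have : ¬ n = m := fun h => hm h.symm
        simp [this]
      · intro h; exact absurd (Finset.mem_range.2 (by omega)) h
  · rw [Finset.sum_eq_single (n + 1)]
    · simp [bond, layerComp, Finset.mul_sum, mul_assoc]
    · intro m _ hm
      simp [hm]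
    · simp

variable {C : Vertex r → Vertex r → ℝ}

lemma IsShellMatrix.adj_eq_zero (hC : IsShellMatrix r C) (x y : Vertex r)
    (hy : y ∉ shells r (x.1 + 2)) : coupling r x y + C x y = 0 := by
  rw [mem_shells] at hy
  obtain ⟨n, s⟩ := x
  obtain ⟨m, t⟩ := y
  dsimp only at hy
  rw [coupling_eq, hC.block _ _ (by dsimp only; omega), if_neg (by omega), if_neg (by omega)]
  simp

lemma IsShellMatrix.sum_shells (hC : IsShellMatrix r C) (f : Vertex r → ℂ) (n : ℕ)
    (s : Shell r n) : ∑ y ∈ shells r (n + 2), (C ⟨n, s⟩ y : ℂ) * f y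
      = ∑ t : Shell r n, (C ⟨n, s⟩ ⟨n, t⟩ : ℂ) * f ⟨n, t⟩ := by
  unfold shells
  rw [Finset.sum_sigma, Finset.sum_eq_single n]
  · intro m _ hm
    apply Finset.sum_eq_zero fun t _ => ?_
    rw [hC.block _ _ (Ne.symm hm)]; simp
  · simp

/-- The action of the operator on a shell: besides the shell operator there are the two rank one
terms coupling the shell to its neighbours. -/
lemma IsSchrodinger.apply_shell {v : Vertex r → ℝ} {H : L2 (Vertex r) →L[ℂ] L2 (Vertex r)}
    (hC : IsShellMatrix r C) (hH : IsSchrodinger (fun x y => coupling r x y + C x y) v H)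
    (ψ : L2 (Vertex r)) (n : ℕ) (s : Shell r n) :
    H ψ ⟨n, s⟩ = ∑ t : Shell r n, (C ⟨n, s⟩ ⟨n, t⟩ : ℂ) * ψ ⟨n, t⟩ + v ⟨n, s⟩ * ψ ⟨n, s⟩ +
      layerVec r n 0 s * (bond ψ n).2 + layerVec r n 2 s * (bond ψ (n + 1)).1 := by
  rw [hH, tsum_eq_sum (s := shells r (n + 2))
    (fun y hy => by
      have := hC.adj_eq_zero ⟨n, s⟩ y hy
      dsimp only
      rw [this]; simp)]
  simp only [Complex.ofReal_add, add_mul, Finset.sum_add_distrib]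
  rw [sum_coupling, hC.sum_shells]
  ring

lemma IsShellMatrix.isSelfAdjoint {v : Vertex r → ℝ} {H : L2 (Vertex r) →L[ℂ] L2 (Vertex r)}
    (hC : IsShellMatrix r C) (hH : IsSchrodinger (fun x y => coupling r x y + C x y) v H) :
    IsSelfAdjoint H :=
  hH.isSelfAdjoint (N := fun x => shells r (x.1 + 2))
    (fun x y => by rw [coupling_symm, hC.symm]) hC.adj_eq_zero

lemma IsShellMatrix.exists_isSchrodinger (hr0 : ∀ n j, Fin (r n j) → 0 < r n j)
    (hC : IsShellMatrix r C) {v : Vertex r → ℝ} {c' : ℝ} (hv : ∀ x, |v x| ≤ c') (hc' : 0 ≤ c') :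
    ∃ H, IsSchrodinger (fun x y => coupling r x y + C x y) v H := by
  obtain ⟨κ, hκ0, hκ⟩ := hC.bound
  refine PartialAntitree.exists_isSchrodinger (w := fun x => (√(r x.1 x.2.1))⁻¹)
    (N := fun x => shells r (x.1 + 2)) (c := 2 + κ) (c' := c') (fun x => ?_) (by positivity)
    (fun x y => by rw [coupling_symm, hC.symm]) hC.adj_eq_zero ?_ hc' hv
  · have : (0 : ℝ) < r x.1 x.2.1 := by exact_mod_cast hr0 _ _ x.2.2
    positivity
  · rintro ⟨n, s⟩
    dsimp only
    have h1 : ∑ y ∈ shells r (n + 2), |C ⟨n, s⟩ y| * (√(r y.1 y.2.1))⁻¹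
        ≤ κ * (√(r n s.1))⁻¹ := by
      refine le_trans (le_of_eq ?_) (hκ n s)
      unfold shells
      rw [Finset.sum_sigma, Finset.sum_eq_single n]
      · intro m _ hm
        apply Finset.sum_eq_zero fun t _ => ?_
        rw [hC.block _ _ (Ne.symm hm)]; simp
      · simp
    have hs0 : 0 ≤ (√(r n s.1))⁻¹ := by positivity
    have h2 : ∑ y ∈ shells r (n + 2), coupling r ⟨n, s⟩ y * (√(r y.1 y.2.1))⁻¹
        ≤ 2 * (√(r n s.1))⁻¹ := by
      unfold shells
      rw [Finset.sum_sigma]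
      simp only [coupling_eq, add_mul, Finset.sum_add_distrib]
      have hb : ∀ j i m, layerVec r n j s * ∑ t : Shell r m,
          layerVec r m i t * (√(r m t.1))⁻¹ ≤ (√(r n s.1))⁻¹ := by
        intro j i m
        calc _ ≤ layerVec r n j s * 1 :=
              mul_le_mul_of_nonneg_left (sum_layerVec_weight m i) (layerVec_nonneg _ _ _)
          _ ≤ _ := by rw [mul_one]; exact layerVec_le _ _ _
      have e1 : ∑ m ∈ Finset.range (n + 2), ∑ t : Shell r m,
          (if m = n + 1 then layerVec r n 2 s * layerVec r m 0 t else 0) * (√(r m t.1))⁻¹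
          ≤ (√(r n s.1))⁻¹ := by
        rw [Finset.sum_eq_single (n + 1)]
        · refine le_trans (le_of_eq ?_) (hb 2 0 (n + 1))
          simp [Finset.mul_sum, mul_assoc]
        · intro m _ hm; simp [hm]
        · simp
      have e2 : ∑ m ∈ Finset.range (n + 2), ∑ t : Shell r m,
          (if n = m + 1 then layerVec r n 0 s * layerVec r m 2 t else 0) * (√(r m t.1))⁻¹
          ≤ (√(r n s.1))⁻¹ := by
        rcases Nat.eq_zero_or_pos n with h0 | h0
        · subst h0
          simp
        · rw [Finset.sum_eq_single (n - 1)]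
          · refine le_trans (le_of_eq ?_) (hb 0 2 (n - 1))
            have : n = n - 1 + 1 := by omega
            simp only [if_pos this]
            simp [Finset.mul_sum, mul_assoc]
          · intro m _ hm
            have : ¬ n = m + 1 := by omega
            simp [this]
          · intro h; exact absurd (Finset.mem_range.2 (by omega)) h
      linarith
    have hcn : ∀ y, 0 ≤ coupling r ⟨n, s⟩ y := by
      intro y; unfold coupling; split_ifs <;> positivity
    calc ∑ y ∈ shells r (n + 2), |coupling r ⟨n, s⟩ y + C ⟨n, s⟩ y| * (√(r y.1 y.2.1))⁻¹
        ≤ ∑ y ∈ shells r (n + 2), (coupling r ⟨n, s⟩ y * (√(r y.1 y.2.1))⁻¹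
          + |C ⟨n, s⟩ y| * (√(r y.1 y.2.1))⁻¹) := by
          refine Finset.sum_le_sum fun y _ => ?_
          rw [← add_mul]
          apply mul_le_mul_of_nonneg_right _ (by positivity)
          refine (abs_add_le _ _).trans ?_
          rw [abs_of_nonneg (hcn y)]
      _ ≤ (2 + κ) * (√(r n s.1))⁻¹ := by
          rw [Finset.sum_add_distrib]
          linarith

end ShellAction

/-! ### Transfer matrices -/

/-- The transfer matrix of a shell with the Green numbers `α`, `β`, `δ` and with `γ` in the role
of `β⁻¹`, applied to a vector. -/
def transfer (α γ β δ : ℂ) (v : ℂ × ℂ) : ℂ × ℂ :=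
  (-(γ * (v.1 + α * v.2)), δ * γ * (v.1 + α * v.2) - β * v.2)

/-- The product of the transfer matrices of the shells `N, …, N + m - 1`, applied to a vector. -/
def tail (α γ β δ : ℕ → ℂ) (N : ℕ) (e : ℂ × ℂ) : ℕ → ℂ × ℂ
  | 0 => e
  | m + 1 => transfer (α (N + m)) (γ (N + m)) (β (N + m)) (δ (N + m)) (tail α γ β δ N e m)

/-- The squared Euclidean norm of a vector in `ℂ²`. -/
def sqNorm (v : ℂ × ℂ) : ℝ := ‖v.1‖ ^ 2 + ‖v.2‖ ^ 2

/-- The squared Hilbert–Schmidt norm of the product of the transfer matrices of the shells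
`N, …, N + m - 1`. -/
def growth (α γ β δ : ℕ → ℂ) (N m : ℕ) : ℝ :=
  sqNorm (tail α γ β δ N (1, 0) m) + sqNorm (tail α γ β δ N (0, 1) m)

/-- The average of `growth` over the first `M` lengths. -/
def avgGrowth (α γ β δ : ℕ → ℂ) (N M : ℕ) : ℝ :=
  (1 / (M : ℝ)) * ∑ m ∈ Finset.range M, growth α γ β δ N m

lemma sqNorm_nonneg (v : ℂ × ℂ) : 0 ≤ sqNorm v := by unfold sqNorm; positivity

lemma growth_nonneg (α γ β δ : ℕ → ℂ) (N m : ℕ) : 0 ≤ growth α γ β δ N m :=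
  add_nonneg (sqNorm_nonneg _) (sqNorm_nonneg _)

lemma avgGrowth_nonneg (α γ β δ : ℕ → ℂ) (N m : ℕ) : 0 ≤ avgGrowth α γ β δ N m :=
  mul_nonneg (by positivity) (Finset.sum_nonneg fun _ _ => growth_nonneg _ _ _ _ _ _)

/-- The determinant of the matrix with the columns `v` and `w`. -/
def wronskian (v w : ℂ × ℂ) : ℂ := v.1 * w.2 - v.2 * w.1

lemma norm_wronskian_sq_le (v w : ℂ × ℂ) : ‖wronskian v w‖ ^ 2 ≤ sqNorm v * sqNorm w := by
  unfold wronskian sqNorm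
  have h1 : ‖v.1 * w.2 - v.2 * w.1‖ ≤ ‖v.1‖ * ‖w.2‖ + ‖v.2‖ * ‖w.1‖ := by
    refine (norm_sub_le _ _).trans ?_
    rw [norm_mul, norm_mul]
  calc ‖v.1 * w.2 - v.2 * w.1‖ ^ 2 ≤ (‖v.1‖ * ‖w.2‖ + ‖v.2‖ * ‖w.1‖) ^ 2 :=
        pow_le_pow_left₀ (norm_nonneg _) h1 2
    _ ≤ _ := by nlinarith [sq_nonneg (‖v.1‖ * ‖w.1‖ - ‖v.2‖ * ‖w.2‖)]

/-- The transfer matrix has the determinant `γβ`, which is one where `γ` inverts `β`. -/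
lemma wronskian_transfer {α γ β δ : ℂ} (h : γ * β = 1) (v w : ℂ × ℂ) :
    wronskian (transfer α γ β δ v) (transfer α γ β δ w) = wronskian v w := by
  unfold wronskian transfer
  dsimp only
  linear_combination (v.1 * w.2 - v.2 * w.1) * h

lemma wronskian_tail {α γ β δ : ℕ → ℂ} {N : ℕ} (h : ∀ n, N ≤ n → γ n * β n = 1)
    (v w : ℂ × ℂ) (m : ℕ) :
    wronskian (tail α γ β δ N v m) (tail α γ β δ N w m) = wronskian v w := by
  induction m with
  | zero => rfl
  | succ m ih => rw [tail, tail, wronskian_transfer (h _ (Nat.le_add_right _ _)), ih]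

/-- Since the transfer matrices have determinant one, the inverse of their product is bounded by
the product itself. -/
lemma sqNorm_le_growth_mul {α γ β δ : ℕ → ℂ} {N : ℕ} (h : ∀ n, N ≤ n → γ n * β n = 1)
    (e : ℂ × ℂ) (m : ℕ) :
    sqNorm e ≤ growth α γ β δ N m * sqNorm (tail α γ β δ N e m) := by
  have h1 : wronskian (tail α γ β δ N e m) (tail α γ β δ N (0, 1) m) = e.1 := by
    rw [wronskian_tail h]; simp [wronskian]
  have h2 : wronskian (tail α γ β δ N (1, 0) m) (tail α γ β δ N e m) = e.2 := by
    rw [wronskian_tail h]; simp [wronskian]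
  have e1 := norm_wronskian_sq_le (tail α γ β δ N e m) (tail α γ β δ N (0, 1) m)
  have e2 := norm_wronskian_sq_le (tail α γ β δ N (1, 0) m) (tail α γ β δ N e m)
  rw [h1] at e1
  rw [h2] at e2
  unfold growth
  rw [sqNorm]
  linarith

/-- Jensen's inequality: the mean of the squared growth is what independence controls. -/
lemma sq_avgGrowth_le (α γ β δ : ℕ → ℂ) (N M : ℕ) :
    avgGrowth α γ β δ N M ^ 2
      ≤ (1 / (M : ℝ)) * ∑ m ∈ Finset.range M, growth α γ β δ N m ^ 2 := by
  rcases Nat.eq_zero_or_pos M with rfl | hM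
  · simp [avgGrowth]
  have hM' : (0 : ℝ) < M := by exact_mod_cast hM
  have := sq_sum_le_card_mul_sum_sq (s := Finset.range M) (f := fun m => growth α γ β δ N m)
  rw [Finset.card_range] at this
  unfold avgGrowth
  rw [mul_pow]
  calc (1 / (M : ℝ)) ^ 2 * (∑ m ∈ Finset.range M, growth α γ β δ N m) ^ 2
      ≤ (1 / (M : ℝ)) ^ 2 * (M * ∑ m ∈ Finset.range M, growth α γ β δ N m ^ 2) := by gcongr
    _ = _ := by field_simp

/-! ### Solutions of the resolvent equation -/

section Resolvent

variable {r : ℕ → Fin 3 → ℕ} {C : Vertex r → Vertex r → ℝ} {v : Vertex r → ℝ}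
  {H : L2 (Vertex r) →L[ℂ] L2 (Vertex r)}

/-- The numbers `α`, `β`, `δ` are the matrix elements of the resolvent of the shell operator at
`z` with respect to the normalized indicators of the first and the last layer, in the sense that
they solve the equations of the shell with sources along these two vectors. -/
def IsShellGreen (C : Vertex r → Vertex r → ℝ) (n : ℕ) (v : Shell r n → ℝ) (z α β δ : ℂ) : Prop :=
  ∀ (f : Shell r n → ℂ) (p q : ℂ),
    (∀ s, ∑ t : Shell r n, (C ⟨n, s⟩ ⟨n, t⟩ : ℂ) * f t + v s * f s +
      layerVec r n 0 s * p + layerVec r n 2 s * q = z * f s) →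
    layerComp r n 0 f = -(α * p + β * q) ∧ layerComp r n 2 f = -(β * p + δ * q)

/-- The formal action of the operator on functions. -/
def act (C : Vertex r → Vertex r → ℝ) (v : Vertex r → ℝ) (f : Vertex r → ℂ) (x : Vertex r) : ℂ :=
  ∑ t : Shell r x.1, (C x ⟨x.1, t⟩ : ℂ) * f ⟨x.1, t⟩ + v x * f x +
      layerVec r x.1 0 x.2 * (bond f x.1).2 + layerVec r x.1 2 x.2 * (bond f (x.1 + 1)).1

lemma IsSchrodinger.apply_eq_act (hC : IsShellMatrix r C)
    (hH : IsSchrodinger (fun x y => coupling r x y + C x y) v H)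
    (ψ : L2 (Vertex r)) (x : Vertex r) : H ψ x = act C v ψ x :=
  hH.apply_shell hC ψ x.1 x.2

lemma bond_fst (f : Vertex r → ℂ) (n : ℕ) :
    (bond f n).1 = layerComp r n 0 fun s => f ⟨n, s⟩ := by
  cases n <;> rfl

lemma bond_snd_succ (f : Vertex r → ℂ) (n : ℕ) :
    (bond f (n + 1)).2 = layerComp r n 2 fun s => f ⟨n, s⟩ := rfl

lemma layerComp_add (n : ℕ) (j : Fin 3) (f g : Shell r n → ℂ) :
    layerComp r n j (fun s => f s + g s) = layerComp r n j f + layerComp r n j g := by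
  simp [layerComp, mul_add, Finset.sum_add_distrib]

lemma layerComp_smul (n : ℕ) (j : Fin 3) (a : ℂ) (f : Shell r n → ℂ) :
    layerComp r n j (fun s => a * f s) = a * layerComp r n j f := by
  simp only [layerComp, Finset.mul_sum]
  exact Finset.sum_congr rfl fun _ _ => by ring

lemma bond_add (f g : Vertex r → ℂ) (n : ℕ) :
    bond (fun x => f x + g x) n = bond f n + bond g n := by
  cases n <;> simp [bond, layerComp_add]

lemma bond_smul (a : ℂ) (f : Vertex r → ℂ) (n : ℕ) :
    bond (fun x => a * f x) n = a • bond f n := by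
  cases n <;> simp [bond, layerComp_smul]

lemma act_add (f g : Vertex r → ℂ) (x : Vertex r) :
    act C v (fun x => f x + g x) x = act C v f x + act C v g x := by
  simp only [act, bond_add, Prod.fst_add, Prod.snd_add, mul_add, Finset.sum_add_distrib]
  ring

lemma act_smul (a : ℂ) (f : Vertex r → ℂ) (x : Vertex r) :
    act C v (fun x => a * f x) x = a * act C v f x := by
  simp only [act, bond_smul, Prod.smul_fst, Prod.smul_snd, smul_eq_mul, mul_add, Finset.mul_sum]
  congr 1
  · congr 1
    · congr 1
      · exact Finset.sum_congr rfl fun _ _ => by ring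
      · ring
    · ring
  · ring

lemma norm_layerComp_sq_le (n : ℕ) (j : Fin 3) (f : Shell r n → ℂ) :
    ‖layerComp r n j f‖ ^ 2 ≤ ∑ s, ‖f s‖ ^ 2 := by
  have h1 : ‖layerComp r n j f‖ ≤ ∑ s, layerVec r n j s * ‖f s‖ := by
    refine (norm_sum_le _ _).trans (le_of_eq (Finset.sum_congr rfl fun s _ => ?_))
    rw [norm_mul, Complex.norm_real, Real.norm_of_nonneg (layerVec_nonneg _ _ _)]
  have h2 : ∑ s : Shell r n, layerVec r n j s ^ 2 ≤ 1 := by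
    refine le_trans (Finset.sum_le_sum fun s _ => ?_) (sum_layerVec_weight n j)
    rw [sq]
    exact mul_le_mul_of_nonneg_left (layerVec_le _ _ _) (layerVec_nonneg _ _ _)
  calc ‖layerComp r n j f‖ ^ 2 ≤ (∑ s, layerVec r n j s * ‖f s‖) ^ 2 :=
        pow_le_pow_left₀ (norm_nonneg _) h1 2
    _ ≤ (∑ s, layerVec r n j s ^ 2) * ∑ s, ‖f s‖ ^ 2 := Finset.sum_mul_sq_le_sq_mul_sq _ _ _
    _ ≤ 1 * ∑ s, ‖f s‖ ^ 2 :=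
        mul_le_mul_of_nonneg_right h2 (Finset.sum_nonneg fun _ _ => sq_nonneg _)
    _ = _ := one_mul _

/-- The values at the couplings are square summable, with a bound that does not depend on the
sizes of the layers. -/
lemma sum_sqNorm_bond_le (u : L2 (Vertex r)) (L : ℕ) :
    ∑ n ∈ Finset.range L, sqNorm (bond u n) ≤ 2 * ‖u‖ ^ 2 := by
  set g : ℕ → ℝ := fun n => ∑ s : Shell r n, ‖u ⟨n, s⟩‖ ^ 2 with hg
  have hg0 : ∀ n, 0 ≤ g n := fun n => Finset.sum_nonneg fun _ _ => sq_nonneg _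
  have h1 : ∑ n ∈ Finset.range L, g n ≤ ‖u‖ ^ 2 := by
    have := lp.sum_rpow_le_norm_rpow (p := 2) (by norm_num) u (shells r L)
    simp only [ENNReal.toReal_ofNat, Real.rpow_ofNat] at this
    refine le_trans (le_of_eq ?_) this
    unfold shells
    rw [Finset.sum_sigma]
  have h2 : ∑ n ∈ Finset.range L, ‖(bond u n).1‖ ^ 2 ≤ ∑ n ∈ Finset.range L, g n := by
    refine Finset.sum_le_sum fun n _ => ?_
    rw [bond_fst]
    exact norm_layerComp_sq_le _ _ _
  have h3 : ∑ n ∈ Finset.range L, ‖(bond u n).2‖ ^ 2 ≤ ∑ n ∈ Finset.range L, g n := by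
    cases L with
    | zero => simp
    | succ L =>
      rw [Finset.sum_range_succ']
      calc _ ≤ ∑ n ∈ Finset.range L, g n + 0 := by
            refine add_le_add (Finset.sum_le_sum fun n _ => ?_) ?_
            · rw [bond_snd_succ]
              exact norm_layerComp_sq_le _ _ _
            · simp [bond]
        _ ≤ _ := by
            rw [add_zero, Finset.sum_range_succ]
            exact le_add_of_nonneg_right (hg0 _)
  unfold sqNorm
  rw [Finset.sum_add_distrib]
  linarith

/-- Outside the support of the source, solutions of the resolvent equation are propagated by the
transfer matrices. -/
lemma bond_succ_eq_transfer (hC : IsShellMatrix r C)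
    (hH : IsSchrodinger (fun x y => coupling r x y + C x y) v H)
    {u ψ : L2 (Vertex r)} {z α γ β δ : ℂ} (hu : H u - z • u = ψ) {n : ℕ}
    (hψ : ∀ s : Shell r n, ψ ⟨n, s⟩ = 0)
    (hG : IsShellGreen C n (fun s => v ⟨n, s⟩) z α β δ) (hγ : γ * β = 1) :
    bond u (n + 1) = transfer α γ β δ (bond u n) := by
  obtain ⟨h1, h2⟩ := hG (fun s => u ⟨n, s⟩) (bond u n).2 (bond u (n + 1)).1 (fun s => by
    have h := hH.apply_shell hC u n s
    have h' : H u ⟨n, s⟩ - z * u ⟨n, s⟩ = ψ ⟨n, s⟩ := by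
      rw [← hu]; rfl
    rw [hψ s] at h'
    rw [← h]
    linear_combination h')
  rw [← bond_fst] at h1
  rw [← bond_snd_succ] at h2
  ext
  · rw [transfer]
    linear_combination γ * h1 - (bond u (n + 1)).1 * hγ
  · rw [transfer]
    linear_combination h2 - δ * γ * h1 + δ * (bond u (n + 1)).1 * hγ

/-- Beyond the support of the source, a solution of the resolvent equation is determined by its
values at one coupling. -/
lemma bond_eq_tail (hC : IsShellMatrix r C)
    (hH : IsSchrodinger (fun x y => coupling r x y + C x y) v H)
    {u ψ : L2 (Vertex r)} {z : ℂ} {α γ β δ : ℕ → ℂ} (hu : H u - z • u = ψ) {N : ℕ}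
    (hψ : ∀ x : Vertex r, N ≤ x.1 → ψ x = 0)
    (hG : ∀ n, N ≤ n → IsShellGreen C n (fun s => v ⟨n, s⟩) z (α n) (β n) (δ n))
    (hγ : ∀ n, N ≤ n → γ n * β n = 1) (m : ℕ) :
    bond u (N + m) = tail α γ β δ N (bond u N) m := by
  induction m with
  | zero => rfl
  | succ m ih =>
    rw [tail, ← ih, ← add_assoc]
    exact bond_succ_eq_transfer hC hH hu (fun s => hψ _ (Nat.le_add_right _ _))
      (hG _ (Nat.le_add_right _ _)) (hγ _ (Nat.le_add_right _ _))

/-- Bounded transfer matrices prevent a solution of the resolvent equation from decaying too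
early: this bounds it at the edge of the support of the source by its norm. -/
lemma sqNorm_bond_le (hC : IsShellMatrix r C)
    (hH : IsSchrodinger (fun x y => coupling r x y + C x y) v H)
    {u ψ : L2 (Vertex r)} {z : ℂ} {α γ β δ : ℕ → ℂ} (hu : H u - z • u = ψ) {N : ℕ}
    (hψ : ∀ x : Vertex r, N ≤ x.1 → ψ x = 0)
    (hG : ∀ n, N ≤ n → IsShellGreen C n (fun s => v ⟨n, s⟩) z (α n) (β n) (δ n))
    (hγ : ∀ n, N ≤ n → γ n * β n = 1) {M : ℕ} (hM : 0 < M) :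
    sqNorm (bond u N) ≤ 2 * avgGrowth α γ β δ N M * ((1 / (M : ℝ)) * ‖u‖ ^ 2) := by
  have hM' : (0 : ℝ) < M := by exact_mod_cast hM
  set b : ℕ → ℝ := fun m => sqNorm (bond u (N + m)) with hb
  have h1 : ∀ m, sqNorm (bond u N) ≤ growth α γ β δ N m * b m := by
    intro m
    have := sqNorm_le_growth_mul (α := α) (δ := δ) hγ (bond u N) m
    rwa [← bond_eq_tail hC hH hu hψ hG hγ m] at this
  have h2 : ∑ m ∈ Finset.range M, b m ≤ 2 * ‖u‖ ^ 2 := by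
    refine le_trans ?_ (sum_sqNorm_bond_le u (N + M))
    rw [Finset.sum_range_add]
    exact le_add_of_nonneg_left (Finset.sum_nonneg fun _ _ => sqNorm_nonneg _)
  -- Cauchy–Schwarz over the shells `N, …, N + M - 1`
  have h3 : (M : ℝ) ^ 2 * sqNorm (bond u N)
      ≤ (∑ m ∈ Finset.range M, growth α γ β δ N m) * ∑ m ∈ Finset.range M, b m := by
    have := Finset.sum_sq_le_sum_mul_sum_of_sq_le_mul (Finset.range M)
      (r := fun _ => √(sqNorm (bond u N))) (f := fun m => growth α γ β δ N m) (g := b)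
      (fun _ _ => growth_nonneg _ _ _ _ _ _) (fun _ _ => sqNorm_nonneg _)
      (fun m _ => by rw [Real.sq_sqrt (sqNorm_nonneg _)]; exact h1 m)
    simp only [Finset.sum_const, Finset.card_range, nsmul_eq_mul] at this
    rwa [mul_pow, Real.sq_sqrt (sqNorm_nonneg _)] at this
  have h4 : (M : ℝ) ^ 2 * sqNorm (bond u N)
      ≤ (∑ m ∈ Finset.range M, growth α γ β δ N m) * (2 * ‖u‖ ^ 2) :=
    h3.trans (mul_le_mul_of_nonneg_left h2 (Finset.sum_nonneg fun _ _ => growth_nonneg _ _ _ _ _ _))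
  unfold avgGrowth
  have : 2 * (1 / (M : ℝ) * ∑ m ∈ Finset.range M, growth α γ β δ N m) * (1 / (M : ℝ) * ‖u‖ ^ 2)
      = ((∑ m ∈ Finset.range M, growth α γ β δ N m) * (2 * ‖u‖ ^ 2)) / (M : ℝ) ^ 2 := by
    field_simp
  rw [this, le_div_iff₀ (by positivity)]
  linarith

end Resolvent

/-! ### The dissipative restriction to finitely many shells -/

section Dissipative

variable {r : ℕ → Fin 3 → ℕ} {C : Vertex r → Vertex r → ℝ} {v : Vertex r → ℝ}
  {H : L2 (Vertex r) →L[ℂ] L2 (Vertex r)}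

/-- The extension by zero of a function on the first `N` shells. -/
def extendZero (r : ℕ → Fin 3 → ℕ) (N : ℕ) (f : shells r N → ℂ) (x : Vertex r) : ℂ :=
  if h : x ∈ shells r N then f ⟨x, h⟩ else 0

lemma extendZero_coe {N : ℕ} (f : shells r N → ℂ) (x : shells r N) :
    extendZero r N f x = f x := by
  simp [extendZero]

lemma extendZero_of_le {N : ℕ} (f : shells r N → ℂ) {x : Vertex r} (hx : N ≤ x.1) :
    extendZero r N f x = 0 := by
  have : x ∉ shells r N := by rw [mem_shells]; omega
  simp [extendZero, this]

lemma extendZero_restrict {N : ℕ} (g : Vertex r → ℂ) {x : Vertex r} (hx : x.1 < N) :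
    extendZero r N (fun y => g y) x = g x := by
  have : x ∈ shells r N := mem_shells.2 hx
  simp [extendZero, this]

/-- The vector through which the shell `N` is coupled to the next one, as a function on
all vertices. -/
def edgeVec (r : ℕ → Fin 3 → ℕ) (N : ℕ) (x : Vertex r) : ℝ :=
  if h : x.1 = N then layerVec r N 2 (h ▸ x.2) else 0

lemma edgeVec_self (N : ℕ) (s : Shell r N) : edgeVec r N ⟨N, s⟩ = layerVec r N 2 s := by
  simp [edgeVec]

lemma edgeVec_of_ne {N : ℕ} {x : Vertex r} (h : x.1 ≠ N) : edgeVec r N x = 0 := by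
  simp [edgeVec, h]

lemma abs_edgeVec_le (N : ℕ) (x : Vertex r) : |edgeVec r N x| ≤ 1 := by
  obtain ⟨n, s⟩ := x
  by_cases h : n = N
  · subst h
    rw [edgeVec_self, abs_of_nonneg (layerVec_nonneg _ _ _)]
    refine (layerVec_le _ _ _).trans ?_
    have : 0 < r n s.1 := Fin.pos s.2
    apply inv_le_one_of_one_le₀
    rw [Real.one_le_sqrt]
    exact_mod_cast this
  · rw [edgeVec_of_ne h]; simp

lemma layerComp_two_eq_sum (f : Vertex r → ℂ) (N : ℕ) :
    (bond f (N + 1)).2 = ∑ x ∈ shells r (N + 1), (edgeVec r N x : ℂ) * f x := by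
  unfold shells
  rw [bond_snd_succ, Finset.sum_sigma, Finset.sum_eq_single N]
  · simp [layerComp, edgeVec_self]
  · intro m _ hm
    exact Finset.sum_eq_zero fun t _ => by rw [edgeVec_of_ne hm]; simp
  · simp

/-- The restriction of the operator to the first `N + 1` shells minus `l`, with the
dissipative term `-i` added along the vector coupling the last of these shells to the next one. -/
def dissipative (C : Vertex r → Vertex r → ℝ) (v : Vertex r → ℝ) (N : ℕ) (l : ℂ) :
    (shells r (N + 1) → ℂ) →ₗ[ℂ] (shells r (N + 1) → ℂ) where
  toFun f x := act C v (extendZero r (N + 1) f) x - l * f x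
    - Complex.I * edgeVec r N x * (bond (extendZero r (N + 1) f) (N + 1)).2
  map_add' f g := by
    ext x
    have : extendZero r (N + 1) (f + g)
        = fun x => extendZero r (N + 1) f x + extendZero r (N + 1) g x := by
      ext x; unfold extendZero; split_ifs <;> simp
    simp only [this, act_add, bond_add, Pi.add_apply, Prod.snd_add]
    ring
  map_smul' a f := by
    ext x
    have : extendZero r (N + 1) (a • f) = fun x => a * extendZero r (N + 1) f x := by
      ext x; unfold extendZero; split_ifs <;> simp
    simp only [this, act_smul, bond_smul, Pi.smul_apply, Prod.smul_snd, smul_eq_mul,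
      RingHom.id_apply]
    ring

lemma bond_fst_eq_zero {f : Vertex r → ℂ} {n : ℕ} (h : ∀ s : Shell r n, f ⟨n, s⟩ = 0) :
    (bond f n).1 = 0 := by
  rw [bond_fst]; simp [layerComp, h]

lemma bond_snd_eq_zero {f : Vertex r → ℂ} {n : ℕ} (h : ∀ s : Shell r n, f ⟨n, s⟩ = 0) :
    (bond f (n + 1)).2 = 0 := by
  rw [bond_snd_succ]; simp [layerComp, h]

/-- A finitely supported function as an element of the Hilbert space. -/
def finL2 {G : Type} (f : G → ℂ) (hf : {x | f x ≠ 0}.Finite) : L2 G :=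
  ⟨f, (memℓp_zero hf).of_exponent_ge bot_le⟩

lemma finite_extendZero {N : ℕ} (f : shells r N → ℂ) :
    {x | extendZero r N f x ≠ 0}.Finite := by
  refine (shells r N).finite_toSet.subset fun x hx => ?_
  by_contra h
  rw [Finset.mem_coe] at h
  exact hx (by simp only [extendZero]; rw [dif_neg h])

/-- The kernel of the dissipative restriction consists of eigenfunctions of the whole operator:
the imaginary part of the quadratic form shows that they are not seen by the next shell. -/
lemma ker_dissipative (hC : IsShellMatrix r C)
    (hH : IsSchrodinger (fun x y => coupling r x y + C x y) v H) {N : ℕ} {l : ℝ}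
    (hl : l ∉ finSuppEigenvalues H) : LinearMap.ker (dissipative C v N l) = ⊥ := by
  rw [LinearMap.ker_eq_bot']
  intro f hf
  set g := extendZero r (N + 1) f with hg
  set G : L2 (Vertex r) := finL2 g (finite_extendZero f) with hG
  have hGg : ∀ x, G x = g x := fun x => rfl
  have hGg' : (G : Vertex r → ℂ) = g := rfl
  have hx : ∀ x : Vertex r, x.1 < N + 1 →
      act C v g x - l * g x - Complex.I * edgeVec r N x * (bond g (N + 1)).2 = 0 := by
    intro x hx
    have := congrFun hf ⟨x, mem_shells.2 hx⟩
    have e : f ⟨x, mem_shells.2 hx⟩ = g x := (extendZero_coe f ⟨x, mem_shells.2 hx⟩).symm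
    rw [← e]
    exact this
  set y := (bond g (N + 1)).2 with hy
  have hsum : ∑ x ∈ shells r (N + 1), starRingEnd ℂ (g x) * act C v g x
      - l * ∑ x ∈ shells r (N + 1), starRingEnd ℂ (g x) * g x
      - Complex.I * (starRingEnd ℂ y * y) = 0 := by
    have : starRingEnd ℂ y = ∑ x ∈ shells r (N + 1), (edgeVec r N x : ℂ) * starRingEnd ℂ (g x) := by
      rw [hy, layerComp_two_eq_sum, map_sum]
      simp
    rw [this, Finset.sum_mul, Finset.mul_sum, Finset.mul_sum, ← Finset.sum_sub_distrib,
      ← Finset.sum_sub_distrib]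
    apply Finset.sum_eq_zero
    intro x hx'
    have := hx x (mem_shells.1 hx')
    linear_combination starRingEnd ℂ (g x) * this
  have hin : inner ℂ G (H G) = ∑ x ∈ shells r (N + 1), starRingEnd ℂ (g x) * act C v g x := by
    rw [lp.inner_eq_tsum, tsum_eq_sum (s := shells r (N + 1))]
    · refine Finset.sum_congr rfl fun x _ => ?_
      rw [RCLike.inner_apply, hH.apply_eq_act hC, hGg', mul_comm]
    · intro x hx'
      rw [hGg, hg, extendZero_of_le f (by rw [mem_shells] at hx'; omega)]
      simp
  have hre : (inner ℂ G (H G)).im = 0 := by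
    have hs := (hC.isSelfAdjoint hH).isSymmetric G G
    simp only [ContinuousLinearMap.coe_coe] at hs
    have h2 : (inner ℂ G (H G)).im = -(inner ℂ G (H G)).im := by
      conv_lhs => rw [← hs, ← inner_conj_symm]
      rw [Complex.conj_im]
    linarith
  have hgg : (∑ x ∈ shells r (N + 1), starRingEnd ℂ (g x) * g x).im = 0 := by
    rw [Complex.im_sum]
    refine Finset.sum_eq_zero fun x _ => ?_
    rw [mul_comm, Complex.mul_conj]; simp
  have hyy : y = 0 := by
    have := congrArg Complex.im hsum
    rw [← hin, mul_comm (starRingEnd ℂ y), Complex.mul_conj] at this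
    simp only [Complex.sub_im, Complex.mul_im, Complex.ofReal_re, Complex.ofReal_im, hre, hgg,
      Complex.I_re, Complex.I_im, Complex.zero_im] at this
    have : Complex.normSq y = 0 := by linarith
    exact Complex.normSq_eq_zero.1 this
  have hev : H G = (l : ℂ) • G := by
    ext x
    rw [hH.apply_eq_act hC, hGg']
    change act C v g x = (l : ℂ) * g x
    rcases lt_or_ge x.1 (N + 1) with h | h
    · have := hx x h
      rw [hyy] at this
      linear_combination this
    · have hz : ∀ n, N + 1 ≤ n → ∀ s : Shell r n, g ⟨n, s⟩ = 0 :=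
        fun n hn s => extendZero_of_le f hn
      have b2 : (bond g x.1).2 = 0 := by
        rcases h.eq_or_lt with h1 | h1
        · rw [← h1]; exact hyy
        · obtain ⟨k, hk⟩ : ∃ k, x.1 = k + 1 := ⟨x.1 - 1, by omega⟩
          rw [hk]
          exact bond_snd_eq_zero (hz k (by omega))
      have b1 : (bond g (x.1 + 1)).1 = 0 := bond_fst_eq_zero (hz _ (by omega))
      have hgx : g x = 0 := extendZero_of_le f h
      rw [act, b1, b2, hgx]
      simp [hz x.1 h]
  by_contra hne
  apply hl
  refine ⟨G, ?_, finite_extendZero f, hev⟩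
  intro h0
  apply hne
  ext x
  have : G x = 0 := by rw [h0]; rfl
  rw [hGg, hg, extendZero_coe] at this
  exact this

/-- The equation satisfied on the first `N + 1` shells by a solution of the resolvent
equation. -/
lemma dissipative_restrict (hC : IsShellMatrix r C)
    (hH : IsSchrodinger (fun x y => coupling r x y + C x y) v H) {N : ℕ} {l z : ℂ}
    {u ψ : L2 (Vertex r)} (hu : H u - z • u = ψ) (x : shells r (N + 1)) :
    dissipative C v N l (fun y => u y) x = ψ x + (z - l) * u x
      - edgeVec r N x * ((bond u (N + 1)).1 + Complex.I * (bond u (N + 1)).2) := by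
  have hx := mem_shells.1 x.2
  set g := extendZero r (N + 1) (fun y => u y) with hg
  have hgu : ∀ n, n < N + 1 → ∀ s : Shell r n, g ⟨n, s⟩ = u ⟨n, s⟩ := fun n hn s =>
    extendZero_restrict (fun y => u y) hn
  have hb2 : ∀ n, n ≤ N + 1 → (bond g n).2 = (bond u n).2 := by
    intro n hn
    cases n with
    | zero => rfl
    | succ n => rw [bond_snd_succ, bond_snd_succ]; simp only [hgu n (by omega)]
  have hb1 : ∀ n, n < N + 1 → (bond g n).1 = (bond u n).1 := by
    intro n hn
    rw [bond_fst, bond_fst]; simp only [hgu n hn]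
  have hb0 : (bond g (N + 1)).1 = 0 := bond_fst_eq_zero fun s =>
    extendZero_of_le _ (le_refl (N + 1))
  have hact : act C v g x = act C v u x - edgeVec r N x * (bond u (N + 1)).1 := by
    obtain ⟨⟨n, s⟩, hxm⟩ := x
    dsimp only at hx ⊢
    simp only [act]
    rw [hb2 n (by omega)]
    simp only [hgu n hx]
    rcases (Nat.lt_succ_iff.1 hx).eq_or_lt with h | h
    · subst h
      rw [hb0, edgeVec_self]; ring
    · rw [hb1 _ (by omega), edgeVec_of_ne (by dsimp only; omega)]
      simp
  have hψ : ψ x = act C v u x - z * u x := by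
    rw [← hH.apply_eq_act hC, ← hu]; rfl
  change act C v g x - l * u x - Complex.I * edgeVec r N x * (bond g (N + 1)).2 = _
  rw [hact, hb2 _ le_rfl, hψ]
  ring

lemma norm_fst_le_sqrt (b : ℂ × ℂ) : ‖b.1‖ ≤ √(sqNorm b) :=
  Real.le_sqrt_of_sq_le (by unfold sqNorm; nlinarith [sq_nonneg ‖b.2‖])

lemma norm_snd_le_sqrt (b : ℂ × ℂ) : ‖b.2‖ ≤ √(sqNorm b) :=
  Real.le_sqrt_of_sq_le (by unfold sqNorm; nlinarith [sq_nonneg ‖b.1‖])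

/-- Near an energy that is not an eigenvalue with a finitely supported eigenfunction, the Poisson
integral of the spectral measure of a vector supported in the first shells is controlled by the
solution at the edge of these shells. -/
lemma poisson_le_of_bond (hC : IsShellMatrix r C)
    (hH : IsSchrodinger (fun x y => coupling r x y + C x y) v H) {N : ℕ} {l₀ : ℝ}
    (hl : l₀ ∉ finSuppEigenvalues H) {ψ : L2 (Vertex r)}
    (hψ : ∀ x : Vertex r, N + 1 ≤ x.1 → ψ x = 0) :
    ∃ ρ > 0, ∃ c > 0, ∀ (l η : ℝ) (u : L2 (Vertex r)), |l - l₀| < ρ → 0 < η → η < ρ →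
      H u - ((l : ℂ) + η * Complex.I) • u = ψ →
      η * ‖u‖ ^ 2 ≤ c * (1 + √(sqNorm (bond u (N + 1)))) := by
  obtain ⟨K, hK0, hK⟩ := LinearMap.exists_antilipschitzWith _ (ker_dissipative (N := N) hC hH hl)
  have hK0' : (0 : ℝ) < K := hK0
  set S := ∑ x ∈ shells r (N + 1), ‖ψ x‖ with hS
  have hS0 : 0 ≤ S := Finset.sum_nonneg fun _ _ => norm_nonneg _
  refine ⟨1 / (4 * K), by positivity, 1 + S * (2 * K * (‖ψ‖ + 2)), by positivity, ?_⟩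
  intro l η u hl' hη hη' hu
  set z : ℂ := (l : ℂ) + η * Complex.I with hz
  set b := √(sqNorm (bond u (N + 1))) with hb
  have hb0 : 0 ≤ b := Real.sqrt_nonneg _
  set f : shells r (N + 1) → ℂ := fun y => u y with hf
  have hzl : ‖z - l₀‖ ≤ 1 / (2 * K) := by
    have : z - l₀ = ((l - l₀ : ℝ) : ℂ) + (η : ℂ) * Complex.I := by rw [hz]; push_cast; ring
    rw [this]
    refine (norm_add_le _ _).trans ?_
    rw [norm_mul, Complex.norm_I, Complex.norm_real, Complex.norm_real, Real.norm_eq_abs,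
      Real.norm_of_nonneg hη.le, mul_one]
    have : 1 / (2 * (K : ℝ)) = 1 / (4 * K) + 1 / (4 * K) := by field_simp; norm_num
    linarith
  have hD : ‖dissipative C v N l₀ f‖ ≤ ‖ψ‖ + ‖z - l₀‖ * ‖f‖ + 2 * b := by
    rw [pi_norm_le_iff_of_nonneg (by positivity)]
    intro x
    rw [dissipative_restrict hC hH hu]
    refine (norm_sub_le _ _).trans (add_le_add ((norm_add_le _ _).trans (add_le_add ?_ ?_)) ?_)
    · exact lp.norm_apply_le_norm (by norm_num) ψ x
    · rw [norm_mul]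
      exact mul_le_mul_of_nonneg_left (norm_le_pi_norm f x) (norm_nonneg _)
    · rw [norm_mul, Complex.norm_real, Real.norm_eq_abs]
      calc _ ≤ 1 * (b + b) := by
            apply mul_le_mul (abs_edgeVec_le _ _) _ (norm_nonneg _) zero_le_one
            refine (norm_add_le _ _).trans (add_le_add (norm_fst_le_sqrt _) ?_)
            rw [norm_mul, Complex.norm_I, one_mul]
            exact norm_snd_le_sqrt _
        _ = 2 * b := by ring
  have hfD : ‖f‖ ≤ K * ‖dissipative C v N l₀ f‖ := by
    have := hK.le_mul_dist f 0
    simpa using this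
  -- `‖z - l₀‖ ≤ 1 / (2 K)` lets the term with `‖f‖` be absorbed on the left
  have hfb : ‖f‖ ≤ 2 * K * (‖ψ‖ + 2) * (1 + b) := by
    have h1 : ‖z - l₀‖ * ‖f‖ ≤ 1 / (2 * K) * ‖f‖ :=
      mul_le_mul_of_nonneg_right hzl (norm_nonneg _)
    have h2 : ‖f‖ ≤ K * (‖ψ‖ + 1 / (2 * K) * ‖f‖ + 2 * b) :=
      hfD.trans (mul_le_mul_of_nonneg_left (hD.trans (by linarith)) hK0'.le)
    have h3 : K * (‖ψ‖ + 1 / (2 * K) * ‖f‖ + 2 * b) = K * (‖ψ‖ + 2 * b) + ‖f‖ / 2 := by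
      field_simp
      ring
    have h4 : ‖f‖ ≤ 2 * K * (‖ψ‖ + 2 * b) := by linarith
    refine h4.trans ?_
    have h5 : ‖ψ‖ + 2 * b ≤ (‖ψ‖ + 2) * (1 + b) := by nlinarith [norm_nonneg ψ]
    calc 2 * K * (‖ψ‖ + 2 * b) ≤ 2 * K * ((‖ψ‖ + 2) * (1 + b)) := by gcongr
      _ = _ := by ring
  have hin : ‖inner ℂ u ψ‖ ≤ S * ‖f‖ := by
    rw [lp.inner_eq_tsum, tsum_eq_sum (s := shells r (N + 1))]
    · refine (norm_sum_le _ _).trans ?_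
      rw [hS, Finset.sum_mul]
      refine Finset.sum_le_sum fun x hx => ?_
      rw [RCLike.inner_apply, norm_mul, RCLike.norm_conj]
      exact mul_le_mul_of_nonneg_left (norm_le_pi_norm f ⟨x, hx⟩) (norm_nonneg _)
    · intro x hx'
      rw [hψ x (by rw [mem_shells] at hx'; omega)]
      simp
  -- since `H` is symmetric, the Poisson integral is the imaginary part of `⟨ψ, u⟩`
  have him : (inner ℂ u ψ).im = -(η * ‖u‖ ^ 2) := by
    have hs := (hC.isSelfAdjoint hH).isSymmetric u u
    simp only [ContinuousLinearMap.coe_coe] at hs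
    have h2 : (inner ℂ u (H u)).im = -(inner ℂ u (H u)).im := by
      conv_lhs => rw [← hs, ← inner_conj_symm]
      rw [Complex.conj_im]
    have h3 : (inner ℂ u (H u)).im = 0 := by linarith
    rw [← hu, inner_sub_right, inner_smul_right, inner_self_eq_norm_sq_to_K, Complex.sub_im, h3]
    have : ((z * ((‖u‖ : ℝ) : ℂ) ^ 2)).im = η * ‖u‖ ^ 2 := by
      rw [hz, ← Complex.ofReal_pow, Complex.mul_im, Complex.ofReal_re, Complex.ofReal_im]
      simp
    rw [show (0 : ℝ) - _ = _ from zero_sub _]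
    exact congrArg _ this
  calc η * ‖u‖ ^ 2 ≤ ‖inner ℂ u ψ‖ := by
        have := Complex.abs_im_le_norm (inner ℂ u ψ)
        rw [him, abs_neg] at this
        exact (le_abs_self _).trans this
    _ ≤ S * (2 * K * (‖ψ‖ + 2) * (1 + b)) := hin.trans (mul_le_mul_of_nonneg_left hfb hS0)
    _ ≤ (1 + S * (2 * K * (‖ψ‖ + 2))) * (1 + b) := by nlinarith

end Dissipative

/-! ### From bounded transfer matrices to absolutely continuous spectrum -/

section Criterion

variable {r : ℕ → Fin 3 → ℕ} {C : Vertex r → Vertex r → ℝ} {v : Vertex r → ℝ}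
  {H : L2 (Vertex r) →L[ℂ] L2 (Vertex r)}

/-- The energy `l + i / M`. -/
def energy (M : ℕ) (l : ℝ) : ℂ := (l : ℂ) + ((1 / (M : ℝ) : ℝ) : ℂ) * Complex.I

/-- The potential `v` admits transfer matrices at the energies close to `[a, b]` in the shells
`n ≥ N`, and the products of these, starting at the shell `N`, are bounded in a mean sense along a
sequence of energies approaching the real axis. -/
structure HasBoundedTail (C : Vertex r → Vertex r → ℝ) (v : Vertex r → ℝ) (a b : ℝ) (N : ℕ)
    (α γ β δ : ℂ → ℕ → ℂ) : Prop where
  green : ∃ η₀ : ℝ, 0 < η₀ ∧ ∀ l ∈ Icc a b, ∀ η : ℝ, 0 < η → η ≤ η₀ → ∀ n, N ≤ n →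
    IsShellGreen C n (fun s => v ⟨n, s⟩) ((l : ℂ) + (η : ℂ) * Complex.I)
      (α ((l : ℂ) + (η : ℂ) * Complex.I) n) (β ((l : ℂ) + (η : ℂ) * Complex.I) n)
      (δ ((l : ℂ) + (η : ℂ) * Complex.I) n) ∧
    γ ((l : ℂ) + (η : ℂ) * Complex.I) n * β ((l : ℂ) + (η : ℂ) * Complex.I) n = 1
  growth : ∃ L : ℝ≥0, ∃ᶠ M : ℕ in atTop, ∫⁻ l in Icc a b,
    ENNReal.ofReal (avgGrowth (α (energy M l)) (γ (energy M l)) (β (energy M l)) (δ (energy M l))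
      N M ^ 2) ≤ L

lemma eventually_one_div_lt {ε : ℝ} (hε : 0 < ε) :
    ∀ᶠ M : ℕ in atTop, 0 < M ∧ 1 / (M : ℝ) < ε := by
  obtain ⟨n, hn⟩ := exists_nat_one_div_lt hε
  filter_upwards [eventually_ge_atTop (n + 1)] with M hM
  have hM0 : 0 < M := by omega
  refine ⟨hM0, lt_of_le_of_lt ?_ hn⟩
  apply one_div_le_one_div_of_le (by positivity)
  exact_mod_cast hM

lemma exists_resolvent (hsa : IsSelfAdjoint H) (ψ : L2 (Vertex r)) (l : ℝ) {η : ℝ} (hη : 0 < η) :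
    ∃ u, H u - ((l : ℂ) + η * Complex.I) • u = ψ := by
  set z : ℂ := (l : ℂ) + η * Complex.I with hz
  have hz' : z ∉ spectrum ℂ H := by
    intro h
    have := hsa.im_eq_zero_of_mem_spectrum h
    rw [hz] at this
    simp at this
    exact hη.ne' this
  rw [spectrum.notMem_iff] at hz'
  obtain ⟨R, hR⟩ := hz'.exists_right_inv
  refine ⟨-(R ψ), ?_⟩
  have := congrArg (fun A : L2 (Vertex r) →L[ℂ] L2 (Vertex r) => A ψ) hR
  simp only [mul_apply_eq_comp, sub_apply, one_apply_eq_self, Algebra.algebraMap_eq_smul_one,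
    smul_apply] at this
  rw [map_neg, smul_neg]
  refine Eq.trans ?_ this
  abel

variable {a b : ℝ} {N : ℕ} {α γ β δ : ℂ → ℕ → ℂ}

/-- The spectral measures of finitely supported vectors are absolutely continuous near energies
that are not eigenvalues with finitely supported eigenfunctions: their Poisson integrals are
bounded by the mean growth of the transfer matrices. -/
lemma HasBoundedTail.locally_ac (hC : IsShellMatrix r C)
    (hH : IsSchrodinger (fun x y => coupling r x y + C x y) v H)
    (hT : HasBoundedTail C v a b (N + 1) α γ β δ) {l₀ : ℝ} (hl₀ : l₀ ∈ Ioo a b)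
    (hl : l₀ ∉ finSuppEigenvalues H) {ψ : L2 (Vertex r)}
    (hψ : ∀ x : Vertex r, N + 1 ≤ x.1 → ψ x = 0) {μ : Measure ℝ} (hμ : IsSpectralMeasure H ψ μ) :
    ∃ J ∈ 𝓝 l₀, μ.restrict J ≪ volume := by
  have := hμ.1
  have hsa := hC.isSelfAdjoint hH
  obtain ⟨ρ, hρ, c, hc, hP⟩ := poisson_le_of_bond (N := N) hC hH hl hψ
  obtain ⟨η₀, hη₀, hG⟩ := hT.green
  obtain ⟨L, hL⟩ := hT.growth
  set J : Set ℝ := Ioo a b ∩ Metric.ball l₀ ρ with hJ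
  have hJo : IsOpen J := isOpen_Ioo.inter Metric.isOpen_ball
  refine ⟨J, hJo.mem_nhds ⟨hl₀, Metric.mem_ball_self hρ⟩, ?_⟩
  have key : ∀ M : ℕ, 0 < M → 1 / (M : ℝ) < ρ → 1 / (M : ℝ) < η₀ → ∀ l ∈ J,
      poissonIntegral μ (1 / (M : ℝ)) l ^ 2 ≤ ENNReal.ofReal (8 * c ^ 2) +
        ENNReal.ofReal (8 * c ^ 4) * ENNReal.ofReal (avgGrowth (α (energy M l)) (γ (energy M l))
          (β (energy M l)) (δ (energy M l)) (N + 1) M ^ 2) := by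
    intro M hM hMρ hMη l hlJ
    have hη : (0 : ℝ) < 1 / (M : ℝ) := by
      have : (0 : ℝ) < M := by exact_mod_cast hM
      positivity
    obtain ⟨u, hu⟩ := exists_resolvent hsa ψ l hη
    have hlI : l ∈ Icc a b := Ioo_subset_Icc_self hlJ.1
    set A := avgGrowth (α (energy M l)) (γ (energy M l)) (β (energy M l)) (δ (energy M l))
      (N + 1) M with hA
    have hA0 : 0 ≤ A := avgGrowth_nonneg _ _ _ _ _ _
    have h1 := sqNorm_bond_le hC hH hu hψ
      (fun n hn => (hG l hlI _ hη hMη.le n hn).1) (fun n hn => (hG l hlI _ hη hMη.le n hn).2) hM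
    have h2 := hP l _ u (by simpa [Real.dist_eq] using hlJ.2) hη hMρ hu
    set P := 1 / (M : ℝ) * ‖u‖ ^ 2 with hPdef
    set s := √(sqNorm (bond u (N + 1))) with hs
    have hs2 : s ^ 2 ≤ 2 * A * P := by
      rw [hs, Real.sq_sqrt (sqNorm_nonneg _)]; exact h1
    have hP0 : 0 ≤ P := by positivity
    have hs0 : 0 ≤ s := Real.sqrt_nonneg _
    -- `c s ≤ c² A + s² / (4 A)` turns the two bounds into a bound of the Poisson integral by `A`
    have h3 : P ≤ 2 * c + 2 * c ^ 2 * A := by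
      by_contra! hcon
      have h4 : c * s > P - c := by nlinarith
      have h5 : 0 < P - c := by nlinarith [sq_nonneg c, mul_nonneg (sq_nonneg c) hA0]
      have h6 : (P - c) ^ 2 < c ^ 2 * (2 * A * P) := by
        calc (P - c) ^ 2 < (c * s) ^ 2 := by
              apply pow_lt_pow_left₀ h4 h5.le (by norm_num)
          _ = c ^ 2 * s ^ 2 := by ring
          _ ≤ _ := by gcongr
      nlinarith
    have hpo := hμ.poisson hsa hη hu
    have hpo' : poissonIntegral μ (1 / (M : ℝ)) l = ENNReal.ofReal P := hpo
    rw [hpo', ← ENNReal.ofReal_pow hP0, ← ENNReal.ofReal_mul (by positivity),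
      ← ENNReal.ofReal_add (by positivity) (by positivity)]
    apply ENNReal.ofReal_le_ofReal
    calc P ^ 2 ≤ (2 * c + 2 * c ^ 2 * A) ^ 2 := pow_le_pow_left₀ hP0 h3 2
      _ ≤ 8 * c ^ 2 + 8 * c ^ 4 * A ^ 2 := by
        nlinarith [sq_nonneg (2 * c - 2 * c ^ 2 * A)]
  refine restrict_absolutelyContinuous_of_poissonIntegral hJo
    (L := Real.toNNReal (8 * c ^ 2 * (b - a)) + Real.toNNReal (8 * c ^ 4) * L) ?_
  refine (hL.and_eventually ((eventually_one_div_lt hρ).and (eventually_one_div_lt hη₀))).mono ?_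
  rintro M ⟨hML, ⟨hM, hMρ⟩, -, hMη⟩
  have hJI : J ⊆ Icc a b := fun x hx => Ioo_subset_Icc_self hx.1
  calc ∫⁻ l in J, poissonIntegral μ (1 / (M : ℝ)) l ^ 2
      ≤ ∫⁻ l in J, (ENNReal.ofReal (8 * c ^ 2) + ENNReal.ofReal (8 * c ^ 4) *
          ENNReal.ofReal (avgGrowth (α (energy M l)) (γ (energy M l))
          (β (energy M l)) (δ (energy M l)) (N + 1) M ^ 2)) :=
        setLIntegral_mono' hJo.measurableSet (key M hM hMρ hMη)
    _ ≤ ∫⁻ l in Icc a b, (ENNReal.ofReal (8 * c ^ 2) + ENNReal.ofReal (8 * c ^ 4) *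
          ENNReal.ofReal (avgGrowth (α (energy M l)) (γ (energy M l))
          (β (energy M l)) (δ (energy M l)) (N + 1) M ^ 2)) := lintegral_mono_set hJI
    _ ≤ ENNReal.ofReal (8 * c ^ 2 * (b - a)) + ENNReal.ofReal (8 * c ^ 4) * L := by
        rw [lintegral_add_left measurable_const, setLIntegral_const, Real.volume_Icc,
          ← ENNReal.ofReal_mul (by positivity), lintegral_const_mul' _ _ ENNReal.ofReal_ne_top]
        gcongr
    _ = _ := by
        rw [ENNReal.coe_add, ENNReal.coe_mul]; rfl

/-- The interval lies in the spectrum: in a spectral gap the resolvent stays bounded up to the real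
axis, so that the solutions of the resolvent equation would have to decay faster than the transfer
matrices permit. -/
lemma HasBoundedTail.mem_spectrum (hC : IsShellMatrix r C) (hr : 0 < r N 2)
    (hH : IsSchrodinger (fun x y => coupling r x y + C x y) v H)
    (hT : HasBoundedTail C v a b (N + 1) α γ β δ) {l₀ : ℝ} (hl₀ : l₀ ∈ Ioo a b) :
    (l₀ : ℂ) ∈ spectrum ℂ H := by
  by_contra hsp
  have hl : l₀ ∉ finSuppEigenvalues H := by
    rintro ⟨φ, hφ, -, he⟩
    rw [spectrum.notMem_iff] at hsp
    obtain ⟨R, hR⟩ := hsp.exists_left_inv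
    have := congrArg (fun A : L2 (Vertex r) →L[ℂ] L2 (Vertex r) => A φ) hR
    simp only [mul_apply_eq_comp, sub_apply, one_apply_eq_self, Algebra.algebraMap_eq_smul_one,
      smul_apply, he, sub_self, map_zero] at this
    exact hφ this.symm
  obtain ⟨η₀, hη₀, hG⟩ := hT.green
  obtain ⟨L, hL⟩ := hT.growth
  -- a source for which the solution at `l₀` does not vanish at the edge of its support
  set D := dissipative C v N l₀ with hD
  set g : shells r (N + 1) → ℂ := fun x => edgeVec r N x with hg
  set ψ : L2 (Vertex r) := finL2 (extendZero r (N + 1) (D g)) (finite_extendZero _) with hψdef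
  have hψ : ∀ x : Vertex r, N + 1 ≤ x.1 → ψ x = 0 := fun x hx => extendZero_of_le _ hx
  set R : ℂ → L2 (Vertex r) →L[ℂ] L2 (Vertex r) := fun z => Ring.inverse (H - algebraMap ℂ _ z)
    with hR
  have hunit : IsUnit (H - algebraMap ℂ (L2 (Vertex r) →L[ℂ] L2 (Vertex r)) (l₀ : ℂ)) := by
    rw [spectrum.notMem_iff] at hsp
    rw [← IsUnit.neg_iff]
    simpa using hsp
  have hRsol : ∀ z, IsUnit (H - algebraMap ℂ (L2 (Vertex r) →L[ℂ] L2 (Vertex r)) z) →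
      H (R z ψ) - z • R z ψ = ψ := by
    intro z hz
    have := congrArg (fun A : L2 (Vertex r) →L[ℂ] L2 (Vertex r) => A ψ)
      (Ring.mul_inverse_cancel _ hz)
    simp only [mul_apply_eq_comp, sub_apply, one_apply_eq_self, smul_apply,
      Algebra.algebraMap_eq_smul_one] at this
    simp only [hR, Algebra.algebraMap_eq_smul_one]
    exact this
  have hRcont : ContinuousAt R l₀ := by
    have h1 : ContinuousAt (Ring.inverse : (L2 (Vertex r) →L[ℂ] L2 (Vertex r)) → _)
        (H - algebraMap ℂ _ (l₀ : ℂ)) := by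
      obtain ⟨U, hU⟩ := hunit
      rw [← hU]
      exact NormedRing.inverse_continuousAt U
    have h2 : Continuous fun z : ℂ => H - algebraMap ℂ (L2 (Vertex r) →L[ℂ] L2 (Vertex r)) z :=
      continuous_const.sub (continuous_algebraMap _ _)
    exact ContinuousAt.comp (f := fun z : ℂ => H - algebraMap ℂ _ z) h1 h2.continuousAt
  have hucont : ContinuousAt (fun z => R z ψ) l₀ := hRcont.clm_apply continuousAt_const
  have hev : ∀ x, ContinuousAt (fun z => (R z ψ) x) (l₀ : ℂ) := by
    intro x
    have h1 : Continuous fun u : L2 (Vertex r) => (u : Vertex r → ℂ) x :=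
      (continuous_apply x).comp lp.uniformContinuous_coe.continuous
    exact h1.continuousAt.comp hucont
  have hbcont : ContinuousAt (fun z => sqNorm (bond (R z ψ) (N + 1))) (l₀ : ℂ) := by
    have hc : ∀ (n : ℕ) (j : Fin 3),
        ContinuousAt (fun z => layerComp r n j fun s => (R z ψ) ⟨n, s⟩) (l₀ : ℂ) := by
      intro n j
      unfold layerComp
      exact tendsto_finsetSum _ fun s _ => tendsto_const_nhds.mul (hev _)
    unfold sqNorm
    simp only [bond]
    exact ((hc _ _).norm.pow 2).add ((hc _ _).norm.pow 2)
  have hb0 : 0 < sqNorm (bond (R l₀ ψ) (N + 1)) := by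
    refine lt_of_le_of_ne (sqNorm_nonneg _) fun h0 => ?_
    have hb1 : (bond (R l₀ ψ) (N + 1)).1 = 0 := by
      have := norm_fst_le_sqrt (bond (R l₀ ψ) (N + 1))
      rw [← h0, Real.sqrt_zero] at this
      exact norm_le_zero_iff.1 this
    have hb2 : (bond (R l₀ ψ) (N + 1)).2 = 0 := by
      have := norm_snd_le_sqrt (bond (R l₀ ψ) (N + 1))
      rw [← h0, Real.sqrt_zero] at this
      exact norm_le_zero_iff.1 this
    -- otherwise the solution satisfies the same equation as `g`, and so coincides with it; but `g`
    -- does not vanish at the edge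
    have hDu : D (fun y => (R l₀ ψ) y) = D g := by
      ext x
      rw [hD, dissipative_restrict hC hH (hRsol l₀ hunit), hb1, hb2]
      simp only [sub_self, zero_mul, mul_zero, add_zero, sub_zero]
      exact extendZero_coe _ x
    have hinj := LinearMap.ker_eq_bot.1 (ker_dissipative (N := N) (v := v) hC hH hl)
    have hug := hinj hDu
    have h1 : (bond (R l₀ ψ) (N + 1)).2 = 1 := by
      rw [bond_snd_succ, ← layerComp_layerVec hr]
      congr 1
      ext s
      have := congrFun hug ⟨⟨N, s⟩, mem_shells.2 (Nat.lt_succ_self N)⟩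
      rw [hg] at this
      simp only [edgeVec_self] at this
      exact this
    rw [hb2] at h1
    exact zero_ne_one h1
  set c := sqNorm (bond (R l₀ ψ) (N + 1)) / 2 with hc
  have hc0 : 0 < c := by positivity
  obtain ⟨ρ, hρ, hball⟩ : ∃ ρ > 0, ∀ z : ℂ, dist z l₀ < ρ →
      IsUnit (H - algebraMap ℂ (L2 (Vertex r) →L[ℂ] L2 (Vertex r)) z) ∧
      c < sqNorm (bond (R z ψ) (N + 1)) ∧ ‖R z ψ‖ < ‖R l₀ ψ‖ + 1 := by
    have e1 : ∀ᶠ z in 𝓝 (l₀ : ℂ),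
        IsUnit (H - algebraMap ℂ (L2 (Vertex r) →L[ℂ] L2 (Vertex r)) z) := by
      have h2 : Continuous fun z : ℂ => H - algebraMap ℂ (L2 (Vertex r) →L[ℂ] L2 (Vertex r)) z :=
        continuous_const.sub (continuous_algebraMap _ _)
      exact (Units.isOpen.preimage h2).mem_nhds hunit
    have e2 : ∀ᶠ z in 𝓝 (l₀ : ℂ), c < sqNorm (bond (R z ψ) (N + 1)) :=
      hbcont.eventually (lt_mem_nhds (by rw [hc]; linarith))
    have e3 : ∀ᶠ z in 𝓝 (l₀ : ℂ), ‖R z ψ‖ < ‖R l₀ ψ‖ + 1 :=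
      hucont.norm.eventually (gt_mem_nhds (by linarith))
    exact Metric.eventually_nhds_iff.1 (e1.and (e2.and e3))
  set B := ‖R l₀ ψ‖ + 1 with hB
  have hB0 : 0 < B := by positivity
  obtain ⟨ρ', hρ', hρ'ρ, hρ'I⟩ : ∃ ρ' > 0, ρ' ≤ ρ / 2 ∧ Icc l₀ (l₀ + ρ') ⊆ Icc a b :=
    ⟨min (ρ / 2) (b - l₀), lt_min (by positivity) (by linarith [hl₀.2]), min_le_left _ _,
      Icc_subset_Icc hl₀.1.le (by linarith [min_le_right (ρ / 2) (b - l₀)])⟩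
  -- the solutions stay bounded while their values at the edge stay away from zero, which forces the
  -- average growth to be of the order `M`
  have hlow : ∀ M : ℕ, 0 < M → 1 / (M : ℝ) < ρ / 2 → 1 / (M : ℝ) < η₀ →
      ENNReal.ofReal ((c * M / (2 * B ^ 2)) ^ 2 * ρ') ≤ L ∨ ¬ (∫⁻ l in Icc a b,
    ENNReal.ofReal (avgGrowth (α (energy M l)) (γ (energy M l)) (β (energy M l)) (δ (energy M l))
      (N + 1) M ^ 2) ≤ L) := by
    intro M hM hMρ hMη
    by_cases hML : (∫⁻ l in Icc a b, ENNReal.ofReal (avgGrowth (α (energy M l))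
      (γ (energy M l)) (β (energy M l)) (δ (energy M l)) (N + 1) M ^ 2) ≤ L)
    swap
    · exact Or.inr hML
    left
    have hM' : (0 : ℝ) < M := by exact_mod_cast hM
    have hη : (0 : ℝ) < 1 / (M : ℝ) := by positivity
    refine le_trans ?_ hML
    calc ENNReal.ofReal ((c * M / (2 * B ^ 2)) ^ 2 * ρ')
        = ∫⁻ l in Icc l₀ (l₀ + ρ'), ENNReal.ofReal ((c * M / (2 * B ^ 2)) ^ 2) := by
          rw [setLIntegral_const, Real.volume_Icc, ← ENNReal.ofReal_mul (by positivity),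
            add_sub_cancel_left]
      _ ≤ ∫⁻ l in Icc l₀ (l₀ + ρ'), ENNReal.ofReal (avgGrowth (α (energy M l))
            (γ (energy M l)) (β (energy M l)) (δ (energy M l)) (N + 1) M ^ 2) := by
          apply setLIntegral_mono' measurableSet_Icc
          intro l hlI
          apply ENNReal.ofReal_le_ofReal
          apply pow_le_pow_left₀ (by positivity)
          have hz : dist (energy M l) (l₀ : ℂ) < ρ := by
            have : energy M l - l₀
                = ((l - l₀ : ℝ) : ℂ) + ((1 / (M : ℝ) : ℝ) : ℂ) * Complex.I := by
              rw [energy]; push_cast; ring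
            rw [dist_eq_norm, this]
            refine lt_of_le_of_lt (norm_add_le _ _) ?_
            rw [norm_mul, Complex.norm_I, Complex.norm_real, Complex.norm_real, Real.norm_eq_abs,
              Real.norm_of_nonneg hη.le, mul_one, abs_of_nonneg (by linarith [hlI.1])]
            linarith [hlI.2]
          obtain ⟨hu, hcb, hRB⟩ := hball _ hz
          have hG' := hG l (hρ'I hlI) _ hη hMη.le
          have h1 := sqNorm_bond_le hC hH (hRsol _ hu) hψ
            (fun n hn => (hG' n hn).1) (fun n hn => (hG' n hn).2) hM
          change sqNorm (bond (R (energy M l) ψ) (N + 1)) ≤ 2 * avgGrowth (α (energy M l))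
            (γ (energy M l)) (β (energy M l)) (δ (energy M l)) (N + 1) M
            * ((1 / (M : ℝ)) * ‖R (energy M l) ψ‖ ^ 2) at h1
          set A := avgGrowth (α (energy M l)) (γ (energy M l)) (β (energy M l)) (δ (energy M l))
            (N + 1) M
          have hA0 : 0 ≤ A := avgGrowth_nonneg _ _ _ _ _ _
          have h2 : c ≤ 2 * A * (1 / (M : ℝ) * B ^ 2) := by
            refine hcb.le.trans (h1.trans ?_)
            gcongr
          rw [div_le_iff₀ (by positivity)]
          calc c * M ≤ 2 * A * (1 / (M : ℝ) * B ^ 2) * M := by gcongr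
            _ = A * (2 * B ^ 2) := by field_simp
      _ ≤ _ := lintegral_mono_set hρ'I
  have hlarge : ∀ᶠ M : ℕ in atTop,
      (L : ℝ≥0∞) < ENNReal.ofReal ((c * M / (2 * B ^ 2)) ^ 2 * ρ') := by
    have h1 : Tendsto (fun M : ℕ => (c * M / (2 * B ^ 2)) ^ 2 * ρ') atTop atTop := by
      apply Tendsto.atTop_mul_const hρ'
      apply (tendsto_pow_atTop (by norm_num)).comp
      apply Tendsto.atTop_div_const (by positivity)
      exact tendsto_natCast_atTop_atTop.const_mul_atTop hc0
    filter_upwards [h1.eventually_gt_atTop (L : ℝ)] with M hM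
    rw [← ENNReal.ofReal_coe_nnreal]
    exact (ENNReal.ofReal_lt_ofReal_iff (lt_of_le_of_lt L.2 hM)).2 hM
  obtain ⟨M, hML, ⟨hM, hMρ⟩, ⟨-, hMη⟩, hMl⟩ := (hL.and_eventually
    ((eventually_one_div_lt (half_pos hρ)).and ((eventually_one_div_lt hη₀).and hlarge))).exists
  rcases hlow M hM hMρ hMη with h | h
  · exact absurd h (not_le.2 hMl)
  · exact h hML

end Criterion

/-! ### Concentrating families of random variables -/

section Concentration

variable {ι κ Ω : Type*} [MeasurableSpace Ω] {P : Measure Ω} {ε : ι → ℝ}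

/-- The uniformly bounded random variables `X i` concentrate at the numbers `x i` at the
rate `ε i`: both the bias and the mean square deviation are of the order `ε i`, uniformly in `i`.
The bias, which for averages of independent variables is much smaller than the root mean square
deviation, has the same order as the mean square. -/
structure Conc (P : Measure Ω) (ε : ι → ℝ) (X : ι → Ω → ℂ) (x : ι → ℂ) : Prop where
  nonneg : ∀ i, 0 ≤ ε i
  measurable : ∀ i, Measurable (X i)
  exists_bound : ∃ C : ℝ, 0 ≤ C ∧ ∀ i, ‖x i‖ ≤ C ∧ (∀ᵐ ω ∂P, ‖X i ω‖ ≤ C) ∧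
    ‖∫ ω, (X i ω - x i) ∂P‖ ≤ C * ε i ∧ ∫ ω, ‖X i ω - x i‖ ^ 2 ∂P ≤ C * ε i

lemma integrable_of_ae_bound [IsFiniteMeasure P] {X : Ω → ℂ} (hX : Measurable X) {C : ℝ}
    (h : ∀ᵐ ω ∂P, ‖X ω‖ ≤ C) : Integrable X P :=
  Integrable.of_bound hX.aestronglyMeasurable C h

lemma integrable_sq_of_ae_bound [IsFiniteMeasure P] {X : Ω → ℂ} (hX : Measurable X) {C : ℝ}
    (h : ∀ᵐ ω ∂P, ‖X ω‖ ≤ C) (x : ℂ) : Integrable (fun ω => ‖X ω - x‖ ^ 2) P := by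
  refine Integrable.of_bound ((hX.sub_const x).norm.pow_const 2).aestronglyMeasurable
    ((C + ‖x‖) ^ 2) ?_
  filter_upwards [h] with ω hω
  rw [Real.norm_of_nonneg (by positivity)]
  exact pow_le_pow_left₀ (norm_nonneg _) ((norm_sub_le _ _).trans (by linarith)) 2

/-- Concentration passes to random variables with a good linear approximation. -/
lemma Conc.of_linear_approx [IsProbabilityMeasure P] {X₁ X₂ Y : ι → Ω → ℂ} {x₁ x₂ y : ι → ℂ}
    (h₁ : Conc P ε X₁ x₁) (h₂ : Conc P ε X₂ x₂) (hY : ∀ i, Measurable (Y i)) {a b : ι → ℂ} {K : ℝ}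
    (hK : 0 ≤ K) (h : ∀ i, ‖y i‖ ≤ K ∧ ‖a i‖ ≤ K ∧ ‖b i‖ ≤ K ∧ ∀ᵐ ω ∂P, ‖Y i ω‖ ≤ K ∧
      ‖Y i ω - y i - (a i * (X₁ i ω - x₁ i) + b i * (X₂ i ω - x₂ i))‖
        ≤ K * (‖X₁ i ω - x₁ i‖ ^ 2 + ‖X₂ i ω - x₂ i‖ ^ 2)) :
    Conc P ε Y y := by
  obtain ⟨C₁, hC₁, H₁⟩ := h₁.exists_bound
  obtain ⟨C₂, hC₂, H₂⟩ := h₂.exists_bound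
  set B := K * (1 + 2 * C₁ + 2 * C₂) with hB
  have hB0 : 0 ≤ B := by positivity
  refine ⟨h₁.nonneg, hY, K + 2 * K * (C₁ + C₂) + 2 * B ^ 2 * (C₁ + C₂),
    by positivity, fun i => ?_⟩
  obtain ⟨hx₁, hX₁, hm₁, hv₁⟩ := H₁ i
  obtain ⟨hx₂, hX₂, hm₂, hv₂⟩ := H₂ i
  obtain ⟨hy, ha, hb, hae⟩ := h i
  have hε := h₁.nonneg i
  have hYb : ∀ᵐ ω ∂P, ‖Y i ω‖ ≤ K := hae.mono fun ω h => h.1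
  have i1 : Integrable (fun ω => X₁ i ω - x₁ i) P :=
    (integrable_of_ae_bound (h₁.measurable i) hX₁).sub (integrable_const _)
  have i2 : Integrable (fun ω => X₂ i ω - x₂ i) P :=
    (integrable_of_ae_bound (h₂.measurable i) hX₂).sub (integrable_const _)
  have s1 := integrable_sq_of_ae_bound (h₁.measurable i) hX₁ (x₁ i)
  have s2 := integrable_sq_of_ae_bound (h₂.measurable i) hX₂ (x₂ i)
  have iY : Integrable (fun ω => Y i ω - y i) P :=
    (integrable_of_ae_bound (hY i) hYb).sub (integrable_const _)
  have iL : Integrable (fun ω => a i * (X₁ i ω - x₁ i) + b i * (X₂ i ω - x₂ i)) P :=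
    (i1.const_mul _).add (i2.const_mul _)
  have hKle : K ≤ K + 2 * K * (C₁ + C₂) + 2 * B ^ 2 * (C₁ + C₂) := by
    have h1 : 0 ≤ 2 * K * (C₁ + C₂) := by positivity
    have h2 : 0 ≤ 2 * B ^ 2 * (C₁ + C₂) := by positivity
    linarith
  refine ⟨hy.trans hKle, hYb.mono fun ω h => h.trans hKle, ?_, ?_⟩
  · have e1 : ∫ ω, (Y i ω - y i) ∂P = (a i * ∫ ω, (X₁ i ω - x₁ i) ∂P
        + b i * ∫ ω, (X₂ i ω - x₂ i) ∂P)
        + ∫ ω, (Y i ω - y i - (a i * (X₁ i ω - x₁ i) + b i * (X₂ i ω - x₂ i))) ∂P := by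
      rw [integral_sub iY iL, integral_add (i1.const_mul _) (i2.const_mul _),
        integral_const_mul, integral_const_mul]
      ring
    have e2 : ‖∫ ω, (Y i ω - y i - (a i * (X₁ i ω - x₁ i) + b i * (X₂ i ω - x₂ i))) ∂P‖
        ≤ K * (C₁ * ε i + C₂ * ε i) := by
      calc _ ≤ ∫ ω, K * (‖X₁ i ω - x₁ i‖ ^ 2 + ‖X₂ i ω - x₂ i‖ ^ 2) ∂P :=
            norm_integral_le_of_norm_le ((s1.add s2).const_mul K) (hae.mono fun ω h => h.2)
        _ = K * (∫ ω, ‖X₁ i ω - x₁ i‖ ^ 2 ∂P + ∫ ω, ‖X₂ i ω - x₂ i‖ ^ 2 ∂P) := by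
            rw [integral_const_mul, integral_add s1 s2]
        _ ≤ _ := by gcongr
    rw [e1]
    calc _ ≤ ‖a i‖ * ‖∫ ω, (X₁ i ω - x₁ i) ∂P‖ + ‖b i‖ * ‖∫ ω, (X₂ i ω - x₂ i) ∂P‖
          + K * (C₁ * ε i + C₂ * ε i) := by
          refine (norm_add_le _ _).trans (add_le_add ((norm_add_le _ _).trans ?_) e2)
          rw [norm_mul, norm_mul]
      _ ≤ K * (C₁ * ε i) + K * (C₂ * ε i) + K * (C₁ * ε i + C₂ * ε i) := by gcongr
      _ ≤ _ := by
          have h1 : 0 ≤ K * ε i := mul_nonneg hK hε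
          have h2 : 0 ≤ 2 * B ^ 2 * (C₁ + C₂) * ε i := by positivity
          nlinarith
  · have hpt : ∀ᵐ ω ∂P, ‖Y i ω - y i‖ ^ 2
        ≤ 2 * B ^ 2 * (‖X₁ i ω - x₁ i‖ ^ 2 + ‖X₂ i ω - x₂ i‖ ^ 2) := by
      filter_upwards [hae, hX₁, hX₂] with ω h0 h1 h2
      set D₁ := X₁ i ω - x₁ i
      set D₂ := X₂ i ω - x₂ i
      have d1 : ‖D₁‖ ≤ 2 * C₁ := (norm_sub_le _ _).trans (by linarith)
      have d2 : ‖D₂‖ ≤ 2 * C₂ := (norm_sub_le _ _).trans (by linarith)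
      have n1 := norm_nonneg D₁
      have n2 := norm_nonneg D₂
      have hle : ‖Y i ω - y i‖ ≤ B * (‖D₁‖ + ‖D₂‖) := by
        calc ‖Y i ω - y i‖ = ‖(Y i ω - y i - (a i * D₁ + b i * D₂)) + (a i * D₁ + b i * D₂)‖ := by
              congr 1; ring
          _ ≤ K * (‖D₁‖ ^ 2 + ‖D₂‖ ^ 2) + (‖a i‖ * ‖D₁‖ + ‖b i‖ * ‖D₂‖) := by
              refine (norm_add_le _ _).trans (add_le_add h0.2 ((norm_add_le _ _).trans ?_))
              rw [norm_mul, norm_mul]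
          _ ≤ K * (2 * C₁ * ‖D₁‖ + 2 * C₂ * ‖D₂‖) + (K * ‖D₁‖ + K * ‖D₂‖) := by
              gcongr
              · rw [sq]; gcongr
              · rw [sq]; gcongr
          _ ≤ B * (‖D₁‖ + ‖D₂‖) := by
              rw [hB]
              nlinarith [mul_nonneg hK (mul_nonneg hC₁ n2), mul_nonneg hK (mul_nonneg hC₂ n1)]
      calc ‖Y i ω - y i‖ ^ 2 ≤ (B * (‖D₁‖ + ‖D₂‖)) ^ 2 := pow_le_pow_left₀ (norm_nonneg _) hle 2
        _ = B ^ 2 * (‖D₁‖ + ‖D₂‖) ^ 2 := by ring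
        _ ≤ B ^ 2 * (2 * (‖D₁‖ ^ 2 + ‖D₂‖ ^ 2)) := by
            gcongr
            nlinarith [sq_nonneg (‖D₁‖ - ‖D₂‖)]
        _ = _ := by ring
    calc ∫ ω, ‖Y i ω - y i‖ ^ 2 ∂P
        ≤ ∫ ω, 2 * B ^ 2 * (‖X₁ i ω - x₁ i‖ ^ 2 + ‖X₂ i ω - x₂ i‖ ^ 2) ∂P :=
          integral_mono_ae (integrable_sq_of_ae_bound (hY i) hYb _)
            ((s1.add s2).const_mul _) hpt
      _ = 2 * B ^ 2 * (∫ ω, ‖X₁ i ω - x₁ i‖ ^ 2 ∂P + ∫ ω, ‖X₂ i ω - x₂ i‖ ^ 2 ∂P) := by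
          rw [integral_const_mul, integral_add s1 s2]
      _ ≤ 2 * B ^ 2 * (C₁ * ε i + C₂ * ε i) := by gcongr
      _ ≤ _ := by
          have h1 : 0 ≤ K * ε i := mul_nonneg hK hε
          have h2 : 0 ≤ 2 * K * (C₁ + C₂) * ε i := by positivity
          nlinarith

lemma Conc.const (hε : ∀ i, 0 ≤ ε i) {c : ι → ℂ} {K : ℝ} (hK : ∀ i, ‖c i‖ ≤ K) :
    Conc P ε (fun i _ => c i) c := by
  refine ⟨hε, fun _ => measurable_const, |K|, abs_nonneg _, fun i => ⟨(hK i).trans (le_abs_self _),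
    ae_of_all _ fun _ => (hK i).trans (le_abs_self _), ?_, ?_⟩⟩
  · simpa using mul_nonneg (abs_nonneg K) (hε i)
  · simpa using mul_nonneg (abs_nonneg K) (hε i)

lemma Conc.conj {X : ι → Ω → ℂ} {x : ι → ℂ} (hX : Conc P ε X x) :
    Conc P ε (fun i ω => starRingEnd ℂ (X i ω)) (fun i => starRingEnd ℂ (x i)) := by
  obtain ⟨C, hC, H⟩ := hX.exists_bound
  refine ⟨hX.nonneg, fun i => Complex.continuous_conj.measurable.comp (hX.measurable i), C, hC,
    fun i => ?_⟩
  obtain ⟨h1, h2, h3, h4⟩ := H i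
  simp only [← map_sub, RCLike.norm_conj]
  refine ⟨h1, h2, ?_, h4⟩
  rw [integral_conj, RCLike.norm_conj]
  exact h3

lemma Conc.comp {X : ι → Ω → ℂ} {x : ι → ℂ} (hX : Conc P ε X x) (f : κ → ι) :
    Conc P (fun k => ε (f k)) (fun k => X (f k)) (fun k => x (f k)) := by
  obtain ⟨C, hC, H⟩ := hX.exists_bound
  exact ⟨fun k => hX.nonneg _, fun k => hX.measurable _, C, hC, fun k => H _⟩

variable [IsProbabilityMeasure P] {X Y : ι → Ω → ℂ} {x y : ι → ℂ}

lemma Conc.add (hX : Conc P ε X x) (hY : Conc P ε Y y) :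
    Conc P ε (fun i ω => X i ω + Y i ω) (fun i => x i + y i) := by
  obtain ⟨C₁, hC₁, H₁⟩ := hX.exists_bound
  obtain ⟨C₂, hC₂, H₂⟩ := hY.exists_bound
  refine hX.of_linear_approx hY (fun i => (hX.measurable i).add (hY.measurable i))
    (a := fun _ => 1) (b := fun _ => 1) (K := C₁ + C₂ + 1) (by positivity) fun i => ?_
  obtain ⟨hx₁, hX₁, -, -⟩ := H₁ i
  obtain ⟨hx₂, hX₂, -, -⟩ := H₂ i
  refine ⟨(norm_add_le _ _).trans (by linarith), by simp; linarith, by simp; linarith, ?_⟩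
  filter_upwards [hX₁, hX₂] with ω h1 h2
  refine ⟨(norm_add_le _ _).trans (by linarith), ?_⟩
  have : X i ω + Y i ω - (x i + y i) - (1 * (X i ω - x i) + 1 * (Y i ω - y i)) = 0 := by ring
  rw [this, norm_zero]
  positivity

lemma Conc.mul (hX : Conc P ε X x) (hY : Conc P ε Y y) :
    Conc P ε (fun i ω => X i ω * Y i ω) (fun i => x i * y i) := by
  obtain ⟨C₁, hC₁, H₁⟩ := hX.exists_bound
  obtain ⟨C₂, hC₂, H₂⟩ := hY.exists_bound
  refine hX.of_linear_approx hY (fun i => (hX.measurable i).mul (hY.measurable i))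
    (a := fun i => y i) (b := fun i => x i) (K := C₁ * C₂ + C₁ + C₂ + 1) (by positivity)
    fun i => ?_
  obtain ⟨hx₁, hX₁, -, -⟩ := H₁ i
  obtain ⟨hx₂, hX₂, -, -⟩ := H₂ i
  have h12 := mul_nonneg hC₁ hC₂
  refine ⟨?_, by linarith, by linarith, ?_⟩
  · rw [norm_mul]
    have := mul_le_mul hx₁ hx₂ (norm_nonneg _) hC₁
    linarith
  filter_upwards [hX₁, hX₂] with ω h1 h2
  refine ⟨?_, ?_⟩
  · rw [norm_mul]
    have := mul_le_mul h1 h2 (norm_nonneg _) hC₁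
    linarith
  have : X i ω * Y i ω - x i * y i - (y i * (X i ω - x i) + x i * (Y i ω - y i))
      = (X i ω - x i) * (Y i ω - y i) := by ring
  rw [this, norm_mul]
  nlinarith [sq_nonneg (‖X i ω - x i‖ - ‖Y i ω - y i‖), sq_nonneg ‖X i ω - x i‖,
    sq_nonneg ‖Y i ω - y i‖, mul_nonneg (add_nonneg (add_nonneg h12 hC₁) hC₂)
      (add_nonneg (sq_nonneg ‖X i ω - x i‖) (sq_nonneg ‖Y i ω - y i‖))]

lemma Conc.const_mul (hX : Conc P ε X x) {c : ι → ℂ} {K : ℝ} (hK : ∀ i, ‖c i‖ ≤ K) :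
    Conc P ε (fun i ω => c i * X i ω) (fun i => c i * x i) :=
  (Conc.const hX.nonneg hK).mul hX

lemma Conc.neg (hX : Conc P ε X x) : Conc P ε (fun i ω => -X i ω) (fun i => -x i) := by
  have := hX.const_mul (c := fun _ => -1) (K := 1) (fun i => by simp)
  simpa using this

lemma Conc.sub (hX : Conc P ε X x) (hY : Conc P ε Y y) :
    Conc P ε (fun i ω => X i ω - Y i ω) (fun i => x i - y i) := by
  have := hX.add hY.neg
  simpa [sub_eq_add_neg] using this

lemma Conc.sum {σ : Type*} (s : Finset σ) {X : σ → ι → Ω → ℂ} {x : σ → ι → ℂ}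
    (hε : ∀ i, 0 ≤ ε i) (h : ∀ j ∈ s, Conc P ε (X j) (x j)) :
    Conc P ε (fun i ω => ∑ j ∈ s, X j i ω) (fun i => ∑ j ∈ s, x j i) := by
  classical
  induction s using Finset.induction_on with
  | empty => simpa using Conc.const hε (c := fun _ => 0) (K := 0) (by simp)
  | insert j s hj ih =>
    simp only [Finset.sum_insert hj]
    exact (h j (Finset.mem_insert_self _ _)).add
      (ih fun k hk => h k (Finset.mem_insert_of_mem hk))

lemma Conc.prod {σ : Type*} (s : Finset σ) {X : σ → ι → Ω → ℂ} {x : σ → ι → ℂ}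
    (hε : ∀ i, 0 ≤ ε i) (h : ∀ j ∈ s, Conc P ε (X j) (x j)) :
    Conc P ε (fun i ω => ∏ j ∈ s, X j i ω) (fun i => ∏ j ∈ s, x j i) := by
  classical
  induction s using Finset.induction_on with
  | empty => simpa using Conc.const hε (c := fun _ => 1) (K := 1) (by simp)
  | insert j s hj ih =>
    simp only [Finset.prod_insert hj]
    exact (h j (Finset.mem_insert_self _ _)).mul
      (ih fun k hk => h k (Finset.mem_insert_of_mem hk))

lemma Conc.det {m : Type*} [Fintype m] [DecidableEq m] {A : ι → Ω → Matrix m m ℂ}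
    {a : ι → Matrix m m ℂ} (hε : ∀ i, 0 ≤ ε i)
    (h : ∀ j k, Conc P ε (fun i ω => A i ω j k) (fun i => a i j k)) :
    Conc P ε (fun i ω => (A i ω).det) (fun i => (a i).det) := by
  simp only [Matrix.det_apply']
  refine Conc.sum _ hε fun σ _ => ?_
  exact (Conc.prod _ hε fun j _ => h _ _).const_mul (c := fun _ => ((Equiv.Perm.sign σ : ℤ) : ℂ))
    (K := ‖((Equiv.Perm.sign σ : ℤ) : ℂ)‖) (fun _ => le_rfl)

lemma Conc.adjugate {m : Type*} [Fintype m] [DecidableEq m] {A : ι → Ω → Matrix m m ℂ}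
    {a : ι → Matrix m m ℂ} (hε : ∀ i, 0 ≤ ε i)
    (h : ∀ j k, Conc P ε (fun i ω => A i ω j k) (fun i => a i j k)) (j k : m) :
    Conc P ε (fun i ω => (A i ω).adjugate j k) (fun i => (a i).adjugate j k) := by
  simp only [Matrix.adjugate_apply]
  refine Conc.det hε fun j' k' => ?_
  simp only [Matrix.updateRow_apply]
  by_cases hjk : j' = k
  · simp only [hjk, if_true]
    exact Conc.const hε (c := fun _ => (Pi.single j (1 : ℂ) : m → ℂ) k')
      (K := ‖(Pi.single j (1 : ℂ) : m → ℂ) k'‖) (fun _ => le_rfl)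
  · simp only [hjk, if_false]
    exact h j' k'

/-- The inverse, cut off near zero. -/
def truncInv (c : ℝ) (z : ℂ) : ℂ := if c ≤ ‖z‖ then z⁻¹ else 0

lemma measurable_truncInv (c : ℝ) : Measurable (truncInv c) := by
  unfold truncInv
  exact Measurable.ite (measurableSet_le measurable_const measurable_norm)
    measurable_inv measurable_const

lemma truncInv_mul {c : ℝ} (hc : 0 < c) {z : ℂ} (hz : c ≤ ‖z‖) : truncInv c z * z = 1 := by
  have : z ≠ 0 := by
    rintro rfl
    rw [norm_zero] at hz
    linarith
  rw [truncInv, if_pos hz, inv_mul_cancel₀ this]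

/-- Where the limit stays away from zero, the inverse has a linear approximation; the truncation
keeps it bounded where the random variable itself comes close to zero. -/
lemma Conc.truncInv (hX : Conc P ε X x) {c : ℝ} (hc : 0 < c) (hx : ∀ i, 2 * c ≤ ‖x i‖) :
    Conc P ε (fun i ω => truncInv c (X i ω)) (fun i => (x i)⁻¹) := by
  refine hX.of_linear_approx hX (fun i => (measurable_truncInv c).comp (hX.measurable i))
    (a := fun i => -((x i)⁻¹) ^ 2) (b := fun _ => 0) (K := 1 / c + 1 / c ^ 2 + 1 / c ^ 3)
    (by positivity) fun i => ?_
  have hx0 : x i ≠ 0 := by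
    intro h
    have := hx i
    rw [h, norm_zero] at this
    linarith
  have hxi : ‖(x i)⁻¹‖ ≤ 1 / (2 * c) := by
    rw [norm_inv, ← one_div]
    exact one_div_le_one_div_of_le (by positivity) (hx i)
  have hxi' : ‖(x i)⁻¹‖ ≤ 1 / c := hxi.trans
    (one_div_le_one_div_of_le hc (by linarith))
  have p1 : 0 < 1 / c := by positivity
  have p2 : 0 < 1 / c ^ 2 := by positivity
  have p3 : 0 < 1 / c ^ 3 := by positivity
  refine ⟨by linarith, ?_, by simpa using by positivity, ae_of_all _ fun ω => ⟨?_, ?_⟩⟩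
  · rw [norm_neg, norm_pow]
    calc ‖(x i)⁻¹‖ ^ 2 ≤ (1 / c) ^ 2 := pow_le_pow_left₀ (norm_nonneg _) hxi' 2
      _ = 1 / c ^ 2 := by ring
      _ ≤ _ := by linarith
  · unfold PartialAntitree.truncInv
    split_ifs with h
    · rw [norm_inv, ← one_div]
      have := one_div_le_one_div_of_le hc h
      linarith
    · simp; positivity
  · set D := X i ω - x i with hD
    have hX' : X i ω = x i + D := by rw [hD]; ring
    rw [zero_mul, add_zero]
    have hfin : ∀ t : ℝ, t ≤ 1 / c ^ 3 * ‖D‖ ^ 2 →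
        t ≤ (1 / c + 1 / c ^ 2 + 1 / c ^ 3) * (‖D‖ ^ 2 + ‖D‖ ^ 2) := by
      intro t ht
      nlinarith [mul_nonneg p1.le (sq_nonneg ‖D‖), mul_nonneg p2.le (sq_nonneg ‖D‖),
        mul_nonneg p3.le (sq_nonneg ‖D‖)]
    apply hfin
    unfold PartialAntitree.truncInv
    split_ifs with h
    · have hX0 : X i ω ≠ 0 := by
        intro h0
        rw [h0, norm_zero] at h
        linarith
      have e : (X i ω)⁻¹ - (x i)⁻¹ - -((x i)⁻¹) ^ 2 * D = ((x i)⁻¹) ^ 2 * (X i ω)⁻¹ * D ^ 2 := by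
        rw [hD]
        field_simp
        ring
      rw [e, norm_mul, norm_mul, norm_pow, norm_pow]
      apply mul_le_mul_of_nonneg_right _ (sq_nonneg _)
      have hXi : ‖(X i ω)⁻¹‖ ≤ 1 / c := by
        rw [norm_inv, ← one_div]
        exact one_div_le_one_div_of_le hc h
      calc ‖(x i)⁻¹‖ ^ 2 * ‖(X i ω)⁻¹‖ ≤ (1 / c) ^ 2 * (1 / c) := by gcongr
        _ = 1 / c ^ 3 := by ring
    · -- here the deviation exceeds `c`, so that every bounded error is quadratically small
      push Not at h
      have hDc : c ≤ ‖D‖ := by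
        have h1 : ‖x i‖ ≤ ‖X i ω‖ + ‖D‖ := by
          have : x i = X i ω - D := by rw [hD]; ring
          rw [this]; exact norm_sub_le _ _
        linarith [hx i]
      rw [zero_sub]
      have h2 : ‖-(x i)⁻¹ - -((x i)⁻¹) ^ 2 * D‖ ≤ 1 / (2 * c) + (1 / (2 * c)) ^ 2 * ‖D‖ := by
        refine (norm_sub_le _ _).trans (add_le_add (by rw [norm_neg]; exact hxi) ?_)
        rw [norm_mul, norm_neg, norm_pow]
        gcongr
      refine h2.trans ?_
      have h3 : 1 / (2 * c) + (1 / (2 * c)) ^ 2 * ‖D‖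
          = 1 / c ^ 3 * (c ^ 2 / 2 + c * ‖D‖ / 4) := by field_simp; ring
      rw [h3]
      gcongr
      nlinarith

end Concentration

/-! ### The invariant quadratic form of an elliptic transfer matrix -/

section QForm

/-- A Hermitian form on `ℂ²` that is invariant under the transfer matrix with the real Green
numbers `α`, `β`, `δ`. It is definite if the transfer matrix is elliptic. -/
def qform (α β δ : ℝ) (v : ℂ × ℂ) : ℝ :=
  δ * (v.1.re ^ 2 + v.1.im ^ 2) + (α * δ - β ^ 2 + 1) * (v.1.re * v.2.re + v.1.im * v.2.im)
    + α * (v.2.re ^ 2 + v.2.im ^ 2)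

lemma qform_eq (α β δ : ℝ) (v : ℂ × ℂ) : (qform α β δ v : ℂ) =
    δ * (v.1 * starRingEnd ℂ v.1) + ((α * δ - β ^ 2 + 1) / 2) *
      (v.1 * starRingEnd ℂ v.2 + starRingEnd ℂ v.1 * v.2) + α * (v.2 * starRingEnd ℂ v.2) := by
  obtain ⟨⟨a, b⟩, ⟨c, d⟩⟩ := v
  have h : ((α * δ - β ^ 2 + 1 : ℂ) / 2) = (((α * δ - β ^ 2 + 1) / 2 : ℝ) : ℂ) := by push_cast; ring
  rw [h]
  apply Complex.ext <;> simp [qform, pow_two] <;> ring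

lemma qform_transfer {α β δ : ℝ} (hβ : β ≠ 0) (v : ℂ × ℂ) :
    qform α β δ (transfer α (β : ℂ)⁻¹ β δ v) = qform α β δ v := by
  obtain ⟨⟨a, b⟩, ⟨c, d⟩⟩ := v
  simp only [qform, transfer, ← Complex.ofReal_inv, Complex.neg_re, Complex.neg_im,
    Complex.mul_re, Complex.mul_im, Complex.add_re, Complex.add_im, Complex.sub_re, Complex.sub_im,
    Complex.ofReal_re, Complex.ofReal_im, zero_mul, sub_zero, add_zero, mul_zero]
  field_simp
  ring

lemma qform_smul (α β δ t : ℝ) (v : ℂ × ℂ) :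
    qform α β δ ((t : ℂ) * v.1, (t : ℂ) * v.2) = t ^ 2 * qform α β δ v := by
  simp only [qform, Complex.mul_re, Complex.mul_im, Complex.ofReal_re, Complex.ofReal_im]
  ring

lemma transfer_smul (α γ β δ t : ℂ) (v : ℂ × ℂ) :
    transfer α γ β δ (t * v.1, t * v.2)
      = (t * (transfer α γ β δ v).1, t * (transfer α γ β δ v).2) := by
  unfold transfer
  ext <;> dsimp only <;> ring

lemma sqNorm_eq (v : ℂ × ℂ) :
    sqNorm v = (v.1.re ^ 2 + v.1.im ^ 2) + (v.2.re ^ 2 + v.2.im ^ 2) := by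
  unfold sqNorm
  rw [Complex.sq_norm, Complex.sq_norm, Complex.normSq_apply, Complex.normSq_apply]
  ring

/-- The condition on the trace of the transfer matrix makes the discriminant negative. -/
lemma discrim_neg_of_trace {α β δ : ℝ} (hβ : β ≠ 0) (h : |β + (1 - α * δ) / β| < 2) :
    (α * δ - β ^ 2 + 1) ^ 2 - 4 * (α * δ) < 0 := by
  have h1 : (β + (1 - α * δ) / β) ^ 2 < 2 ^ 2 := by
    rw [← sq_abs]
    exact pow_lt_pow_left₀ h (abs_nonneg _) (by norm_num)
  have h2 : (β ^ 2 + 1 - α * δ) ^ 2 < 4 * β ^ 2 := by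
    have h3 : (β ^ 2 + 1 - α * δ) ^ 2 = (β + (1 - α * δ) / β) ^ 2 * β ^ 2 := by
      field_simp
      ring
    rw [h3]
    have : 0 < β ^ 2 := by positivity
    nlinarith
  nlinarith

/-- A negative discriminant makes the form definite, by completing the square in either
component. -/
lemma sqNorm_le_qform {α β δ κ₀ C : ℝ} (h : (α * δ - β ^ 2 + 1) ^ 2 - 4 * (α * δ) ≤ -κ₀)
    (hα : |α| ≤ C) (hδ : |δ| ≤ C) (v : ℂ × ℂ) :
    κ₀ * sqNorm v ≤ 8 * C * |qform α β δ v| := by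
  rw [sqNorm_eq]
  set q := qform α β δ v with hq
  have e1 : κ₀ * (v.2.re ^ 2 + v.2.im ^ 2) ≤ 4 * (δ * q) := by
    rw [hq, qform]
    nlinarith [sq_nonneg (2 * δ * v.1.re + (α * δ - β ^ 2 + 1) * v.2.re),
      sq_nonneg (2 * δ * v.1.im + (α * δ - β ^ 2 + 1) * v.2.im), sq_nonneg v.2.re,
      sq_nonneg v.2.im, mul_le_mul_of_nonneg_right h (sq_nonneg v.2.re),
      mul_le_mul_of_nonneg_right h (sq_nonneg v.2.im)]
  have e2 : κ₀ * (v.1.re ^ 2 + v.1.im ^ 2) ≤ 4 * (α * q) := by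
    rw [hq, qform]
    nlinarith [sq_nonneg (2 * α * v.2.re + (α * δ - β ^ 2 + 1) * v.1.re),
      sq_nonneg (2 * α * v.2.im + (α * δ - β ^ 2 + 1) * v.1.im), sq_nonneg v.1.re,
      sq_nonneg v.1.im, mul_le_mul_of_nonneg_right h (sq_nonneg v.1.re),
      mul_le_mul_of_nonneg_right h (sq_nonneg v.1.im)]
  have e3 : δ * q ≤ C * |q| := by
    refine (le_abs_self _).trans ?_
    rw [abs_mul]
    exact mul_le_mul_of_nonneg_right hδ (abs_nonneg _)
  have e4 : α * q ≤ C * |q| := by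
    refine (le_abs_self _).trans ?_
    rw [abs_mul]
    exact mul_le_mul_of_nonneg_right hα (abs_nonneg _)
  linarith

end QForm

/-! ### The mean growth of the invariant form under one random transfer matrix -/

section Step

variable {ι Ω : Type*} [MeasurableSpace Ω] {P : Measure Ω} [IsProbabilityMeasure P] {ε : ι → ℝ}
  {A G B D : ι → Ω → ℂ} {α β δ : ι → ℝ} {κ₀ : ℝ}

/-- In the mean, the square of the form that is invariant under the limit of concentrating transfer
matrices grows at most by the rate of concentration. -/
lemma exists_lintegral_qform_transfer_le (hA : Conc P ε A fun i => (α i : ℂ))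
    (hG : Conc P ε G fun i => (β i : ℂ)⁻¹) (hB : Conc P ε B fun i => (β i : ℂ))
    (hD : Conc P ε D fun i => (δ i : ℂ)) (hβ : ∀ i, β i ≠ 0) (hκ₀ : 0 < κ₀)
    (hκ : ∀ i, (α i * δ i - β i ^ 2 + 1) ^ 2 - 4 * (α i * δ i) ≤ -κ₀) :
    ∃ C : ℝ, 0 ≤ C ∧ ∀ i (w : ℂ × ℂ), ∫⁻ ω, ENNReal.ofReal
      (qform (α i) (β i) (δ i) (transfer (A i ω) (G i ω) (B i ω) (D i ω) w) ^ 2) ∂P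
        ≤ ENNReal.ofReal ((1 + C * ε i) * qform (α i) (β i) (δ i) w ^ 2) := by
  -- the unit vector is made part of the index, so that all estimates are uniform in it
  let S := {w : ℂ × ℂ // sqNorm w = 1}
  let f : ι × S → ι := Prod.fst
  have hS1 : ∀ w : S, ‖w.1.1‖ ≤ 1 := by
    intro w
    have := norm_fst_le_sqrt w.1
    rwa [w.2, Real.sqrt_one] at this
  have hS2 : ∀ w : S, ‖w.1.2‖ ≤ 1 := by
    intro w
    have := norm_snd_le_sqrt w.1
    rwa [w.2, Real.sqrt_one] at this
  have hε : ∀ k : ι × S, 0 ≤ ε (f k) := fun k => hA.nonneg _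
  have hA' := hA.comp f
  have hG' := hG.comp f
  have hB' := hB.comp f
  have hD' := hD.comp f
  have c1 : Conc P (fun k => ε (f k)) (fun (k : ι × S) _ => k.2.1.1) (fun k => k.2.1.1) :=
    Conc.const hε (K := 1) fun k => hS1 k.2
  have c2 : Conc P (fun k => ε (f k)) (fun (k : ι × S) _ => k.2.1.2) (fun k => k.2.1.2) :=
    Conc.const hε (K := 1) fun k => hS2 k.2
  obtain ⟨Ca, hCa, HA⟩ := hA'.exists_bound
  obtain ⟨Cb, hCb, HB⟩ := hB'.exists_bound
  obtain ⟨Cd, hCd, HD⟩ := hD'.exists_bound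
  have kα : Conc P (fun k => ε (f k)) (fun (k : ι × S) _ => (α k.1 : ℂ)) (fun k => (α k.1 : ℂ)) :=
    Conc.const hε (K := Ca) fun k => (HA k).1
  have kβ : Conc P (fun k => ε (f k)) (fun (k : ι × S) _ => (β k.1 : ℂ)) (fun k => (β k.1 : ℂ)) :=
    Conc.const hε (K := Cb) fun k => (HB k).1
  have kδ : Conc P (fun k => ε (f k)) (fun (k : ι × S) _ => (δ k.1 : ℂ)) (fun k => (δ k.1 : ℂ)) :=
    Conc.const hε (K := Cd) fun k => (HD k).1
  have kh : Conc P (fun k => ε (f k)) (fun (_ : ι × S) _ => (2 : ℂ)⁻¹) (fun _ => (2 : ℂ)⁻¹) :=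
    Conc.const hε (K := 1) fun k => by norm_num
  have k1 : Conc P (fun k => ε (f k)) (fun (_ : ι × S) _ => (1 : ℂ)) (fun _ => (1 : ℂ)) :=
    Conc.const hε (K := 1) fun k => by norm_num
  have s1 := c1.add (hA'.mul c2)
  have t1 := (hG'.mul s1).neg
  have t2 := ((hD'.mul hG').mul s1).sub (hB'.mul c2)
  have kκ := (((kα.mul kδ).sub (kβ.mul kβ)).add k1).mul kh
  have q := ((kδ.mul (t1.mul t1.conj)).add (kκ.mul ((t1.mul t2.conj).add (t1.conj.mul t2)))).add
    (kα.mul (t2.mul t2.conj))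
  have qq := q.mul q
  -- the value of the form on the image of a unit vector, and its limit
  set Y : ι × S → Ω → ℝ := fun k ω => qform (α k.1) (β k.1) (δ k.1)
    (transfer (A k.1 ω) (G k.1 ω) (B k.1 ω) (D k.1 ω) k.2.1) ^ 2 with hY
  set y : ι × S → ℝ := fun k => qform (α k.1) (β k.1) (δ k.1) k.2.1 ^ 2 with hy
  have hYc : Conc P (fun k => ε (f k)) (fun k ω => (Y k ω : ℂ)) (fun k => (y k : ℂ)) := by
    convert! qq using 1
    · ext k ω
      rw [hY]
      push_cast
      rw [qform_eq]
      simp only [transfer]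
      ring
    · ext k
      rw [hy]
      dsimp only
      rw [← qform_transfer (hβ k.1) k.2.1]
      push_cast
      rw [qform_eq]
      simp only [transfer]
      ring
  obtain ⟨C, hC, HY⟩ := hYc.exists_bound
  set K := Ca + Cd + 1 with hK
  have hK0 : 0 < K := by positivity
  refine ⟨C * (8 * K / κ₀) ^ 2, by positivity, fun i w => ?_⟩
  -- the case of a unit vector
  have hunit : ∀ w : S, ∫⁻ ω, ENNReal.ofReal (Y (i, w) ω) ∂P
      ≤ ENNReal.ofReal ((1 + C * (8 * K / κ₀) ^ 2 * ε i) * y (i, w)) := by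
    intro w
    obtain ⟨hy1, hY1, hm, -⟩ := HY (i, w)
    have hmeas : Measurable (Y (i, w)) := by
      have := Complex.measurable_re.comp (hYc.measurable (i, w))
      exact this
    have hint : Integrable (fun ω => Y (i, w) ω) P := by
      refine Integrable.of_bound hmeas.aestronglyMeasurable C ?_
      filter_upwards [hY1] with ω hω
      rwa [Complex.norm_real] at hω
    have h1 : |∫ ω, Y (i, w) ω ∂P - y (i, w)| ≤ C * ε i := by
      have : (∫ ω, ((Y (i, w) ω : ℂ) - (y (i, w) : ℂ)) ∂P)
          = ((∫ ω, Y (i, w) ω ∂P - y (i, w) : ℝ) : ℂ) := by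
        rw [integral_sub hint.ofReal (integrable_const _), integral_complex_ofReal,
          integral_const]
        simp
      rw [this, Complex.norm_real] at hm
      exact hm
    rw [← ofReal_integral_eq_lintegral_ofReal hint (ae_of_all _ fun ω => sq_nonneg _)]
    apply ENNReal.ofReal_le_ofReal
    have h2 : ∫ ω, Y (i, w) ω ∂P ≤ y (i, w) + C * ε i := by linarith [(abs_le.1 h1).2]
    have hαK : |α i| ≤ K := by
      have := (HA (i, w)).1
      rw [Complex.norm_real, Real.norm_eq_abs] at this
      linarith
    have hδK : |δ i| ≤ K := by
      have := (HD (i, w)).1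
      rw [Complex.norm_real, Real.norm_eq_abs] at this
      linarith
    have h3 := sqNorm_le_qform (hκ i) hαK hδK w.1
    rw [w.2, mul_one] at h3
    have h4 : 1 ≤ (8 * K / κ₀) ^ 2 * y (i, w) := by
      have h5 : 1 ≤ 8 * K / κ₀ * |qform (α i) (β i) (δ i) w.1| := by
        rw [div_mul_eq_mul_div, le_div_iff₀ hκ₀]
        linarith
      calc (1 : ℝ) = 1 ^ 2 := by norm_num
        _ ≤ (8 * K / κ₀ * |qform (α i) (β i) (δ i) w.1|) ^ 2 :=
            pow_le_pow_left₀ zero_le_one h5 2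
        _ = _ := by rw [mul_pow, sq_abs]
    have h6 : C * ε i * 1 ≤ C * ε i * ((8 * K / κ₀) ^ 2 * y (i, w)) :=
      mul_le_mul_of_nonneg_left h4 (mul_nonneg hC (hA.nonneg i))
    linarith
  -- the general case, by homogeneity
  rcases (sqNorm_nonneg w).eq_or_lt with h0 | h0
  · have hw1 : w.1 = 0 := by
      have := norm_fst_le_sqrt w
      rw [← h0, Real.sqrt_zero] at this
      exact norm_le_zero_iff.1 this
    have hw2 : w.2 = 0 := by
      have := norm_snd_le_sqrt w
      rw [← h0, Real.sqrt_zero] at this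
      exact norm_le_zero_iff.1 this
    simp [transfer, hw1, hw2, qform]
  · set t := √(sqNorm w) with ht
    have ht0 : 0 < t := Real.sqrt_pos.2 h0
    have ht0' : (t : ℂ) ≠ 0 := by exact_mod_cast ht0.ne'
    let w' : S := ⟨((t : ℂ)⁻¹ * w.1, (t : ℂ)⁻¹ * w.2), by
      unfold sqNorm
      rw [norm_mul, norm_mul, norm_inv, Complex.norm_real, Real.norm_of_nonneg ht0.le, mul_pow,
        mul_pow, ← mul_add]
      change t⁻¹ ^ 2 * sqNorm w = 1
      rw [← Real.sq_sqrt h0.le, ← ht]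
      field_simp⟩
    have hw : w = ((t : ℂ) * w'.1.1, (t : ℂ) * w'.1.2) := by
      ext <;> simp [w', mul_inv_cancel_left₀ ht0']
    have e1 : ∀ ω, qform (α i) (β i) (δ i) (transfer (A i ω) (G i ω) (B i ω) (D i ω) w) ^ 2
        = t ^ 4 * Y (i, w') ω := by
      intro ω
      rw [hw, transfer_smul, qform_smul, hY]
      ring
    have e2 : qform (α i) (β i) (δ i) w ^ 2 = t ^ 4 * y (i, w') := by
      conv_lhs => rw [hw]
      rw [qform_smul, hy]
      ring
    simp only [e1, e2]
    simp_rw [ENNReal.ofReal_mul (show 0 ≤ t ^ 4 by positivity)]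
    rw [lintegral_const_mul' _ _ ENNReal.ofReal_ne_top]
    calc _ ≤ ENNReal.ofReal (t ^ 4) * ENNReal.ofReal
          ((1 + C * (8 * K / κ₀) ^ 2 * ε i) * y (i, w')) := by
          gcongr
          exact hunit w'
      _ = _ := by
          rw [← ENNReal.ofReal_mul (by positivity)]
          congr 1
          ring

end Step

/-! ### Products of independent transfer matrices -/

section RandomTail

variable {r : ℕ → Fin 3 → ℕ}

/-- The potential on the shell `n`. -/
def shellPart (n : ℕ) (ω : Vertex r → ℝ) : Shell r n → ℝ := fun s => ω ⟨n, s⟩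

lemma measurable_shellPart (n : ℕ) : Measurable (shellPart (r := r) n) :=
  measurable_pi_lambda _ fun _ => measurable_pi_apply _

/-- Candidates for the Green numbers of the shells, as functions of the energy and of the potential
on the shell. -/
structure ShellCoeff (r : ℕ → Fin 3 → ℕ) where
  /-- The Green number of the first layer. -/
  al : ∀ n, ℂ → (Shell r n → ℝ) → ℂ
  /-- The Green number between the first and the last layer. -/
  be : ∀ n, ℂ → (Shell r n → ℝ) → ℂ
  /-- The Green number of the last layer. -/
  de : ∀ n, ℂ → (Shell r n → ℝ) → ℂ
  measurable_al : ∀ n, Measurable fun p : ℂ × (Shell r n → ℝ) => al n p.1 p.2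
  measurable_be : ∀ n, Measurable fun p : ℂ × (Shell r n → ℝ) => be n p.1 p.2
  measurable_de : ∀ n, Measurable fun p : ℂ × (Shell r n → ℝ) => de n p.1 p.2

/-- A shell together with an energy `l + iη` above the interval `[a, b]` and at most at the
height `η₀`. -/
structure Param (a b η₀ : ℝ) where
  /-- The number of the shell. -/
  n : ℕ
  /-- The real part of the energy. -/
  l : ℝ
  /-- The imaginary part of the energy. -/
  η : ℝ
  l_mem : l ∈ Icc a b
  η_pos : 0 < η
  η_le : η ≤ η₀

/-- The energy. -/
def Param.z {a b η₀ : ℝ} (p : Param a b η₀) : ℂ := (p.l : ℂ) + (p.η : ℂ) * Complex.I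

variable (S : ShellCoeff r) (c₀ : ℝ)

/-- The product of the transfer matrices of the shells `N, …, N + m - 1` for the potential `ω`,
applied to `e`. The inverse of `β` is cut off. -/
def randomTail (z : ℂ) (ω : Vertex r → ℝ) (N : ℕ) (e : ℂ × ℂ) (m : ℕ) : ℂ × ℂ :=
  tail (fun n => S.al n z (shellPart n ω)) (fun n => truncInv c₀ (S.be n z (shellPart n ω)))
    (fun n => S.be n z (shellPart n ω)) (fun n => S.de n z (shellPart n ω)) N e m

/-- The average growth of the products of the transfer matrices for the potential `ω`. -/
def randomAvgGrowth (z : ℂ) (ω : Vertex r → ℝ) (N M : ℕ) : ℝ :=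
  avgGrowth (fun n => S.al n z (shellPart n ω)) (fun n => truncInv c₀ (S.be n z (shellPart n ω)))
    (fun n => S.be n z (shellPart n ω)) (fun n => S.de n z (shellPart n ω)) N M

lemma measurable_coeff {f : ∀ n, ℂ → (Shell r n → ℝ) → ℂ} {n : ℕ}
    (hf : Measurable fun p : ℂ × (Shell r n → ℝ) => f n p.1 p.2) :
    Measurable fun p : ℂ × (Vertex r → ℝ) => f n p.1 (shellPart n p.2) :=
  hf.comp (measurable_fst.prodMk ((measurable_shellPart n).comp measurable_snd))

lemma measurable_transfer {X : Type*} [MeasurableSpace X] {α γ β δ : X → ℂ} {v : X → ℂ × ℂ}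
    (hα : Measurable α) (hγ : Measurable γ) (hβ : Measurable β) (hδ : Measurable δ)
    (hv : Measurable v) : Measurable fun x => transfer (α x) (γ x) (β x) (δ x) (v x) := by
  unfold transfer
  have h1 := hv.fst
  have h2 := hv.snd
  exact (hγ.mul (h1.add (hα.mul h2))).neg.prodMk
    (((hδ.mul hγ).mul (h1.add (hα.mul h2))).sub (hβ.mul h2))

lemma measurable_randomTail (N : ℕ) (e : ℂ × ℂ) (m : ℕ) :
    Measurable fun p : ℂ × (Vertex r → ℝ) => randomTail S c₀ p.1 p.2 N e m := by
  induction m with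
  | zero => exact measurable_const
  | succ m ih =>
    exact measurable_transfer (measurable_coeff (S.measurable_al _))
      ((measurable_truncInv c₀).comp (measurable_coeff (S.measurable_be _)))
      (measurable_coeff (S.measurable_be _)) (measurable_coeff (S.measurable_de _)) ih

lemma measurable_sqNorm : Measurable sqNorm := by
  unfold sqNorm
  fun_prop

lemma measurable_qform (α β δ : ℝ) : Measurable (qform α β δ) := by
  unfold qform
  fun_prop

lemma measurable_randomAvgGrowth (N M : ℕ) :
    Measurable fun p : ℂ × (Vertex r → ℝ) => randomAvgGrowth S c₀ p.1 p.2 N M := by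
  unfold randomAvgGrowth avgGrowth growth
  refine measurable_const.mul (Finset.measurable_fun_sum _ fun m _ => ?_)
  exact (measurable_sqNorm.comp (measurable_randomTail S c₀ N (1, 0) m)).add
    (measurable_sqNorm.comp (measurable_randomTail S c₀ N (0, 1) m))

lemma randomTail_succ (z : ℂ) (ω : Vertex r → ℝ) (N : ℕ) (e : ℂ × ℂ) (m : ℕ) :
    randomTail S c₀ z ω N e (m + 1) = transfer (S.al (N + m) z (shellPart (N + m) ω))
      (truncInv c₀ (S.be (N + m) z (shellPart (N + m) ω))) (S.be (N + m) z (shellPart (N + m) ω))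
      (S.de (N + m) z (shellPart (N + m) ω)) (randomTail S c₀ z ω N e m) := rfl

lemma randomTail_congr (z : ℂ) {ω ω' : Vertex r → ℝ} (N : ℕ) (e : ℂ × ℂ) (m : ℕ)
    (h : ∀ x : Vertex r, x.1 < N + m → ω x = ω' x) :
    randomTail S c₀ z ω N e m = randomTail S c₀ z ω' N e m := by
  induction m with
  | zero => rfl
  | succ m ih =>
    have hs : shellPart (N + m) ω = shellPart (N + m) ω' := by
      ext s
      exact h _ (by dsimp only; omega)
    rw [randomTail_succ, randomTail_succ, hs, ih fun x hx => h x (by omega)]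

variable (ν : Measure ℝ) [IsProbabilityMeasure ν]

/-- The law of the random potential. -/
abbrev potentialLaw (r : ℕ → Fin 3 → ℕ) (ν : Measure ℝ) : Measure (Vertex r → ℝ) :=
  Measure.infinitePi fun _ : Vertex r => ν

/-- The product of the first transfer matrices is independent of the next shell, so that a bound
for the mean growth in one step applies conditionally on the preceding steps. -/
lemma lintegral_randomTail_succ_le (z : ℂ) (N : ℕ) (e : ℂ × ℂ) (m : ℕ) {Q : ℂ × ℂ → ℝ≥0∞}
    (hQ : Measurable Q) {c : ℝ≥0∞} (h : ∀ w : ℂ × ℂ, ∫⁻ ω, Q (transfer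
      (S.al (N + m) z (shellPart (N + m) ω)) (truncInv c₀ (S.be (N + m) z (shellPart (N + m) ω)))
      (S.be (N + m) z (shellPart (N + m) ω)) (S.de (N + m) z (shellPart (N + m) ω)) w)
      ∂(potentialLaw r ν) ≤ c * Q w) :
    ∫⁻ ω, Q (randomTail S c₀ z ω N e (m + 1)) ∂(potentialLaw r ν)
      ≤ c * ∫⁻ ω, Q (randomTail S c₀ z ω N e m) ∂(potentialLaw r ν) := by
  classical
  set P := potentialLaw r ν with hP
  -- the vertices before the shell `N + m`, and those in it
  set T : Finset (Vertex r) := shells r (N + m) with hT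
  set T' : Finset (Vertex r) := (Finset.univ : Finset (Shell r (N + m))).map
    (Function.Embedding.sigmaMk (N + m)) with hT'
  have hdisj : Disjoint T T' := by
    rw [Finset.disjoint_left]
    intro x hx hx'
    rw [hT, mem_shells] at hx
    rw [hT', Finset.mem_map] at hx'
    obtain ⟨s, -, rfl⟩ := hx'
    exact lt_irrefl _ hx
  have hind : iIndepFun (fun (x : Vertex r) (ω : Vertex r → ℝ) => ω x) P :=
    iIndepFun_infinitePi (X := fun _ t => t) (fun _ => measurable_id)
  have h2 := hind.indepFun_finset T T' hdisj (fun x => measurable_pi_apply x)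
  let X : (Vertex r → ℝ) → (T → ℝ) := fun ω i => ω i
  let Y : (Vertex r → ℝ) → (T' → ℝ) := fun ω i => ω i
  have hX : Measurable X := measurable_pi_lambda _ fun i => measurable_pi_apply _
  have hY : Measurable Y := measurable_pi_lambda _ fun i => measurable_pi_apply _
  let ext : (T → ℝ) → (Vertex r → ℝ) := fun f x => if hx : x ∈ T then f ⟨x, hx⟩ else 0
  have hext : Measurable ext := measurable_pi_lambda _ fun x => by
    by_cases hx : x ∈ T
    · simp only [ext, hx, dif_pos]; exact measurable_pi_apply _
    · simp only [ext, hx, dif_neg, not_false_iff]; exact measurable_const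
  let sh : (T' → ℝ) → (Shell r (N + m) → ℝ) := fun f s =>
    f ⟨⟨N + m, s⟩, Finset.mem_map_of_mem _ (Finset.mem_univ s)⟩
  have hsh : Measurable sh := measurable_pi_lambda _ fun s => measurable_pi_apply _
  let W : (T → ℝ) → ℂ × ℂ := fun f => randomTail S c₀ z (ext f) N e m
  have hW : Measurable W := (measurable_randomTail S c₀ N e m).comp
    (measurable_const.prodMk hext)
  have hQW : Measurable fun f => Q (W f) := hQ.comp hW
  have hWX : ∀ ω, W (X ω) = randomTail S c₀ z ω N e m := fun ω => by
    apply randomTail_congr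
    intro x hx
    have : x ∈ T := mem_shells.2 hx
    simp only [ext, X, this, dif_pos]
  have hshY : ∀ ω, sh (Y ω) = shellPart (N + m) ω := fun ω => rfl
  let F : (T → ℝ) × (T' → ℝ) → ℝ≥0∞ := fun p => Q (transfer (S.al (N + m) z (sh p.2))
    (truncInv c₀ (S.be (N + m) z (sh p.2))) (S.be (N + m) z (sh p.2))
    (S.de (N + m) z (sh p.2)) (W p.1))
  have hc : ∀ {f : ∀ n, ℂ → (Shell r n → ℝ) → ℂ},
      (Measurable fun p : ℂ × (Shell r (N + m) → ℝ) => f (N + m) p.1 p.2) →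
      Measurable fun p : (T → ℝ) × (T' → ℝ) => f (N + m) z (sh p.2) := fun hf =>
    hf.comp (measurable_const.prodMk (hsh.comp measurable_snd))
  have hF : Measurable F := hQ.comp (measurable_transfer (hc (S.measurable_al _))
    ((measurable_truncInv c₀).comp (hc (S.measurable_be _))) (hc (S.measurable_be _))
    (hc (S.measurable_de _)) (hW.comp measurable_fst))
  have hmap : P.map (fun ω => (X ω, Y ω)) = (P.map X).prod (P.map Y) :=
    (indepFun_iff_map_prod_eq_prod_map_map hX.aemeasurable hY.aemeasurable).1 h2
  have : IsProbabilityMeasure (P.map X) := Measure.isProbabilityMeasure_map hX.aemeasurable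
  have : IsProbabilityMeasure (P.map Y) := Measure.isProbabilityMeasure_map hY.aemeasurable
  calc ∫⁻ ω, Q (randomTail S c₀ z ω N e (m + 1)) ∂P = ∫⁻ ω, F (X ω, Y ω) ∂P := by
        refine lintegral_congr fun ω => ?_
        rw [randomTail_succ, ← hWX ω, ← hshY ω]
    _ = ∫⁻ p, F p ∂(P.map (fun ω => (X ω, Y ω))) := (lintegral_map hF (hX.prodMk hY)).symm
    _ = ∫⁻ f, ∫⁻ g, F (f, g) ∂(P.map Y) ∂(P.map X) := by
        rw [hmap, lintegral_prod _ hF.aemeasurable]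
    _ ≤ ∫⁻ f, c * Q (W f) ∂(P.map X) := by
        refine lintegral_mono fun f => ?_
        have hFf : Measurable fun g => F (f, g) :=
          hF.comp (measurable_const.prodMk measurable_id)
        rw [lintegral_map hFf hY]
        exact h (W f)
    _ = c * ∫⁻ f, Q (W f) ∂(P.map X) := lintegral_const_mul _ hQW
    _ = _ := by
        rw [lintegral_map hQW hX]
        simp only [hWX]

end RandomTail

section GrowthBound

variable {r : ℕ → Fin 3 → ℕ} {S : ShellCoeff r} {c₀ : ℝ} {ν : Measure ℝ} [IsProbabilityMeasure ν]
  {a b η₀ : ℝ} {e : ℕ → ℝ} {al be de : ℝ → ℝ}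

/-- The Green numbers of the shells concentrate at the real numbers `al l`, `be l`, `de l`. -/
structure CoeffConc (S : ShellCoeff r) (ν : Measure ℝ) (a b η₀ : ℝ) (e : ℕ → ℝ)
    (al be de : ℝ → ℝ) : Prop where
  conc_al : Conc (potentialLaw r ν) (fun p : Param a b η₀ => e p.n + p.η)
    (fun p ω => S.al p.n p.z (shellPart p.n ω)) (fun p => (al p.l : ℂ))
  conc_be : Conc (potentialLaw r ν) (fun p : Param a b η₀ => e p.n + p.η)
    (fun p ω => S.be p.n p.z (shellPart p.n ω)) (fun p => (be p.l : ℂ))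
  conc_de : Conc (potentialLaw r ν) (fun p : Param a b η₀ => e p.n + p.η)
    (fun p ω => S.de p.n p.z (shellPart p.n ω)) (fun p => (de p.l : ℂ))

/-- In the elliptic regime, the mean of the fourth power of the products of transfer matrices is
bounded, at energies at the height `η` for the first `1/η` shells. -/
lemma exists_lintegral_growth_sq_le (h : CoeffConc S ν a b η₀ e al be de) (hc₀ : 0 < c₀)
    (hbe : ∀ l ∈ Icc a b, 2 * c₀ ≤ |be l|) (he0 : ∀ n, 0 ≤ e n) (he : Summable e) {κ₀ : ℝ}
    (hκ₀ : 0 < κ₀)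
    (hκ : ∀ l ∈ Icc a b, (al l * de l - be l ^ 2 + 1) ^ 2 - 4 * (al l * de l) ≤ -κ₀) :
    ∃ K : ℝ≥0, ∀ l ∈ Icc a b, ∀ η, 0 < η → η ≤ η₀ → ∀ N m : ℕ, m * η ≤ 1 →
      ∫⁻ ω, ENNReal.ofReal (growth
        (fun n => S.al n ((l : ℂ) + (η : ℂ) * Complex.I) (shellPart n ω))
        (fun n => truncInv c₀ (S.be n ((l : ℂ) + (η : ℂ) * Complex.I) (shellPart n ω)))
        (fun n => S.be n ((l : ℂ) + (η : ℂ) * Complex.I) (shellPart n ω))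
        (fun n => S.de n ((l : ℂ) + (η : ℂ) * Complex.I) (shellPart n ω)) N m ^ 2)
        ∂(potentialLaw r ν) ≤ K := by
  have hG := h.conc_be.truncInv hc₀ (fun p => by
    rw [Complex.norm_real]; exact hbe p.l p.l_mem)
  obtain ⟨C, hC, H⟩ := exists_lintegral_qform_transfer_le h.conc_al hG h.conc_be h.conc_de
    (fun p h0 => by
      have := hbe p.l p.l_mem
      rw [h0, abs_zero] at this
      linarith) hκ₀ (fun p => hκ p.l p.l_mem)
  obtain ⟨Ca, hCa, HA⟩ := h.conc_al.exists_bound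
  obtain ⟨Cd, hCd, HD⟩ := h.conc_de.exists_bound
  set B := Ca + Cd + 1 with hB
  have hB0 : 0 < B := by positivity
  set Se := ∑' n, e n with hSe
  set K : ℝ := 2 * (8 * B / κ₀) ^ 2 * (2 * (Real.exp (C * (Se + 1)) * B ^ 2)) with hK
  have hK0 : 0 ≤ K := by positivity
  refine ⟨Real.toNNReal K, fun l hl η hη hηle N m hm => ?_⟩
  set z : ℂ := (l : ℂ) + (η : ℂ) * Complex.I with hz
  set q := qform (al l) (be l) (de l) with hq
  have hmq : Measurable fun w => ENNReal.ofReal (q w ^ 2) :=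
    ((measurable_qform _ _ _).pow_const 2).ennreal_ofReal
  have hαB : |al l| ≤ B := by
    have := (HA ⟨0, l, η, hl, hη, hηle⟩).1
    rw [Complex.norm_real, Real.norm_eq_abs] at this
    linarith
  have hδB : |de l| ≤ B := by
    have := (HD ⟨0, l, η, hl, hη, hηle⟩).1
    rw [Complex.norm_real, Real.norm_eq_abs] at this
    linarith
  -- one factor `1 + C (e n + η) ≤ exp (C (e n + η))` for each shell
  have hprod : ∀ (e₀ : ℂ × ℂ) (m : ℕ),
      ∫⁻ ω, ENNReal.ofReal (q (randomTail S c₀ z ω N e₀ m) ^ 2) ∂(potentialLaw r ν)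
        ≤ ENNReal.ofReal (Real.exp (C * (∑ k ∈ Finset.range m, (e (N + k) + η))) * q e₀ ^ 2) := by
    intro e₀ m
    induction m with
    | zero => simp [randomTail, tail]
    | succ m ih =>
      refine (lintegral_randomTail_succ_le S c₀ ν z N e₀ m hmq
        (c := ENNReal.ofReal (1 + C * (e (N + m) + η))) fun w => ?_).trans ?_
      · refine (H ⟨N + m, l, η, hl, hη, hηle⟩ w).trans (le_of_eq ?_)
        rw [← ENNReal.ofReal_mul (by have := he0 (N + m); positivity)]
      · refine (mul_le_mul_right ih _).trans ?_
        rw [← ENNReal.ofReal_mul (by have := he0 (N + m); positivity)]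
        apply ENNReal.ofReal_le_ofReal
        rw [Finset.sum_range_succ, mul_add C (Finset.sum _ _), Real.exp_add, ← mul_assoc]
        apply mul_le_mul_of_nonneg_right _ (sq_nonneg _)
        rw [mul_comm]
        apply mul_le_mul_of_nonneg_left _ (Real.exp_nonneg _)
        rw [add_comm]
        exact Real.add_one_le_exp _
  have hsum : ∑ k ∈ Finset.range m, (e (N + k) + η) ≤ Se + 1 := by
    rw [Finset.sum_add_distrib, Finset.sum_const, Finset.card_range, nsmul_eq_mul]
    refine add_le_add ?_ hm
    have h1 : ∑ k ∈ Finset.range m, e (N + k) ≤ ∑ k ∈ Finset.range (N + m), e k := by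
      rw [Finset.sum_range_add]
      exact le_add_of_nonneg_left (Finset.sum_nonneg fun k _ => he0 k)
    exact h1.trans (he.sum_le_tsum _ fun k _ => he0 k)
  have hunit : ∀ e₀ : ℂ × ℂ, |q e₀| ≤ B →
      ∫⁻ ω, ENNReal.ofReal (q (randomTail S c₀ z ω N e₀ m) ^ 2) ∂(potentialLaw r ν)
        ≤ ENNReal.ofReal (Real.exp (C * (Se + 1)) * B ^ 2) := by
    intro e₀ he₀
    refine (hprod e₀ m).trans (ENNReal.ofReal_le_ofReal ?_)
    have h1 : q e₀ ^ 2 ≤ B ^ 2 := by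
      rw [← sq_abs]; exact pow_le_pow_left₀ (abs_nonneg _) he₀ 2
    gcongr
  have hm1 : ∀ e₀, Measurable fun ω => ENNReal.ofReal (q (randomTail S c₀ z ω N e₀ m) ^ 2) :=
    fun e₀ => hmq.comp ((measurable_randomTail S c₀ N e₀ m).comp
      (measurable_const.prodMk measurable_id))
  have hpt : ∀ ω, ENNReal.ofReal (growth
        (fun n => S.al n z (shellPart n ω)) (fun n => truncInv c₀ (S.be n z (shellPart n ω)))
        (fun n => S.be n z (shellPart n ω)) (fun n => S.de n z (shellPart n ω)) N m ^ 2)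
      ≤ ENNReal.ofReal (2 * (8 * B / κ₀) ^ 2) *
        (ENNReal.ofReal (q (randomTail S c₀ z ω N (1, 0) m) ^ 2)
          + ENNReal.ofReal (q (randomTail S c₀ z ω N (0, 1) m) ^ 2)) := by
    intro ω
    rw [← ENNReal.ofReal_add (sq_nonneg _) (sq_nonneg _), ← ENNReal.ofReal_mul (by positivity)]
    apply ENNReal.ofReal_le_ofReal
    have hs : ∀ w, sqNorm w ≤ 8 * B / κ₀ * |q w| := by
      intro w
      rw [div_mul_eq_mul_div, le_div_iff₀ hκ₀, mul_comm]
      exact sqNorm_le_qform (hκ l hl) hαB hδB w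
    have h1 := hs (randomTail S c₀ z ω N (1, 0) m)
    have h2 := hs (randomTail S c₀ z ω N (0, 1) m)
    set w₁ := randomTail S c₀ z ω N (1, 0) m
    set w₂ := randomTail S c₀ z ω N (0, 1) m
    change (sqNorm w₁ + sqNorm w₂) ^ 2 ≤ _
    calc (sqNorm w₁ + sqNorm w₂) ^ 2 ≤ (8 * B / κ₀ * |q w₁| + 8 * B / κ₀ * |q w₂|) ^ 2 :=
          pow_le_pow_left₀ (add_nonneg (sqNorm_nonneg _) (sqNorm_nonneg _)) (add_le_add h1 h2) 2
      _ = (8 * B / κ₀) ^ 2 * (|q w₁| + |q w₂|) ^ 2 := by ring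
      _ ≤ (8 * B / κ₀) ^ 2 * (2 * (|q w₁| ^ 2 + |q w₂| ^ 2)) := by
          gcongr
          nlinarith [sq_nonneg (|q w₁| - |q w₂|)]
      _ = _ := by rw [sq_abs, sq_abs]; ring
  refine (lintegral_mono hpt).trans ?_
  rw [lintegral_const_mul' _ _ ENNReal.ofReal_ne_top, lintegral_add_left (hm1 _)]
  have e1 := hunit (1, 0) (by simpa [hq, qform] using hδB)
  have e2 := hunit (0, 1) (by simpa [hq, qform] using hαB)
  calc _ ≤ ENNReal.ofReal (2 * (8 * B / κ₀) ^ 2) *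
        (ENNReal.ofReal (Real.exp (C * (Se + 1)) * B ^ 2)
          + ENNReal.ofReal (Real.exp (C * (Se + 1)) * B ^ 2)) := by gcongr
    _ = ENNReal.ofReal K := by
      rw [← ENNReal.ofReal_add (by positivity) (by positivity),
        ← ENNReal.ofReal_mul (by positivity), hK]
      congr 1
      ring

/-- Almost surely, the mean growth of the products of transfer matrices stays bounded along a
sequence of energies approaching the real axis. -/
lemma ae_frequently_lintegral_avgGrowth_le (h : CoeffConc S ν a b η₀ e al be de) (hη₀ : 0 < η₀)
    (hc₀ : 0 < c₀) (hbe : ∀ l ∈ Icc a b, 2 * c₀ ≤ |be l|) (he0 : ∀ n, 0 ≤ e n)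
    (he : Summable e) {κ₀ : ℝ} (hκ₀ : 0 < κ₀)
    (hκ : ∀ l ∈ Icc a b, (al l * de l - be l ^ 2 + 1) ^ 2 - 4 * (al l * de l) ≤ -κ₀) (N : ℕ) :
    ∀ᵐ ω ∂(potentialLaw r ν), ∃ L : ℝ≥0, ∃ᶠ M : ℕ in atTop, ∫⁻ l in Icc a b,
      ENNReal.ofReal (randomAvgGrowth S c₀ (energy M l) ω N M ^ 2) ≤ L := by
  obtain ⟨K, hK⟩ := exists_lintegral_growth_sq_le (c₀ := c₀) h hc₀ hbe he0 he hκ₀ hκ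
  have hmeas : ∀ M : ℕ, Measurable fun p : (Vertex r → ℝ) × ℝ =>
      ENNReal.ofReal (randomAvgGrowth S c₀ (energy M p.2) p.1 N M ^ 2) := by
    intro M
    have he : Measurable (energy M) := by unfold energy; fun_prop
    exact (((measurable_randomAvgGrowth S c₀ N M).comp
      ((he.comp measurable_snd).prodMk measurable_fst)).pow_const 2).ennreal_ofReal
  have hM : ∀ M : ℕ, 0 < M → 1 / (M : ℝ) < η₀ → ∀ l ∈ Icc a b,
      ∫⁻ ω, ENNReal.ofReal (randomAvgGrowth S c₀ (energy M l) ω N M ^ 2) ∂(potentialLaw r ν)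
        ≤ K := by
    intro M hM0 hMη l hl
    have hM' : (0 : ℝ) < M := by exact_mod_cast hM0
    have hmg : ∀ m, Measurable fun ω => ENNReal.ofReal (growth
        (fun n => S.al n (energy M l) (shellPart n ω))
        (fun n => truncInv c₀ (S.be n (energy M l) (shellPart n ω)))
        (fun n => S.be n (energy M l) (shellPart n ω))
        (fun n => S.de n (energy M l) (shellPart n ω)) N m ^ 2) := by
      intro m
      have hmm : Measurable fun ω : Vertex r → ℝ => (energy M l, ω) :=
        measurable_const.prodMk measurable_id
      exact (((measurable_sqNorm.comp ((measurable_randomTail S c₀ N (1, 0) m).comp hmm)).add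
        (measurable_sqNorm.comp
          ((measurable_randomTail S c₀ N (0, 1) m).comp hmm))).pow_const 2).ennreal_ofReal
    calc _ ≤ ∫⁻ ω, ENNReal.ofReal (1 / (M : ℝ)) * ∑ m ∈ Finset.range M, ENNReal.ofReal (growth
            (fun n => S.al n (energy M l) (shellPart n ω))
            (fun n => truncInv c₀ (S.be n (energy M l) (shellPart n ω)))
            (fun n => S.be n (energy M l) (shellPart n ω))
            (fun n => S.de n (energy M l) (shellPart n ω)) N m ^ 2) ∂(potentialLaw r ν) := by
          refine lintegral_mono fun ω => ?_
          rw [← ENNReal.ofReal_sum_of_nonneg (fun _ _ => sq_nonneg _),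
            ← ENNReal.ofReal_mul (by positivity)]
          exact ENNReal.ofReal_le_ofReal (sq_avgGrowth_le _ _ _ _ _ _)
      _ = ENNReal.ofReal (1 / (M : ℝ)) * ∑ m ∈ Finset.range M, ∫⁻ ω, ENNReal.ofReal (growth
            (fun n => S.al n (energy M l) (shellPart n ω))
            (fun n => truncInv c₀ (S.be n (energy M l) (shellPart n ω)))
            (fun n => S.be n (energy M l) (shellPart n ω))
            (fun n => S.de n (energy M l) (shellPart n ω)) N m ^ 2) ∂(potentialLaw r ν) := by
          rw [lintegral_const_mul' _ _ ENNReal.ofReal_ne_top, lintegral_finsetSum _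
            (fun m _ => hmg m)]
      _ ≤ ENNReal.ofReal (1 / (M : ℝ)) * ∑ m ∈ Finset.range M, (K : ℝ≥0∞) := by
          gcongr with m hm
          refine hK l hl (1 / (M : ℝ)) (by positivity) hMη.le N m ?_
          rw [mul_one_div, div_le_one hM']
          exact_mod_cast (Finset.mem_range.1 hm).le
      _ = K := by
          rw [Finset.sum_const, Finset.card_range, nsmul_eq_mul, ← mul_assoc]
          have : ENNReal.ofReal (1 / (M : ℝ)) * (M : ℝ≥0∞) = 1 := by
            rw [← ENNReal.ofReal_natCast, ← ENNReal.ofReal_mul (by positivity),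
              one_div_mul_cancel hM'.ne', ENNReal.ofReal_one]
          rw [this, one_mul]
  -- Fatou's lemma, and Tonelli's theorem for the integrals over the energy
  have hint : ∫⁻ ω, liminf (fun M : ℕ => ∫⁻ l in Icc a b,
      ENNReal.ofReal (randomAvgGrowth S c₀ (energy M l) ω N M ^ 2)) atTop ∂(potentialLaw r ν)
      < ∞ := by
    refine lt_of_le_of_lt (lintegral_liminf_le fun M => (hmeas M).lintegral_prod_right') ?_
    refine lt_of_le_of_lt (liminf_le_of_frequently_le' (x := K * ENNReal.ofReal (b - a)) ?_)
      (ENNReal.mul_lt_top ENNReal.coe_lt_top ENNReal.ofReal_lt_top)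
    refine Eventually.frequently ?_
    filter_upwards [eventually_one_div_lt hη₀] with M hMη
    rw [lintegral_lintegral_swap (hmeas M).aemeasurable]
    calc _ ≤ ∫⁻ _ in Icc a b, (K : ℝ≥0∞) :=
          setLIntegral_mono' measurableSet_Icc (hM M hMη.1 hMη.2)
      _ = _ := by rw [setLIntegral_const, Real.volume_Icc]
  filter_upwards [ae_lt_top (Measurable.liminf fun M => (hmeas M).lintegral_prod_right') hint.ne]
    with ω hω
  obtain ⟨L, hL1, hL2⟩ := ENNReal.lt_iff_exists_nnreal_btwn.1 hω
  exact ⟨L, (frequently_lt_of_liminf_lt (by isBoundedDefault) hL1).mono fun M hM => hM.le⟩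

end GrowthBound

/-! ### Energy intervals with absolutely continuous spectrum -/

section Interval

variable {r : ℕ → Fin 3 → ℕ} {C : Vertex r → Vertex r → ℝ} {v : Vertex r → ℝ}
  {H : L2 (Vertex r) →L[ℂ] L2 (Vertex r)}

/-- If the Green number `β` does not vanish at `l` in any shell, then an eigenfunction with finite
support would vanish at the couplings between the shells, backwards from infinity, so that its
restriction to some shell would be an eigenfunction of the shell. -/
lemma notMem_finSuppEigenvalues (hC : IsShellMatrix r C)
    (hH : IsSchrodinger (fun x y => coupling r x y + C x y) v H) {l : ℝ} {α β δ : ℕ → ℂ}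
    (hG : ∀ n, IsShellGreen C n (fun s => v ⟨n, s⟩) l (α n) (β n) (δ n)) (hβ : ∀ n, β n ≠ 0)
    (hinj : ∀ n (f : Shell r n → ℂ),
      (∀ s, ∑ t : Shell r n, (C ⟨n, s⟩ ⟨n, t⟩ : ℂ) * f t + v ⟨n, s⟩ * f s = l * f s) →
        ∀ s, f s = 0) :
    l ∉ finSuppEigenvalues H := by
  rintro ⟨φ, hφ0, hfin, he⟩
  obtain ⟨N, hN⟩ : ∃ N, ∀ x : Vertex r, N ≤ x.1 → φ x = 0 := by
    obtain ⟨N, hN⟩ := (hfin.image fun x : Vertex r => x.1).bddAbove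
    refine ⟨N + 1, fun x hx => ?_⟩
    by_contra h
    have := hN (mem_image_of_mem _ h)
    omega
  have he0 : H φ - (l : ℂ) • φ = 0 := sub_eq_zero.2 he
  have hend : sqNorm (bond φ (N + 1)) = 0 := by
    have h1 : (bond φ (N + 1)).1 = 0 := bond_fst_eq_zero fun s => hN _ (by simp)
    have h2 : (bond φ (N + 1)).2 = 0 := bond_snd_eq_zero fun s => hN _ (by simp)
    rw [sqNorm, h1, h2]
    simp
  have hγ : ∀ n, (β n)⁻¹ * β n = 1 := fun n => inv_mul_cancel₀ (hβ n)
  -- the product of the transfer matrices from `n` to `N + 1` is invertible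
  have hbond : ∀ n, n ≤ N + 1 → bond φ n = 0 := by
    intro n hn
    have h1 := sqNorm_le_growth_mul (α := α) (δ := δ) (γ := fun n => (β n)⁻¹) (β := β) (N := n)
      (fun n _ => hγ n) (bond φ n) (N + 1 - n)
    rw [← bond_eq_tail hC hH he0 (fun _ _ => rfl) (fun n _ => hG n) (fun n _ => hγ n),
      Nat.add_sub_cancel' hn, hend, mul_zero] at h1
    have h2 : ‖(bond φ n).1‖ ^ 2 + ‖(bond φ n).2‖ ^ 2 ≤ 0 := h1
    have h3 : ‖(bond φ n).1‖ = 0 := by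
      nlinarith [sq_nonneg ‖(bond φ n).1‖, sq_nonneg ‖(bond φ n).2‖]
    have h4 : ‖(bond φ n).2‖ = 0 := by
      nlinarith [sq_nonneg ‖(bond φ n).1‖, sq_nonneg ‖(bond φ n).2‖]
    exact Prod.ext (norm_eq_zero.1 h3) (norm_eq_zero.1 h4)
  refine hφ0 (lp.ext (funext fun x => ?_))
  obtain ⟨n, s⟩ := x
  rcases lt_or_ge n N with hn | hn
  · refine hinj n (fun s => φ ⟨n, s⟩) (fun s => ?_) s
    have h := hH.apply_shell hC φ n s
    rw [hbond n (by omega), hbond (n + 1) (by omega), he,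
      show ((l : ℂ) • φ) ⟨n, s⟩ = (l : ℂ) * φ ⟨n, s⟩ from rfl] at h
    simpa using h.symm
  · exact hN _ hn

/-- The vectors with finite support are dense. -/
lemma dense_finite_support :
    Dense {ψ : L2 (Vertex r) | ∃ N, ∀ x : Vertex r, N ≤ x.1 → ψ x = 0} := by
  classical
  intro ψ
  have h := lp.hasSum_single (by norm_num : (2 : ℝ≥0∞) ≠ ∞) ψ
  refine mem_closure_of_tendsto h (Eventually.of_forall fun F => ?_)
  obtain ⟨N, hN⟩ := (F.image fun x : Vertex r => x.1).bddAbove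
  refine ⟨N + 1, fun x hx => ?_⟩
  rw [lp.coeFn_sum, Finset.sum_apply]
  refine Finset.sum_eq_zero fun y hy => ?_
  rw [lp.single_apply]
  refine Pi.single_eq_of_ne ?_ _
  rintro rfl
  have := hN (Finset.mem_coe.2 (Finset.mem_image_of_mem _ hy))
  omega

variable {S : ShellCoeff r} {a b η₀ : ℝ} {e : ℕ → ℝ} {al be de : ℝ → ℝ}

/-- Concentration on a smaller set of energies. -/
lemma CoeffConc.mono {ν : Measure ℝ} (h : CoeffConc S ν a b η₀ e al be de) {a' b' η₁ : ℝ}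
    (ha : a ≤ a') (hb : b' ≤ b) (hη : η₁ ≤ η₀) : CoeffConc S ν a' b' η₁ e al be de := by
  let f : Param a' b' η₁ → Param a b η₀ := fun p =>
    ⟨p.n, p.l, p.η, ⟨ha.trans p.l_mem.1, p.l_mem.2.trans hb⟩, p.η_pos, p.η_le.trans hη⟩
  exact ⟨h.conc_al.comp f, h.conc_be.comp f, h.conc_de.comp f⟩

/-- Almost surely, the products of transfer matrices starting at late shells are bounded at the
energies close to `[a, b]`. -/
def IsTransportInterval (C : Vertex r → Vertex r → ℝ) (ν : Measure ℝ) [IsProbabilityMeasure ν]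
    (a b : ℝ) : Prop :=
  ∀ᵐ ω ∂(potentialLaw r ν), ∃ N₀ : ℕ, ∀ N, N₀ ≤ N → ∃ α γ β δ : ℂ → ℕ → ℂ,
    HasBoundedTail C ω a b N α γ β δ

variable {ν : Measure ℝ} [IsProbabilityMeasure ν]

/-- If every energy of `B` lies in a transport interval, then almost surely `B` belongs to the
spectrum, which is purely absolutely continuous in `B` off the eigenvalues with finitely supported
eigenfunctions. Countably many of the intervals cover `B`, so that one null set serves all
energies. -/
lemma ae_spectrum_of_isTransportInterval (hC : IsShellMatrix r C) (hr : ∀ n, 0 < r n 2)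
    {B : Set ℝ} (hB : ∀ t ∈ B, ∃ a b, t ∈ Ioo a b ∧ IsTransportInterval C ν a b) :
    ∀ᵐ ω ∂(potentialLaw r ν), ∀ H : L2 (Vertex r) →L[ℂ] L2 (Vertex r),
      IsSchrodinger (fun x y => coupling r x y + C x y) ω H →
        (∀ t ∈ B, (t : ℂ) ∈ spectrum ℂ H) ∧ PurelyACOn H (B \ finSuppEigenvalues H) := by
  let ι := {p : ℝ × ℝ // IsTransportInterval C ν p.1 p.2}
  obtain ⟨T, hT, hTU⟩ := TopologicalSpace.isOpen_iUnion_countable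
    (fun p : ι => Ioo p.1.1 p.1.2) fun p => isOpen_Ioo
  have hcov : ∀ t ∈ B, ∃ p : ι, p ∈ T ∧ t ∈ Ioo p.1.1 p.1.2 := by
    intro t ht
    obtain ⟨a, b, hab, h⟩ := hB t ht
    have : t ∈ ⋃ p : ι, Ioo p.1.1 p.1.2 := mem_iUnion.2 ⟨⟨(a, b), h⟩, hab⟩
    rw [← hTU] at this
    obtain ⟨p, hp, hpt⟩ := mem_iUnion₂.1 this
    exact ⟨p, hp, hpt⟩
  have hae := (ae_ball_iff hT).2 fun (p : ι) _ => p.2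
  filter_upwards [hae] with ω hω H hH
  constructor
  · intro t ht
    obtain ⟨p, hpT, htp⟩ := hcov t ht
    obtain ⟨N₀, hN₀⟩ := hω p hpT
    obtain ⟨α, γ, β, δ, h⟩ := hN₀ (N₀ + 1) (by omega)
    exact h.mem_spectrum hC (hr N₀) hH htp
  · refine purelyACOn_of_dense (hC.isSelfAdjoint hH) dense_finite_support ?_
    rintro ψ ⟨N, hN⟩ μ hμ
    refine restrict_absolutelyContinuous_of_locally fun t ht => ?_
    obtain ⟨p, hpT, htp⟩ := hcov t ht.1
    obtain ⟨N₀, hN₀⟩ := hω p hpT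
    obtain ⟨α, γ, β, δ, h⟩ := hN₀ (N₀ + N + 1) (by omega)
    exact h.locally_ac hC hH htp ht.2 (fun x hx => hN x (by omega)) hμ

variable {c₀ : ℝ}

/-- The numbers `S` are almost surely the Green numbers of the late shells at the energies close to
`[a, b]`, with `β` bounded away from zero. -/
def IsGreenOn (S : ShellCoeff r) (C : Vertex r → Vertex r → ℝ) (ν : Measure ℝ)
    [IsProbabilityMeasure ν] (c₀ a b η₀ : ℝ) : Prop :=
  ∀ᵐ ω ∂(potentialLaw r ν), ∃ N₀ : ℕ, ∀ n, N₀ ≤ n → ∀ l ∈ Icc a b, ∀ η : ℝ, 0 < η → η ≤ η₀ →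
    IsShellGreen C n (shellPart n ω) ((l : ℂ) + (η : ℂ) * Complex.I)
      (S.al n ((l : ℂ) + (η : ℂ) * Complex.I) (shellPart n ω))
      (S.be n ((l : ℂ) + (η : ℂ) * Complex.I) (shellPart n ω))
      (S.de n ((l : ℂ) + (η : ℂ) * Complex.I) (shellPart n ω)) ∧
    c₀ ≤ ‖S.be n ((l : ℂ) + (η : ℂ) * Complex.I) (shellPart n ω)‖

/-- Concentration of the Green numbers at an elliptic limit makes an interval a transport
interval. There the cut-off inverse of `β` used in the estimates is the true inverse. -/
lemma CoeffConc.isTransportInterval (h : CoeffConc S ν a b η₀ e al be de) (hη₀ : 0 < η₀)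
    (hc₀ : 0 < c₀) (hbe : ∀ l ∈ Icc a b, 2 * c₀ ≤ |be l|) (he0 : ∀ n, 0 ≤ e n)
    (he : Summable e) {κ₀ : ℝ} (hκ₀ : 0 < κ₀)
    (hκ : ∀ l ∈ Icc a b, (al l * de l - be l ^ 2 + 1) ^ 2 - 4 * (al l * de l) ≤ -κ₀)
    (hG : IsGreenOn S C ν c₀ a b η₀) : IsTransportInterval C ν a b := by
  have hgr := ae_all_iff.2 fun N =>
    ae_frequently_lintegral_avgGrowth_le (c₀ := c₀) h hη₀ hc₀ hbe he0 he hκ₀ hκ N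
  filter_upwards [hG, hgr] with ω hω hg
  obtain ⟨N₀, hN₀⟩ := hω
  refine ⟨N₀, fun N hN => ⟨fun z n => S.al n z (shellPart n ω),
    fun z n => truncInv c₀ (S.be n z (shellPart n ω)), fun z n => S.be n z (shellPart n ω),
    fun z n => S.de n z (shellPart n ω), ⟨η₀, hη₀, fun l hl η hη hηle n hn => ?_⟩, hg N⟩⟩
  obtain ⟨h1, h2⟩ := hN₀ n (hN.trans hn) l hl η hη hηle
  exact ⟨h1, truncInv_mul hc₀ h2⟩

/-- The elliptic regime is an open condition on the energy. -/
lemma exists_isTransportInterval {t : ℝ} (hal : ContinuousAt al t) (hbe : ContinuousAt be t)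
    (hde : ContinuousAt de t) (hbe0 : be t ≠ 0)
    (htr : |be t + (1 - al t * de t) / be t| < 2) (he0 : ∀ n, 0 ≤ e n) (he : Summable e)
    (hab : t ∈ Ioo a b) (h : CoeffConc S ν a b η₀ e al be de)
    (hG : ∀ a' b', a ≤ a' → b' ≤ b → ∀ c : ℝ, 0 < c → (∀ l ∈ Icc a' b', 2 * c ≤ |be l|) →
      ∃ c₀ η₁, 0 < c₀ ∧ c₀ ≤ c ∧ 0 < η₁ ∧ η₁ ≤ η₀ ∧ IsGreenOn S C ν c₀ a' b' η₁) :
    ∃ a' b', t ∈ Ioo a' b' ∧ IsTransportInterval C ν a' b' := by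
  have hdisc := discrim_neg_of_trace hbe0 htr
  set D : ℝ → ℝ := fun l => (al l * de l - be l ^ 2 + 1) ^ 2 - 4 * (al l * de l) with hD
  have hDc : ContinuousAt D t :=
    ((((hal.mul hde).sub (hbe.pow 2)).add continuousAt_const).pow 2).sub
      (continuousAt_const.mul (hal.mul hde))
  have h1 : ∀ᶠ l in 𝓝 t, D l < D t / 2 := hDc.eventually_lt_const (by simp only [hD]; linarith)
  have h2 : ∀ᶠ l in 𝓝 t, |be t| / 2 < |be l| :=
    hbe.abs.eventually_const_lt (by have := abs_pos.2 hbe0; linarith)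
  have h3 : ∀ᶠ l in 𝓝 t, l ∈ Ioo a b := isOpen_Ioo.mem_nhds hab
  obtain ⟨ε, hε, hball⟩ := Metric.eventually_nhds_iff_ball.1 (h1.and (h2.and h3))
  have hin : ∀ l ∈ Icc (t - ε / 2) (t + ε / 2),
      D l < D t / 2 ∧ |be t| / 2 < |be l| ∧ l ∈ Ioo a b := by
    intro l hl
    apply hball
    rw [Metric.mem_ball, Real.dist_eq, abs_lt]
    constructor <;> linarith [hl.1, hl.2]
  have ha : a ≤ t - ε / 2 := (hin _ ⟨le_rfl, by linarith⟩).2.2.1.le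
  have hb : t + ε / 2 ≤ b := (hin _ ⟨by linarith, le_rfl⟩).2.2.2.le
  obtain ⟨c₀, η₁, hc₀, hc, hη₁, hη, hGr⟩ := hG _ _ ha hb (|be t| / 4)
    (by have := abs_pos.2 hbe0; linarith) fun l hl => by linarith [(hin l hl).2.1]
  refine ⟨t - ε / 2, t + ε / 2, ⟨by linarith, by linarith⟩, ?_⟩
  exact (h.mono ha hb hη).isTransportInterval (κ₀ := -(D t) / 2) hη₁ hc₀
    (fun l hl => by linarith [(hin l hl).2.1]) he0 he (by simp only [hD]; linarith)
    (fun l hl => by have := (hin l hl).1; simp only [hD] at this ⊢; linarith) hGr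

end Interval

/-! ### Averages of independent random variables -/

section Average

lemma norm_average_le {J : Type*} {T : Finset J} (hT : 0 < T.card) {f : J → ℂ} {C : ℝ}
    (hf : ∀ j ∈ T, ‖f j‖ ≤ C) : ‖(T.card : ℂ)⁻¹ * ∑ j ∈ T, f j‖ ≤ C := by
  rw [norm_mul, norm_inv, Complex.norm_natCast, inv_mul_le_iff₀ (by exact_mod_cast hT)]
  exact (norm_sum_le_of_le _ hf).trans (by rw [Finset.sum_const, nsmul_eq_mul])

variable {Ω : Type*} [MeasurableSpace Ω] {P : Measure Ω} [IsProbabilityMeasure P]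

/-- The variance of an average of `m` pairwise independent variables is of the order `1 / m`. -/
lemma integral_sub_sq_average_le {J : Type*} {T : Finset J} (hT : T.Nonempty) {X : J → Ω → ℝ}
    {K : ℝ} (hX : ∀ j ∈ T, Measurable (X j)) (hK : ∀ j ∈ T, ∀ᵐ ω ∂P, |X j ω| ≤ K)
    (hind : Set.Pairwise (T : Set J) fun i j => IndepFun (X i) (X j) P) :
    ∫ ω, ((T.card : ℝ)⁻¹ * ∑ j ∈ T, X j ω - (T.card : ℝ)⁻¹ * ∑ j ∈ T, ∫ ω', X j ω' ∂P) ^ 2 ∂P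
      ≤ K ^ 2 * (T.card : ℝ)⁻¹ := by
  have hc : (0 : ℝ) < T.card := by exact_mod_cast hT.card_pos
  have hmem : ∀ j ∈ T, MemLp (X j) 2 P := fun j hj =>
    MemLp.of_bound (hX j hj).aestronglyMeasurable K (hK j hj)
  have hint : ∀ j ∈ T, Integrable (X j) P := fun j hj => (hmem j hj).integrable one_le_two
  have hm : AEMeasurable (∑ j ∈ T, X j) P :=
    Finset.aemeasurable_sum _ fun j hj => (hX j hj).aemeasurable
  have hE : ∫ ω, (∑ j ∈ T, X j) ω ∂P = ∑ j ∈ T, ∫ ω, X j ω ∂P := by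
    simp only [Finset.sum_apply]
    exact integral_finsetSum _ hint
  calc _ = ∫ ω, ((T.card : ℝ)⁻¹) ^ 2 * ((∑ j ∈ T, X j) ω - ∫ ω', (∑ j ∈ T, X j) ω' ∂P) ^ 2 ∂P := by
        refine integral_congr_ae (ae_of_all _ fun ω => ?_)
        simp only [hE]
        rw [Finset.sum_apply]
        ring
    _ = ((T.card : ℝ)⁻¹) ^ 2 * ∑ j ∈ T, variance (X j) P := by
        rw [integral_const_mul, ← variance_eq_integral hm, IndepFun.variance_sum hmem hind]
    _ ≤ ((T.card : ℝ)⁻¹) ^ 2 * ∑ j ∈ T, K ^ 2 := by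
        gcongr with j hj
        refine (variance_le_expectation_sq (hX j hj).aestronglyMeasurable).trans ?_
        calc ∫ ω, (X j ^ 2) ω ∂P ≤ ∫ _, K ^ 2 ∂P := by
              refine integral_mono_ae (hmem j hj).integrable_sq (integrable_const _) ?_
              filter_upwards [hK j hj] with ω hω
              exact sq_le_sq' (by linarith [(abs_le.1 hω).1]) (abs_le.1 hω).2
          _ = K ^ 2 := by simp
    _ = _ := by
        rw [Finset.sum_const, nsmul_eq_mul]
        field_simp

/-- Averages of pairwise independent bounded random variables with almost the same mean
concentrate. -/
lemma Conc.average {ι : Type*} {J : ι → Type*} {ε : ι → ℝ} (hε : ∀ i, 0 ≤ ε i)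
    {T : ∀ i, Finset (J i)}
    (hT : ∀ i, (T i).Nonempty) {X : ∀ i, J i → Ω → ℂ} {x : ι → ℂ} {K : ℝ} (hK0 : 0 ≤ K)
    (hX : ∀ i j, Measurable (X i j)) (hK : ∀ i, ∀ j ∈ T i, ∀ᵐ ω ∂P, ‖X i j ω‖ ≤ K)
    (hx : ∀ i, ‖x i‖ ≤ K)
    (hind : ∀ i, Set.Pairwise (T i : Set (J i)) fun j k => IndepFun (X i j) (X i k) P)
    (hcard : ∀ i, ((T i).card : ℝ)⁻¹ ≤ K * ε i)
    (hmean : ∀ i, ∀ j ∈ T i, ‖∫ ω, X i j ω ∂P - x i‖ ≤ K * ε i) :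
    Conc P ε (fun i ω => ((T i).card : ℂ)⁻¹ * ∑ j ∈ T i, X i j ω) x := by
  have hc : ∀ i, (0 : ℝ) < (T i).card := fun i => by exact_mod_cast (hT i).card_pos
  have havg : ∀ i (f : J i → ℂ) (C : ℝ), (∀ j ∈ T i, ‖f j‖ ≤ C) →
      ‖((T i).card : ℂ)⁻¹ * ∑ j ∈ T i, f j‖ ≤ C := fun i _ _ hf =>
    norm_average_le (hT i).card_pos hf
  have hae : ∀ i, ∀ᵐ ω ∂P, ‖((T i).card : ℂ)⁻¹ * ∑ j ∈ T i, X i j ω‖ ≤ K := by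
    intro i
    filter_upwards [(ae_ball_iff (T i).countable_toSet).2 fun j hj => hK i j hj] with ω hω
    exact havg i _ K fun j hj => hω j hj
  have hme : ∀ i, Measurable fun ω => ((T i).card : ℂ)⁻¹ * ∑ j ∈ T i, X i j ω := fun i =>
    measurable_const.mul (Finset.measurable_fun_sum _ fun j _ => hX i j)
  have hint : ∀ i, ∀ j ∈ T i, Integrable (X i j) P := fun i j hj =>
    integrable_of_ae_bound (hX i j) (hK i j hj)
  -- the exact mean; its distance to `x i` is the bias
  set m : ι → ℂ := fun i => ((T i).card : ℂ)⁻¹ * ∑ j ∈ T i, ∫ ω, X i j ω ∂P with hm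
  have hmx : ∀ i, ‖m i - x i‖ ≤ K * ε i := by
    intro i
    have : m i - x i = ((T i).card : ℂ)⁻¹ * ∑ j ∈ T i, (∫ ω, X i j ω ∂P - x i) := by
      have h0 : ((T i).card : ℂ) ≠ 0 := by exact_mod_cast (hc i).ne'
      rw [Finset.sum_sub_distrib, Finset.sum_const, nsmul_eq_mul, mul_sub,
        inv_mul_cancel_left₀ h0]
    rw [this]
    exact havg i _ _ (hmean i)
  have hmK : ∀ i, ‖m i‖ ≤ K := fun i => havg i _ K fun j hj => by
    refine (norm_integral_le_of_norm_le_const (hK i j hj)).trans ?_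
    simp
  refine ⟨hε, hme, 4 * K ^ 3 + 4 * K ^ 2 + K + 1, by positivity, fun i => ⟨?_, ?_, ?_, ?_⟩⟩
  · exact (hx i).trans (by nlinarith [pow_nonneg hK0 3, sq_nonneg K])
  · filter_upwards [hae i] with ω hω
    exact hω.trans (by nlinarith [pow_nonneg hK0 3, sq_nonneg K])
  · have h1 : ∫ ω, (((T i).card : ℂ)⁻¹ * ∑ j ∈ T i, X i j ω - x i) ∂P = m i - x i := by
      rw [integral_sub (integrable_of_ae_bound (hme i) (hae i)) (integrable_const _),
        integral_const_mul, integral_finsetSum _ (hint i)]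
      simp [hm]
    rw [h1]
    exact (hmx i).trans (mul_le_mul_of_nonneg_right
      (by nlinarith [pow_nonneg hK0 3, sq_nonneg K]) (hε i))
  · set A : Ω → ℂ := fun ω => ((T i).card : ℂ)⁻¹ * ∑ j ∈ T i, X i j ω with hA
    have hre := integral_sub_sq_average_le (P := P) (hT i) (X := fun j ω => (X i j ω).re) (K := K)
      (fun j _ => Complex.measurable_re.comp (hX i j))
      (fun j hj => (hK i j hj).mono fun ω h => (Complex.abs_re_le_norm _).trans h)
      (fun j hj k hk hjk => (hind i hj hk hjk).comp Complex.measurable_re Complex.measurable_re)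
    have him := integral_sub_sq_average_le (P := P) (hT i) (X := fun j ω => (X i j ω).im) (K := K)
      (fun j _ => Complex.measurable_im.comp (hX i j))
      (fun j hj => (hK i j hj).mono fun ω h => (Complex.abs_im_le_norm _).trans h)
      (fun j hj k hk hjk => (hind i hj hk hjk).comp Complex.measurable_im Complex.measurable_im)
    have hcre : ∀ f : J i → ℂ, (((T i).card : ℂ)⁻¹ * ∑ j ∈ T i, f j).re
        = ((T i).card : ℝ)⁻¹ * ∑ j ∈ T i, (f j).re := by
      intro f
      rw [← Complex.ofReal_natCast, ← Complex.ofReal_inv, Complex.re_ofReal_mul, Complex.re_sum]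
    have hcim : ∀ f : J i → ℂ, (((T i).card : ℂ)⁻¹ * ∑ j ∈ T i, f j).im
        = ((T i).card : ℝ)⁻¹ * ∑ j ∈ T i, (f j).im := by
      intro f
      rw [← Complex.ofReal_natCast, ← Complex.ofReal_inv, Complex.im_ofReal_mul, Complex.im_sum]
    have hIre : ∀ j ∈ T i, ∫ ω, (X i j ω).re ∂P = (∫ ω, X i j ω ∂P).re := fun j hj =>
      integral_re (hint i j hj)
    have hIim : ∀ j ∈ T i, ∫ ω, (X i j ω).im ∂P = (∫ ω, X i j ω ∂P).im := fun j hj =>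
      integral_im (hint i j hj)
    rw [Finset.sum_congr rfl hIre, ← hcre] at hre
    rw [Finset.sum_congr rfl hIim, ← hcim] at him
    simp only [← hcre] at hre
    simp only [← hcim] at him
    have hb : ∀ᵐ ω ∂P, ‖A ω - m i‖ ≤ 2 * K := by
      filter_upwards [hae i] with ω hω
      exact (norm_sub_le _ _).trans (by linarith [hmK i])
    have hire : Integrable (fun ω => ((A ω).re - (m i).re) ^ 2) P := by
      refine Integrable.of_bound
        (((Complex.measurable_re.comp (hme i)).sub_const _).pow_const 2).aestronglyMeasurable
        ((2 * K) ^ 2) ?_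
      filter_upwards [hb] with ω hω
      rw [Real.norm_of_nonneg (sq_nonneg _), ← Complex.sub_re, ← sq_abs]
      exact pow_le_pow_left₀ (abs_nonneg _) ((Complex.abs_re_le_norm _).trans hω) 2
    have hiim : Integrable (fun ω => ((A ω).im - (m i).im) ^ 2) P := by
      refine Integrable.of_bound
        (((Complex.measurable_im.comp (hme i)).sub_const _).pow_const 2).aestronglyMeasurable
        ((2 * K) ^ 2) ?_
      filter_upwards [hb] with ω hω
      rw [Real.norm_of_nonneg (sq_nonneg _), ← Complex.sub_im, ← sq_abs]
      exact pow_le_pow_left₀ (abs_nonneg _) ((Complex.abs_im_le_norm _).trans hω) 2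
    have hd : ∀ z w : ℂ, ‖z - w‖ ^ 2 = (z.re - w.re) ^ 2 + (z.im - w.im) ^ 2 := by
      intro z w
      rw [← Complex.normSq_eq_norm_sq, Complex.normSq_apply, Complex.sub_re, Complex.sub_im]
      ring
    have hii : Integrable
        (fun ω => 2 * (((A ω).re - (m i).re) ^ 2 + ((A ω).im - (m i).im) ^ 2)) P :=
      (hire.add hiim).const_mul 2
    calc ∫ ω, ‖A ω - x i‖ ^ 2 ∂P
        ≤ ∫ ω, (2 * (((A ω).re - (m i).re) ^ 2 + ((A ω).im - (m i).im) ^ 2)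
          + 2 * ‖m i - x i‖ ^ 2) ∂P := by
          refine integral_mono_ae (integrable_sq_of_ae_bound (hme i) (hae i) _)
            (hii.add (integrable_const _)) (ae_of_all _ fun ω => ?_)
          simp only [← hd]
          have : ‖A ω - x i‖ ≤ ‖A ω - m i‖ + ‖m i - x i‖ := norm_sub_le_norm_sub_add_norm_sub _ _ _
          nlinarith [norm_nonneg (A ω - x i), sq_nonneg (‖A ω - m i‖ - ‖m i - x i‖)]
      _ = 2 * (∫ ω, ((A ω).re - (m i).re) ^ 2 ∂P + ∫ ω, ((A ω).im - (m i).im) ^ 2 ∂P)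
          + 2 * ‖m i - x i‖ ^ 2 := by
          rw [integral_add hii (integrable_const _), integral_const_mul,
            integral_add hire hiim]
          simp
      _ ≤ 2 * (K ^ 2 * (K * ε i) + K ^ 2 * (K * ε i)) + 2 * ((2 * K) * (K * ε i)) := by
          have h1 : K ^ 2 * ((T i).card : ℝ)⁻¹ ≤ K ^ 2 * (K * ε i) :=
            mul_le_mul_of_nonneg_left (hcard i) (sq_nonneg K)
          have h2 : ‖m i - x i‖ ^ 2 ≤ (2 * K) * (K * ε i) := by
            rw [pow_two]
            exact mul_le_mul ((norm_sub_le _ _).trans (by linarith [hmK i, hx i])) (hmx i)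
              (norm_nonneg _) (by positivity)
          have h3 := hre.trans h1
          have h4 := him.trans h1
          linarith
      _ ≤ _ := by
          have := hε i
          nlinarith [mul_nonneg hK0 this]

end Average

section EventualBound

variable {r : ℕ → Fin 3 → ℕ} {S : ShellCoeff r} {ν : Measure ℝ} [IsProbabilityMeasure ν]
  {a b η₀ : ℝ} {e : ℕ → ℝ} {al be de : ℝ → ℝ}

/-- If the fluctuations are summable, the numbers `β` of the late shells are almost surely bounded
away from zero, uniformly in the energy: by the Borel–Cantelli lemma at the energies of a finite
net, hence everywhere by Lipschitz continuity. -/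
lemma CoeffConc.ae_eventually_le_norm (h : CoeffConc S ν a b η₀ e al be de) (hη₀ : 0 < η₀)
    (he0 : ∀ n, 0 < e n) (he : Summable e) {L : ℝ} (hL0 : 0 ≤ L)
    (hL : ∀ᵐ ω ∂(potentialLaw r ν), ∀ p q : Param a b η₀, p.n = q.n →
      ‖S.be p.n p.z (shellPart p.n ω) - S.be p.n q.z (shellPart p.n ω)‖ ≤ L * ‖p.z - q.z‖)
    {c : ℝ} (hc : 0 < c) (hbe : ∀ l ∈ Icc a b, 2 * c ≤ |be l|) :
    ∃ η₁, 0 < η₁ ∧ η₁ ≤ η₀ ∧ ∀ᵐ ω ∂(potentialLaw r ν), ∃ N₀ : ℕ, ∀ n, N₀ ≤ n →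
      ∀ l ∈ Icc a b, ∀ η : ℝ, 0 < η → η ≤ η₁ →
        c / 2 ≤ ‖S.be n ((l : ℂ) + (η : ℂ) * Complex.I) (shellPart n ω)‖ := by
  set ρ : ℝ := c / (4 * (L + 1)) with hρ
  have hρ0 : 0 < ρ := by positivity
  have hLρ : L * (ρ + ρ) ≤ c / 2 := by
    rw [hρ, ← two_mul, mul_div_assoc', mul_div_assoc', div_le_div_iff₀ (by positivity) two_pos]
    nlinarith
  set η₁ : ℝ := min η₀ ρ with hη₁
  have hη₁0 : 0 < η₁ := lt_min hη₀ hρ0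
  refine ⟨η₁, hη₁0, min_le_left _ _, ?_⟩
  obtain ⟨T, hTs, hTf, hTc⟩ := (isCompact_Icc (a := a) (b := b)).finite_cover_balls hρ0
  obtain ⟨C, hC, H⟩ := h.conc_be.exists_bound
  -- the imaginary part of the energies used for the shell `n` has to be summable as well
  set h' : ℕ → ℝ := fun n => min (e n) η₁ with hh
  have hh0 : ∀ n, 0 < h' n := fun n => lt_min (he0 n) hη₁0
  have hhe : ∀ n, h' n ≤ e n := fun n => min_le_left _ _
  have hhη : ∀ n, h' n ≤ η₁ := fun n => min_le_right _ _
  have hBC : ∀ l ∈ T, ∀ᵐ ω ∂(potentialLaw r ν), ∀ᶠ n in atTop,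
      ‖S.be n ((l : ℂ) + (h' n : ℂ) * Complex.I) (shellPart n ω) - be l‖ ^ 2 < c ^ 2 := by
    intro l hl
    have hP : ∀ n, (potentialLaw r ν) {ω | c ^ 2 ≤
        ‖S.be n ((l : ℂ) + (h' n : ℂ) * Complex.I) (shellPart n ω) - be l‖ ^ 2}
        ≤ ENNReal.ofReal (2 * C / c ^ 2 * e n) := by
      intro n
      let p : Param a b η₀ := ⟨n, l, h' n, hTs hl, hh0 n, (hhη n).trans (min_le_left _ _)⟩
      have h1 := mul_meas_ge_le_integral_of_nonneg (μ := potentialLaw r ν)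
        (f := fun ω => ‖S.be n p.z (shellPart n ω) - be l‖ ^ 2)
        (ae_of_all _ fun ω => sq_nonneg _)
        (integrable_sq_of_ae_bound (h.conc_be.measurable p) (H p).2.1 _) (c ^ 2)
      have h2 := h1.trans (H p).2.2.2
      rw [← ofReal_measureReal]
      apply ENNReal.ofReal_le_ofReal
      have h3 : C * (e p.n + p.η) ≤ 2 * C * e n := by
        have := mul_le_mul_of_nonneg_left (hhe n) hC
        change C * (e n + h' n) ≤ _
        linarith
      rw [div_mul_eq_mul_div, le_div_iff₀ (by positivity), mul_comm]
      exact h2.trans h3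
    have hsum : ∑' n, (potentialLaw r ν) {ω | c ^ 2 ≤
        ‖S.be n ((l : ℂ) + (h' n : ℂ) * Complex.I) (shellPart n ω) - be l‖ ^ 2} ≠ ∞ :=
      ne_top_of_le_ne_top (he.mul_left _).tsum_ofReal_ne_top (ENNReal.tsum_le_tsum hP)
    filter_upwards [ae_eventually_notMem hsum] with ω hω
    filter_upwards [hω] with n hn
    simpa using hn
  filter_upwards [(ae_ball_iff hTf.countable).2 hBC, hL] with ω hω hLω
  obtain ⟨N₀, hN₀⟩ := eventually_atTop.1 (hTf.eventually_all.2 hω)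
  refine ⟨N₀, fun n hn l hl η hη hηle => ?_⟩
  obtain ⟨l', hl', hd⟩ : ∃ l' ∈ T, l ∈ Metric.ball l' ρ := by simpa using hTc hl
  have h1 := hN₀ n hn l' hl'
  have h1' := lt_of_pow_lt_pow_left₀ 2 hc.le h1
  have h2 := hLω ⟨n, l, η, hl, hη, hηle.trans (min_le_left _ _)⟩
    ⟨n, l', h' n, hTs hl', hh0 n, (hhη n).trans (min_le_left _ _)⟩ rfl
  simp only [Param.z] at h2
  have h3 : ‖((l : ℂ) + (η : ℂ) * Complex.I) - ((l' : ℂ) + (h' n : ℂ) * Complex.I)‖ ≤ ρ + ρ := by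
    have : ((l : ℂ) + (η : ℂ) * Complex.I) - ((l' : ℂ) + (h' n : ℂ) * Complex.I)
        = ((l - l' : ℝ) : ℂ) + ((η - h' n : ℝ) : ℂ) * Complex.I := by push_cast; ring
    rw [this]
    refine (norm_add_le _ _).trans ?_
    rw [norm_mul, Complex.norm_I, mul_one, Complex.norm_real, Complex.norm_real]
    refine add_le_add (Metric.mem_ball.1 hd).le ?_
    rw [Real.norm_eq_abs, abs_le]
    have := hh0 n
    have := hhη n
    have := min_le_right η₀ ρ
    constructor <;> linarith
  have h4 : ‖((be l' : ℝ) : ℂ)‖ ≤ ‖S.be n ((l' : ℂ) + (h' n : ℂ) * Complex.I) (shellPart n ω)‖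
      + ‖S.be n ((l' : ℂ) + (h' n : ℂ) * Complex.I) (shellPart n ω) - be l'‖ := by
    rw [← norm_neg (S.be n _ _ - _), neg_sub]
    exact norm_le_norm_add_norm_sub' _ _
  have h5 : ‖S.be n ((l' : ℂ) + (h' n : ℂ) * Complex.I) (shellPart n ω)‖
      ≤ ‖S.be n ((l : ℂ) + (η : ℂ) * Complex.I) (shellPart n ω)‖
      + ‖S.be n ((l : ℂ) + (η : ℂ) * Complex.I) (shellPart n ω)
        - S.be n ((l' : ℂ) + (h' n : ℂ) * Complex.I) (shellPart n ω)‖ := by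
    rw [← norm_neg (S.be n _ _ - _), neg_sub]
    exact norm_le_norm_add_norm_sub' _ _
  rw [Complex.norm_real, Real.norm_eq_abs] at h4
  have h6 := hbe l' (hTs hl')
  have h7 := h2.trans ((mul_le_mul_of_nonneg_left h3 hL0).trans hLρ)
  linarith

end EventualBound

/-! ### The stretched antitree -/

section Support

lemma ae_prod_mem_support (ν : Measure ℝ) : ∀ᵐ q ∂(ν.prod ν), q ∈ ν.support ×ˢ ν.support :=
  (Measure.quasiMeasurePreserving_fst.ae Measure.support_mem_ae).and
    (Measure.quasiMeasurePreserving_snd.ae Measure.support_mem_ae)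

variable {ν : Measure ℝ} [IsProbabilityMeasure ν]

lemma ae_forall_mem_support (r : ℕ → Fin 3 → ℕ) :
    ∀ᵐ ω ∂(potentialLaw r ν), ∀ x, ω x ∈ ν.support :=
  ae_all_iff.2 fun x => (measurePreserving_eval_infinitePi (fun _ : Vertex r => ν)
    x).quasiMeasurePreserving.ae Measure.support_mem_ae

end Support

section StretchedShell

variable {s : ℕ → ℕ}

/-- The weights of the edges inside the shells of the stretched antitree. -/
def matching (s : ℕ → ℕ) (x y : Vertex (stretchedSizes s)) : ℝ :=
  if x.1 = y.1 ∧ ((x.2.1 = 0 ∧ y.2.1 = 2) ∨ (x.2.1 = 2 ∧ y.2.1 = 0)) ∧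
    (x.2.2 : ℕ) = (y.2.2 : ℕ) then 1 else 0

/-- The `i`-th vertex of the first layer of a shell. -/
def lo (s : ℕ → ℕ) (n : ℕ) (i : Fin (s n)) : Shell (stretchedSizes s) n := ⟨0, i⟩

/-- The `i`-th vertex of the last layer of a shell. -/
def hi (s : ℕ → ℕ) (n : ℕ) (i : Fin (s n)) : Shell (stretchedSizes s) n := ⟨2, i⟩

lemma shell_cases {n : ℕ} {p : Shell (stretchedSizes s) n → Prop} (h0 : ∀ i, p (lo s n i))
    (h2 : ∀ i, p (hi s n i)) (t : Shell (stretchedSizes s) n) : p t := by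
  obtain ⟨j, i⟩ := t
  fin_cases j
  · exact h0 i
  · exact (show Fin 0 from i).elim0
  · exact h2 i

lemma lo_injective (n : ℕ) : Function.Injective (lo s n) := fun _ _ h =>
  eq_of_heq (Sigma.mk.inj h).2

lemma hi_injective (n : ℕ) : Function.Injective (hi s n) := fun _ _ h =>
  eq_of_heq (Sigma.mk.inj h).2

lemma lo_ne_hi (n : ℕ) (i j : Fin (s n)) : lo s n i ≠ hi s n j := fun h => by
  have := congrArg Sigma.fst h
  simp [lo, hi] at this

lemma sum_shell {R : Type*} [AddCommMonoid R] {n : ℕ} (g : Shell (stretchedSizes s) n → R) :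
    ∑ t, g t = ∑ i, g (lo s n i) + ∑ i, g (hi s n i) := by
  rw [Fintype.sum_sigma, Fin.sum_univ_three]
  have : IsEmpty (Fin (stretchedSizes s n 1)) := inferInstanceAs (IsEmpty (Fin 0))
  rw [Finset.univ_eq_empty (α := Fin (stretchedSizes s n 1)), Finset.sum_empty, add_zero]
  rfl

lemma matching_lo_lo (n : ℕ) (i j : Fin (s n)) : matching s ⟨n, lo s n i⟩ ⟨n, lo s n j⟩ = 0 := by
  simp [matching, lo]

lemma matching_hi_hi (n : ℕ) (i j : Fin (s n)) : matching s ⟨n, hi s n i⟩ ⟨n, hi s n j⟩ = 0 := by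
  simp [matching, hi]

lemma matching_lo_hi (n : ℕ) (i j : Fin (s n)) :
    matching s ⟨n, lo s n i⟩ ⟨n, hi s n j⟩ = if i = j then 1 else 0 := by
  simp [matching, hi, lo, Fin.ext_iff]

lemma matching_hi_lo (n : ℕ) (i j : Fin (s n)) :
    matching s ⟨n, hi s n i⟩ ⟨n, lo s n j⟩ = if i = j then 1 else 0 := by
  simp [matching, hi, lo, Fin.ext_iff]

lemma isShellMatrix_matching : IsShellMatrix (stretchedSizes s) (matching s) := by
  refine ⟨fun x y => ?_, fun x y h => ?_, 1, zero_le_one, fun n t => ?_⟩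
  · unfold matching
    congr 1
    apply propext
    constructor <;> rintro ⟨h1, h2, h3⟩ <;> exact ⟨h1.symm, by tauto, h3.symm⟩
  · simp [matching, h]
  · have e0 : ∀ i, (stretchedSizes s n (lo s n i).1 : ℝ) = s n := fun i => rfl
    have e2 : ∀ i, (stretchedSizes s n (hi s n i).1 : ℝ) = s n := fun i => rfl
    induction t using shell_cases with
    | h0 i =>
      rw [sum_shell]
      simp [matching_lo_lo, matching_lo_hi, e0, e2, apply_ite abs]
    | h2 i =>
      rw [sum_shell]
      simp [matching_hi_hi, matching_hi_lo, e0, e2, apply_ite abs]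

lemma layerComp_lo (n : ℕ) (f : Shell (stretchedSizes s) n → ℂ) :
    layerComp (stretchedSizes s) n 0 f = ((√(s n : ℝ))⁻¹ : ℝ) * ∑ i, f (lo s n i) := by
  have e : (stretchedSizes s n 0 : ℝ) = s n := rfl
  rw [layerComp, sum_shell]
  simp [layerVec, lo, hi, e, Finset.mul_sum]

lemma layerComp_hi (n : ℕ) (f : Shell (stretchedSizes s) n → ℂ) :
    layerComp (stretchedSizes s) n 2 f = ((√(s n : ℝ))⁻¹ : ℝ) * ∑ i, f (hi s n i) := by
  have e : (stretchedSizes s n 2 : ℝ) = s n := rfl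
  rw [layerComp, sum_shell]
  simp [layerVec, lo, hi, e, Finset.mul_sum]

/-- The determinant of a pair of matched vertices with the potentials `q`, at the energy `z`. -/
def pairDet (z : ℂ) (q : ℝ × ℝ) : ℂ := (q.2 - z) * (q.1 - z) - 1

/-- The Green numbers of the stretched antitree: averages over the matched pairs. -/
def stretchedCoeff (s : ℕ → ℕ) : ShellCoeff (stretchedSizes s) where
  al n z w := (s n : ℂ)⁻¹ * ∑ i : Fin (s n),
    ((w (hi s n i) : ℂ) - z) / pairDet z (w (lo s n i), w (hi s n i))
  be n z w := (s n : ℂ)⁻¹ * ∑ i : Fin (s n), -1 / pairDet z (w (lo s n i), w (hi s n i))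
  de n z w := (s n : ℂ)⁻¹ * ∑ i : Fin (s n),
    ((w (lo s n i) : ℂ) - z) / pairDet z (w (hi s n i), w (lo s n i))
  measurable_al n := by unfold pairDet; fun_prop
  measurable_be n := by unfold pairDet; fun_prop
  measurable_de n := by unfold pairDet; fun_prop

/-- The equations of a shell decouple into the matched pairs. -/
lemma stretched_shell_eq_pair {n : ℕ} {w : Shell (stretchedSizes s) n → ℝ} {z p q : ℂ}
    {f : Shell (stretchedSizes s) n → ℂ}
    (h : ∀ t, ∑ t', (matching s ⟨n, t⟩ ⟨n, t'⟩ : ℂ) * f t' + w t * f t +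
      layerVec (stretchedSizes s) n 0 t * p + layerVec (stretchedSizes s) n 2 t * q = z * f t)
    (i : Fin (s n)) :
    f (hi s n i) + w (lo s n i) * f (lo s n i) + ((√(s n : ℝ))⁻¹ : ℝ) * p = z * f (lo s n i) ∧
    f (lo s n i) + w (hi s n i) * f (hi s n i) + ((√(s n : ℝ))⁻¹ : ℝ) * q = z * f (hi s n i) := by
  have a1 : layerVec (stretchedSizes s) n 0 (lo s n i) = (√(s n : ℝ))⁻¹ := rfl
  have a2 : layerVec (stretchedSizes s) n 2 (lo s n i) = 0 := by simp [layerVec, lo]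
  have a3 : layerVec (stretchedSizes s) n 0 (hi s n i) = 0 := by simp [layerVec, hi]
  have a4 : layerVec (stretchedSizes s) n 2 (hi s n i) = (√(s n : ℝ))⁻¹ := rfl
  have h1 := h (lo s n i)
  have h2 := h (hi s n i)
  rw [sum_shell, a1, a2] at h1
  rw [sum_shell, a3, a4] at h2
  simp only [matching_lo_lo, matching_lo_hi, Complex.ofReal_zero, zero_mul,
    Finset.sum_const_zero, zero_add, add_zero, apply_ite Complex.ofReal, Complex.ofReal_one,
    ite_mul, one_mul, Finset.sum_ite_eq, Finset.mem_univ, if_true] at h1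
  simp only [matching_hi_hi, matching_hi_lo, Complex.ofReal_zero, zero_mul,
    Finset.sum_const_zero, add_zero, apply_ite Complex.ofReal, Complex.ofReal_one,
    ite_mul, one_mul, Finset.sum_ite_eq, Finset.mem_univ, if_true] at h2
  exact ⟨h1, h2⟩

/-- Solving the equations of the matched pairs by Cramer's rule gives the Green numbers. -/
lemma isShellGreen_stretched {n : ℕ} {w : Shell (stretchedSizes s) n → ℝ} {z : ℂ}
    (h : ∀ i, pairDet z (w (lo s n i), w (hi s n i)) ≠ 0) :
    IsShellGreen (matching s) n w z ((stretchedCoeff s).al n z w) ((stretchedCoeff s).be n z w)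
      ((stretchedCoeff s).de n z w) := by
  intro f p q hf
  have hsq : (((√(s n : ℝ))⁻¹ : ℝ) : ℂ) * ((√(s n : ℝ))⁻¹ : ℝ) = (s n : ℂ)⁻¹ := by
    rw [← Complex.ofReal_mul, ← mul_inv, Real.mul_self_sqrt (Nat.cast_nonneg _)]
    push_cast
    rfl
  set σ : ℂ := (((√(s n : ℝ))⁻¹ : ℝ) : ℂ) with hσ
  have hlo : ∀ i, f (lo s n i) =
      σ * -((w (hi s n i) - z) / pairDet z (w (lo s n i), w (hi s n i)) * p
      + -1 / pairDet z (w (lo s n i), w (hi s n i)) * q) := by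
    intro i
    obtain ⟨h1, h2⟩ := stretched_shell_eq_pair hf i
    have hD := h i
    rw [div_mul_eq_mul_div, div_mul_eq_mul_div, ← add_div, ← neg_div, mul_div_assoc',
      eq_div_iff hD]
    unfold pairDet
    linear_combination (w (hi s n i) - z) * h1 - h2
  have hhi : ∀ i, f (hi s n i) = σ * -(-1 / pairDet z (w (lo s n i), w (hi s n i)) * p
      + (w (lo s n i) - z) / pairDet z (w (hi s n i), w (lo s n i)) * q) := by
    intro i
    obtain ⟨h1, h2⟩ := stretched_shell_eq_pair hf i
    have hD := h i
    have hsymm : pairDet z (w (hi s n i), w (lo s n i))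
        = pairDet z (w (lo s n i), w (hi s n i)) := by
      unfold pairDet; ring
    rw [hsymm, div_mul_eq_mul_div, div_mul_eq_mul_div, ← add_div, ← neg_div, mul_div_assoc',
      eq_div_iff hD]
    unfold pairDet
    linear_combination (w (lo s n i) - z) * h2 - h1
  constructor
  · rw [layerComp_lo, Finset.sum_congr rfl fun i _ => hlo i]
    simp only [stretchedCoeff, ← hsq]
    rw [← Finset.mul_sum, Finset.sum_neg_distrib, Finset.sum_add_distrib, ← Finset.sum_mul,
      ← Finset.sum_mul]
    ring
  · rw [layerComp_hi, Finset.sum_congr rfl fun i _ => hhi i]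
    simp only [stretchedCoeff, ← hsq]
    rw [← Finset.mul_sum, Finset.sum_neg_distrib, Finset.sum_add_distrib, ← Finset.sum_mul,
      ← Finset.sum_mul]
    ring

/-- An energy at which no determinant of a matched pair vanishes is not an eigenvalue of the
shell. -/
lemma stretched_shell_injective {n : ℕ} {w : Shell (stretchedSizes s) n → ℝ} {z : ℂ}
    (h : ∀ i, pairDet z (w (lo s n i), w (hi s n i)) ≠ 0) (f : Shell (stretchedSizes s) n → ℂ)
    (hf : ∀ t, ∑ t', (matching s ⟨n, t⟩ ⟨n, t'⟩ : ℂ) * f t' + w t * f t = z * f t)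
    (t : Shell (stretchedSizes s) n) : f t = 0 := by
  have hf' := stretched_shell_eq_pair (s := s) (w := w) (z := z) (p := 0) (q := 0) (f := f)
    (by simpa using hf)
  induction t using shell_cases with
  | h0 i =>
    obtain ⟨h1, h2⟩ := hf' i
    refine (mul_eq_zero.1 ?_).resolve_left (h i)
    unfold pairDet
    linear_combination (w (hi s n i) - z) * h1 - h2
  | h2 i =>
    obtain ⟨h1, h2⟩ := hf' i
    refine (mul_eq_zero.1 ?_).resolve_left (h i)
    unfold pairDet
    linear_combination (w (lo s n i) - z) * h2 - h1

end StretchedShell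

/-! ### Averages over pairs of vertices -/

section PairKernel

variable {ν : Measure ℝ} {t ρ K : ℝ} {F : ℂ → ℝ × ℝ → ℂ}

/-- A function of the energy and of the potentials at two vertices which is bounded and Lipschitz
continuous in the energy, for energies close to `t`. -/
structure IsPairKernel (ν : Measure ℝ) (t ρ K : ℝ) (F : ℂ → ℝ × ℝ → ℂ) : Prop where
  pos : 0 < ρ
  one_le : 1 ≤ K
  measurable : ∀ z, Measurable (F z)
  bound : ∀ z : ℂ, ‖z - t‖ ≤ ρ → ∀ q ∈ ν.support ×ˢ ν.support, ‖F z q‖ ≤ K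
  lipschitz : ∀ z z' : ℂ, ‖z - t‖ ≤ ρ → ‖z' - t‖ ≤ ρ → ∀ q ∈ ν.support ×ˢ ν.support,
    ‖F z q - F z' q‖ ≤ K * ‖z - z'‖

lemma Param.norm_z_sub_le (p : Param (t - ρ / 2) (t + ρ / 2) (ρ / 2)) : ‖p.z - t‖ ≤ ρ := by
  have h : p.z - t = ((p.l - t : ℝ) : ℂ) + (p.η : ℂ) * Complex.I := by
    unfold Param.z; push_cast; ring
  rw [h]
  refine (norm_add_le _ _).trans ?_
  rw [norm_mul, Complex.norm_I, mul_one, Complex.norm_real, Complex.norm_real, Real.norm_eq_abs,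
    Real.norm_eq_abs, abs_of_pos p.η_pos]
  have h1 : |p.l - t| ≤ ρ / 2 := abs_le.2 ⟨by linarith [p.l_mem.1], by linarith [p.l_mem.2]⟩
  linarith [p.η_le]

lemma Param.norm_z_sub_l {a b η₀ : ℝ} (p : Param a b η₀) : ‖p.z - p.l‖ = p.η := by
  rw [Param.z, add_sub_cancel_left, norm_mul, Complex.norm_I, mul_one, Complex.norm_real,
    Real.norm_of_nonneg p.η_pos.le]

lemma Param.norm_l_sub_le (p : Param (t - ρ / 2) (t + ρ / 2) (ρ / 2)) :
    ‖(p.l : ℂ) - t‖ ≤ ρ := by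
  rw [← Complex.ofReal_sub, Complex.norm_real, Real.norm_eq_abs, abs_le]
  have := p.η_pos
  have := p.η_le
  constructor <;> linarith [p.l_mem.1, p.l_mem.2]

lemma IsPairKernel.norm_average_sub_le (h : IsPairKernel ν t ρ K F) {m : ℕ} (hm : 0 < m) {z z' : ℂ}
    (hz : ‖z - t‖ ≤ ρ) (hz' : ‖z' - t‖ ≤ ρ) {q : Fin m → ℝ × ℝ}
    (hq : ∀ i, q i ∈ ν.support ×ˢ ν.support) :
    ‖(m : ℂ)⁻¹ * ∑ i, F z (q i) - (m : ℂ)⁻¹ * ∑ i, F z' (q i)‖ ≤ K * ‖z - z'‖ := by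
  rw [← mul_sub, ← Finset.sum_sub_distrib, norm_mul, norm_inv, Complex.norm_natCast,
    inv_mul_le_iff₀ (by exact_mod_cast hm)]
  refine (norm_sum_le_of_le _ fun i _ => h.lipschitz z z' hz hz' _ (hq i)).trans ?_
  simp

variable [IsProbabilityMeasure ν]

lemma IsPairKernel.integrable (h : IsPairKernel ν t ρ K F) {z : ℂ} (hz : ‖z - t‖ ≤ ρ) :
    Integrable (F z) (ν.prod ν) :=
  integrable_of_ae_bound (h.measurable z)
    ((ae_prod_mem_support ν).mono fun q hq => h.bound z hz q hq)

lemma IsPairKernel.norm_integral_sub_le (h : IsPairKernel ν t ρ K F) {z z' : ℂ}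
    (hz : ‖z - t‖ ≤ ρ) (hz' : ‖z' - t‖ ≤ ρ) :
    ‖∫ q, F z q ∂(ν.prod ν) - ∫ q, F z' q ∂(ν.prod ν)‖ ≤ K * ‖z - z'‖ := by
  rw [← integral_sub (h.integrable hz) (h.integrable hz')]
  refine (norm_integral_le_of_norm_le_const
    ((ae_prod_mem_support ν).mono fun q hq => h.lipschitz z z' hz hz' q hq)).trans ?_
  simp

lemma IsPairKernel.continuousAt (h : IsPairKernel ν t ρ K F) {φ : ℝ → ℝ}
    (hφ : ∀ l : ℝ, (φ l : ℂ) = ∫ q, F l q ∂(ν.prod ν)) : ContinuousAt φ t := by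
  refine continuousAt_of_locally_lipschitz h.pos K fun l hl => ?_
  have h1 : ‖(l : ℂ) - t‖ = dist l t := by
    rw [← Complex.ofReal_sub, Complex.norm_real, Real.dist_eq, Real.norm_eq_abs]
  have h2 := h.norm_integral_sub_le (z := l) (z' := t) (by rw [h1]; exact hl.le)
    (by simpa using h.pos.le)
  rwa [← hφ, ← hφ, ← Complex.ofReal_sub, Complex.norm_real, h1, Real.norm_eq_abs,
    ← Real.dist_eq] at h2

/-- Averages of a kernel over disjoint pairs of vertices concentrate at its mean. -/
lemma IsPairKernel.conc {r : ℕ → Fin 3 → ℕ} (h : IsPairKernel ν t ρ K F) {s : ℕ → ℕ}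
    (hs : ∀ n, 0 < s n) {f g : ∀ n, Fin (s n) → Vertex r} (hf : ∀ n, Function.Injective (f n))
    (hg : ∀ n, Function.Injective (g n)) (hfg : ∀ n i j, f n i ≠ g n j) :
    Conc (potentialLaw r ν)
      (fun p : Param (t - ρ / 2) (t + ρ / 2) (ρ / 2) => ((s p.n : ℝ))⁻¹ + p.η)
      (fun p ω => (s p.n : ℂ)⁻¹ * ∑ i, F p.z (ω (f p.n i), ω (g p.n i)))
      (fun p => ∫ q, F p.l q ∂(ν.prod ν)) := by
  have hK := h.one_le
  have hmeas : ∀ x y : Vertex r, Measurable fun ω : Vertex r → ℝ => (ω x, ω y) := fun x y =>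
    (measurable_pi_apply x).prodMk (measurable_pi_apply y)
  have hb : ∀ (p : Param (t - ρ / 2) (t + ρ / 2) (ρ / 2)) (i : Fin (s p.n)),
      ∀ᵐ ω ∂(potentialLaw r ν), ‖F p.z (ω (f p.n i), ω (g p.n i))‖ ≤ K := by
    intro p i
    filter_upwards [ae_forall_mem_support (ν := ν) r] with ω hω
    exact h.bound _ p.norm_z_sub_le _ ⟨hω _, hω _⟩
  have key := Conc.average (P := potentialLaw r ν)
    (ε := fun p : Param (t - ρ / 2) (t + ρ / 2) (ρ / 2) => ((s p.n : ℝ))⁻¹ + p.η)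
    (fun p => add_nonneg (by positivity) p.η_pos.le)
    (J := fun p => Fin (s p.n)) (T := fun p => Finset.univ)
    (X := fun p i ω => F p.z (ω (f p.n i), ω (g p.n i)))
    (x := fun p => ∫ q, F p.l q ∂(ν.prod ν)) (K := K)
    (fun p => ⟨⟨0, hs p.n⟩, Finset.mem_univ _⟩) (by linarith)
    (fun p i => (h.measurable p.z).comp (hmeas _ _)) (fun p i _ => hb p i)
    (fun p => by
      refine (norm_integral_le_of_norm_le_const ((ae_prod_mem_support ν).mono fun q hq =>
        h.bound p.l p.norm_l_sub_le q hq)).trans ?_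
      simp)
    (fun p i _ j _ hij => by
      have hind : iIndepFun (fun (x : Vertex r) (ω : Vertex r → ℝ) => ω x) (potentialLaw r ν) :=
        iIndepFun_infinitePi (X := fun _ t => t) (fun _ => measurable_id)
      exact (hind.indepFun_prodMk_prodMk (fun x => measurable_pi_apply x) (f p.n i) (g p.n i)
        (f p.n j) (g p.n j) (fun e => hij (hf _ e)) (hfg _ _ _) (fun e => hfg _ _ _ e.symm)
        (fun e => hij (hg _ e))).comp (h.measurable p.z) (h.measurable p.z))
    (fun p => by
      have : (0 : ℝ) ≤ ((s p.n : ℝ))⁻¹ := by positivity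
      rw [Finset.card_univ, Fintype.card_fin]
      nlinarith [p.η_pos])
    (fun p i _ => by
      have hmap : ∫ ω, F p.z (ω (f p.n i), ω (g p.n i)) ∂(potentialLaw r ν)
          = ∫ q, F p.z q ∂(ν.prod ν) := by
        rw [← Measure.infinitePi_map_eval_prod (P := fun _ : Vertex r => ν) (hfg p.n i i),
          integral_map (hmeas _ _).aemeasurable (h.measurable p.z).aestronglyMeasurable]
      rw [hmap]
      refine (h.norm_integral_sub_le p.norm_z_sub_le p.norm_l_sub_le).trans ?_
      rw [p.norm_z_sub_l]
      have : (0 : ℝ) ≤ ((s p.n : ℝ))⁻¹ := by positivity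
      nlinarith)
  simpa using key

end PairKernel

section StretchedKernel

variable {ν : Measure ℝ}

lemma norm_div_sub_div_le {u u' D D' : ℂ} {U d x y : ℝ} (hd : 0 < d) (hu : ‖u'‖ ≤ U)
    (hD : d ≤ ‖D‖) (hD' : d ≤ ‖D'‖) (hx : ‖u - u'‖ ≤ x) (hy : ‖D - D'‖ ≤ y) :
    ‖u / D - u' / D'‖ ≤ x / d + U * y / (d * d) := by
  have h0 : D ≠ 0 := norm_pos_iff.1 (hd.trans_le hD)
  have h0' : D' ≠ 0 := norm_pos_iff.1 (hd.trans_le hD')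
  have e : u / D - u' / D' = (u - u') / D + u' * (D' - D) / (D * D') := by
    field_simp
    ring
  rw [e]
  refine (norm_add_le _ _).trans ?_
  rw [norm_div, norm_div, norm_mul, norm_mul, norm_sub_rev D']
  have hx0 := (norm_nonneg _).trans hx
  have hy0 := (norm_nonneg _).trans hy
  have hU0 := (norm_nonneg _).trans hu
  gcongr

/-- The product of two distances to the support is larger than one in `I₊`, and smaller than one
in `I₋`. -/
lemma pairDet_ne_zero {t : ℝ} (ht : t ∈ IPlus ν ∪ IMinus ν) {q : ℝ × ℝ}
    (hq : q ∈ ν.support ×ˢ ν.support) : pairDet t q ≠ 0 := by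
  have e : pairDet t q = (((q.2 - t) * (q.1 - t) - 1 : ℝ) : ℂ) := by
    unfold pairDet; push_cast; ring
  rw [e, Complex.ofReal_ne_zero, sub_ne_zero]
  intro h
  have h' : |t - q.2| * |t - q.1| = 1 := by
    rw [abs_sub_comm t, abs_sub_comm t, ← abs_mul, h, abs_one]
  rcases ht with ht | ht
  · have h1 := ht _ hq.1
    have h2 := ht _ hq.2
    nlinarith
  · have h1 := ht _ hq.1
    have h2 := ht _ hq.2
    nlinarith [abs_nonneg (t - q.2), abs_nonneg (t - q.1)]

/-- Close to energies in `I₊ ∪ I₋` the determinants of the matched pairs are bounded away from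
zero, uniformly in the values of the potential. -/
lemma exists_le_norm_pairDet (hν : IsCompact ν.support) {t : ℝ} (ht : t ∈ IPlus ν ∪ IMinus ν) :
    ∃ ρ > 0, ∃ d > 0, ∃ M : ℝ, 1 ≤ M ∧ ∀ z : ℂ, ‖z - t‖ ≤ ρ → ∀ q ∈ ν.support ×ˢ ν.support,
      d ≤ ‖pairDet z q‖ ∧ ‖(q.1 : ℂ) - z‖ ≤ M ∧ ‖(q.2 : ℂ) - z‖ ≤ M := by
  have hc := hν.prod hν
  have hcont : Continuous fun p : ℂ × (ℝ × ℝ) => pairDet p.1 p.2 := by unfold pairDet; fun_prop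
  obtain ⟨d, hd, hd'⟩ : ∃ d > 0, ∀ q ∈ ν.support ×ˢ ν.support, d < ‖pairDet t q‖ := by
    obtain ⟨d, hd, h⟩ := hc.exists_forall_le' (f := fun q => ‖pairDet t q‖) (a := 0)
      (by fun_prop) fun q hq => norm_pos_iff.2 (pairDet_ne_zero ht hq)
    exact ⟨d / 2, by positivity, fun q hq => by linarith [h q hq]⟩
  have hev : ∀ᶠ z : ℂ in 𝓝 (t : ℂ), ∀ q ∈ ν.support ×ˢ ν.support, d < ‖pairDet z q‖ := by
    refine hc.eventually_forall_of_forall_eventually fun q hq => ?_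
    exact (hcont.norm.continuousAt (x := ((t : ℂ), q))).eventually_const_lt (hd' q hq)
  obtain ⟨ρ, hρ, hball⟩ := Metric.eventually_nhds_iff_ball.1 hev
  obtain ⟨R, hR⟩ := hν.isBounded.exists_norm_le
  have hρ' : 0 < min (ρ / 2) 1 := lt_min (by positivity) one_pos
  refine ⟨min (ρ / 2) 1, hρ', d, hd, |R| + |t| + 1,
    by linarith [abs_nonneg R, abs_nonneg t], fun z hz q hq => ?_⟩
  have hz1 : ‖z - t‖ ≤ 1 := hz.trans (min_le_right _ _)
  have hz2 : ‖z‖ ≤ |t| + 1 := by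
    have := norm_le_norm_add_norm_sub' z t
    rw [Complex.norm_real, Real.norm_eq_abs] at this
    linarith
  have hM : ∀ x ∈ ν.support, ‖(x : ℂ) - z‖ ≤ |R| + |t| + 1 := by
    intro x hx
    refine (norm_sub_le _ _).trans ?_
    rw [Complex.norm_real]
    linarith [hR x hx, le_abs_self R]
  refine ⟨(hball z ?_ q hq).le, hM _ hq.1, hM _ hq.2⟩
  rw [mem_ball_iff_norm]
  linarith [hz.trans (min_le_left _ _)]

/-- The kernels in the Green numbers of the stretched antitree. -/
lemma exists_isPairKernel (hν : IsCompact ν.support) {t : ℝ} (ht : t ∈ IPlus ν ∪ IMinus ν) :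
    ∃ ρ K : ℝ, IsPairKernel ν t ρ K (fun z q => (q.2 - z) / pairDet z q) ∧
      IsPairKernel ν t ρ K (fun z q => -1 / pairDet z q) ∧
      ∀ z : ℂ, ‖z - t‖ ≤ ρ → ∀ q ∈ ν.support ×ˢ ν.support, pairDet z q ≠ 0 := by
  obtain ⟨ρ, hρ, d, hd, M, hM, h⟩ := exists_le_norm_pairDet hν ht
  have hdet : ∀ z z' : ℂ, ‖z - t‖ ≤ ρ → ‖z' - t‖ ≤ ρ → ∀ q ∈ ν.support ×ˢ ν.support,
      ‖pairDet z q - pairDet z' q‖ ≤ 2 * M * ‖z - z'‖ := by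
    intro z z' hz hz' q hq
    obtain ⟨-, h1, -⟩ := h z hz q hq
    obtain ⟨-, -, h2⟩ := h z' hz' q hq
    have e : pairDet z q - pairDet z' q = (z' - z) * (q.1 - z) + (q.2 - z') * (z' - z) := by
      unfold pairDet; ring
    rw [e, norm_sub_rev z]
    refine (norm_add_le _ _).trans ?_
    rw [norm_mul, norm_mul]
    nlinarith [norm_nonneg (z' - z)]
  set K : ℝ := 1 + M / d + (1 / d + M * (2 * M) / (d * d)) with hK
  have hM0 : 0 < M := by linarith
  have hK1 : 1 ≤ K := by
    have : 0 ≤ M / d + (1 / d + M * (2 * M) / (d * d)) := by positivity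
    linarith
  have hm : Measurable fun p : ℂ × (ℝ × ℝ) => pairDet p.1 p.2 := by unfold pairDet; fun_prop
  have hmz : ∀ z : ℂ, Measurable (pairDet z) :=
    fun z => hm.comp (measurable_const.prodMk measurable_id)
  refine ⟨ρ, K, ⟨hρ, hK1, fun z => ?_, fun z hz q hq => ?_, fun z z' hz hz' q hq => ?_⟩,
    ⟨hρ, hK1, fun z => ?_, fun z hz q hq => ?_, fun z z' hz hz' q hq => ?_⟩, fun z hz q hq => ?_⟩
  · exact ((Complex.measurable_ofReal.comp measurable_snd).sub_const z).div (hmz z)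
  · obtain ⟨h1, -, h3⟩ := h z hz q hq
    rw [norm_div]
    have : 0 ≤ 1 / d + M * (2 * M) / (d * d) := by positivity
    calc _ ≤ M / d := by gcongr
      _ ≤ K := by linarith
  · obtain ⟨h1, -, h3⟩ := h z hz q hq
    obtain ⟨h1', -, h3'⟩ := h z' hz' q hq
    refine (norm_div_sub_div_le (x := ‖z - z'‖) hd h3' h1 h1' ?_ (hdet z z' hz hz' q hq)).trans ?_
    · rw [sub_sub_sub_cancel_left, norm_sub_rev]
    · have : 0 ≤ (1 + M / d) * ‖z - z'‖ := by positivity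
      have e : K * ‖z - z'‖ = (1 + M / d) * ‖z - z'‖
          + (‖z - z'‖ / d + M * (2 * M * ‖z - z'‖) / (d * d)) := by
        rw [hK]; ring
      linarith
  · exact measurable_const.div (hmz z)
  · obtain ⟨h1, -, -⟩ := h z hz q hq
    rw [norm_div, norm_neg, norm_one]
    have : 0 ≤ M / d + M * (2 * M) / (d * d) := by positivity
    calc _ ≤ 1 / d := by gcongr
      _ ≤ K := by linarith
  · obtain ⟨h1, -, h3⟩ := h z hz q hq
    obtain ⟨h1', -, h3'⟩ := h z' hz' q hq
    refine (norm_div_sub_div_le (x := ‖z - z'‖) (U := M) hd (by simpa using hM) h1 h1' ?_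
      (hdet z z' hz hz' q hq)).trans ?_
    · rw [sub_self, norm_zero]; positivity
    · have : 0 ≤ (1 + M / d) * ‖z - z'‖ := by positivity
      have e : K * ‖z - z'‖ = (1 + M / d) * ‖z - z'‖
          + (‖z - z'‖ / d + M * (2 * M * ‖z - z'‖) / (d * d)) := by
        rw [hK]; ring
      linarith
  · exact norm_pos_iff.1 (hd.trans_le (h z hz q hq).1)

end StretchedKernel

section StretchedTransport

variable {ν : Measure ℝ} [IsProbabilityMeasure ν] {s : ℕ → ℕ}

/-- Energies of `I_𝕊` lie in transport intervals. The determinants of the matched pairs can have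
both signs, so that `β` may be small in some shells: that it is not in the late shells is where the
Borel–Cantelli lemma enters. -/
lemma exists_isTransportInterval_stretched (hν : IsCompact ν.support) (hs : ∀ n, 0 < s n)
    (hsum : Summable fun n => ((s n : ℝ))⁻¹) {t : ℝ} (ht : t ∈ IS ν) :
    ∃ a b, t ∈ Ioo a b ∧ IsTransportInterval (matching s) ν a b := by
  obtain ⟨htI, hbe, htr⟩ := ht
  obtain ⟨ρ, K, hα, hβ, hD⟩ := exists_isPairKernel hν htI
  have hρ := hα.pos
  have hK := hα.one_le
  have eα : ∀ l : ℝ, (alphaS ν l : ℂ) = ∫ q : ℝ × ℝ, ((q.2 - l) / pairDet l q : ℂ) ∂(ν.prod ν) := by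
    intro l
    rw [alphaS, ← integral_complex_ofReal]
    unfold pairDet
    push_cast
    rfl
  have eβ : ∀ l : ℝ, ((-betaS ν l : ℝ) : ℂ) = ∫ q : ℝ × ℝ, -1 / pairDet l q ∂(ν.prod ν) := by
    intro l
    rw [betaS, ← integral_neg, ← integral_complex_ofReal]
    unfold pairDet
    push_cast
    refine integral_congr_ae (ae_of_all _ fun q => ?_)
    dsimp only
    ring
  have hlo : ∀ n, Function.Injective fun i => (⟨n, lo s n i⟩ : Vertex (stretchedSizes s)) :=
    fun n i j h => lo_injective n (eq_of_heq (Sigma.mk.inj h).2)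
  have hhi : ∀ n, Function.Injective fun i => (⟨n, hi s n i⟩ : Vertex (stretchedSizes s)) :=
    fun n i j h => hi_injective n (eq_of_heq (Sigma.mk.inj h).2)
  have hlohi : ∀ n i j, (⟨n, lo s n i⟩ : Vertex (stretchedSizes s)) ≠ ⟨n, hi s n j⟩ :=
    fun n i j h => lo_ne_hi n i j (eq_of_heq (Sigma.mk.inj h).2)
  -- the Green number between the layers is `-β`, which does not affect the modulus of the trace
  have hconc : CoeffConc (stretchedCoeff s) ν (t - ρ / 2) (t + ρ / 2) (ρ / 2)
      (fun n => ((s n : ℝ))⁻¹) (alphaS ν) (fun l => -betaS ν l) (alphaS ν) := by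
    refine ⟨?_, ?_, ?_⟩
    · have := hα.conc hs hlo hhi hlohi
      simp only [← eα] at this
      exact this
    · have := hβ.conc hs hlo hhi hlohi
      simp only [← eβ] at this
      exact this
    · have := hα.conc hs hhi hlo fun n i j => (hlohi n j i).symm
      simp only [← eα] at this
      exact this
  refine exists_isTransportInterval (al := alphaS ν) (be := fun l => -betaS ν l) (de := alphaS ν)
    (hα.continuousAt eα) (hβ.continuousAt eβ) (hα.continuousAt eα) (neg_ne_zero.2 hbe) ?_
    (fun n => by positivity) hsum (a := t - ρ / 2) (b := t + ρ / 2) ⟨by linarith, by linarith⟩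
    hconc ?_
  · rw [div_neg, ← neg_add, abs_neg, ← pow_two]
    exact htr
  · intro a b ha hb c hc hbc
    have hmono := hconc.mono ha hb le_rfl
    let f : Param a b (ρ / 2) → Param (t - ρ / 2) (t + ρ / 2) (ρ / 2) := fun p =>
      ⟨p.n, p.l, p.η, ⟨ha.trans p.l_mem.1, p.l_mem.2.trans hb⟩, p.η_pos, p.η_le⟩
    have hLip : ∀ᵐ ω ∂(potentialLaw (stretchedSizes s) ν), ∀ p q : Param a b (ρ / 2), p.n = q.n →
        ‖(stretchedCoeff s).be p.n p.z (shellPart p.n ω)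
          - (stretchedCoeff s).be p.n q.z (shellPart p.n ω)‖ ≤ K * ‖p.z - q.z‖ := by
      filter_upwards [ae_forall_mem_support (ν := ν) (stretchedSizes s)] with ω hω p q _
      exact hβ.norm_average_sub_le (hs _) (f p).norm_z_sub_le (f q).norm_z_sub_le
        fun i => ⟨hω _, hω _⟩
    obtain ⟨η₁, hη₁, hη, hev⟩ := hmono.ae_eventually_le_norm (by positivity)
      (fun n => inv_pos.2 (by exact_mod_cast hs n)) hsum (by linarith) hLip hc hbc
    refine ⟨c / 2, η₁, by positivity, by linarith, hη₁, hη, ?_⟩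
    filter_upwards [hev, ae_forall_mem_support (ν := ν) (stretchedSizes s)] with ω hω hsupp
    obtain ⟨N₀, hN₀⟩ := hω
    refine ⟨N₀, fun n hn l hl η hη0 hηle => ⟨isShellGreen_stretched fun i => ?_,
      hN₀ n hn l hl η hη0 hηle⟩⟩
    let p : Param (t - ρ / 2) (t + ρ / 2) (ρ / 2) :=
      ⟨n, l, η, ⟨ha.trans hl.1, hl.2.trans hb⟩, hη0, hηle.trans hη⟩
    exact hD p.z p.norm_z_sub_le _ ⟨hsupp _, hsupp _⟩

/-- Eigenfunctions with finite support occur only in `I₊` and in the convex hull of the support: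
elsewhere the determinants of the matched pairs all have the same sign. -/
lemma notMem_finSuppEigenvalues_stretched {ν : Measure ℝ} (hs : ∀ n, 0 < s n) {t : ℝ}
    (ht : t ∈ IS ν)
    (ht' : ¬ (t ∈ IPlus ν ∧ t ∈ convexHull ℝ ν.support)) {ω : Vertex (stretchedSizes s) → ℝ}
    (hω : ∀ x, ω x ∈ ν.support) {H : L2 (Vertex (stretchedSizes s)) →L[ℂ] _}
    (hH : IsSchrodinger (fun x y => coupling (stretchedSizes s) x y + matching s x y) ω H) :
    t ∉ finSuppEigenvalues H := by
  have hD : ∀ n i, pairDet t (ω ⟨n, lo s n i⟩, ω ⟨n, hi s n i⟩) ≠ 0 := fun n i =>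
    pairDet_ne_zero ht.1 ⟨hω _, hω _⟩
  refine notMem_finSuppEigenvalues (α := fun n => (stretchedCoeff s).al n t (shellPart n ω))
    (β := fun n => (stretchedCoeff s).be n t (shellPart n ω))
    (δ := fun n => (stretchedCoeff s).de n t (shellPart n ω)) isShellMatrix_matching hH
    (fun n => isShellGreen_stretched (hD n)) (fun n => ?_)
    (fun n f hf => stretched_shell_injective (w := shellPart n ω) (hD n) f hf)
  have e : (stretchedCoeff s).be n t (shellPart n ω) = (((s n : ℝ)⁻¹ * ∑ i : Fin (s n),
      -1 / ((ω ⟨n, hi s n i⟩ - t) * (ω ⟨n, lo s n i⟩ - t) - 1) : ℝ) : ℂ) := by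
    simp only [stretchedCoeff, pairDet, shellPart]
    push_cast
    rfl
  have hne : (Finset.univ : Finset (Fin (s n))).Nonempty := ⟨⟨0, hs n⟩, Finset.mem_univ _⟩
  have hinv : (s n : ℝ)⁻¹ ≠ 0 := inv_ne_zero (by exact_mod_cast (hs n).ne')
  rw [e, Complex.ofReal_ne_zero]
  refine mul_ne_zero hinv ?_
  rcases ht.1 with hp | hm
  · have hside : (∀ x ∈ ν.support, 1 < x - t) ∨ ∀ x ∈ ν.support, 1 < t - x := by
      by_contra! hcon
      obtain ⟨⟨x, hx, hxt⟩, y, hy, hyt⟩ := hcon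
      have h1 := hp x hx
      have h2 := hp y hy
      rcases lt_abs.1 h1 with h1 | h1
      · rcases lt_abs.1 h2 with h2 | h2
        · linarith
        · refine ht' ⟨hp, (convex_convexHull ℝ _).ordConnected.out (subset_convexHull ℝ _ hx)
            (subset_convexHull ℝ _ hy) ⟨?_, ?_⟩⟩ <;> linarith
      · linarith
    refine (Finset.sum_neg (fun i _ => ?_) hne).ne
    apply div_neg_of_neg_of_pos (by norm_num)
    rcases hside with h | h
    · nlinarith [h _ (hω ⟨n, hi s n i⟩), h _ (hω ⟨n, lo s n i⟩)]
    · nlinarith [h _ (hω ⟨n, hi s n i⟩), h _ (hω ⟨n, lo s n i⟩)]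
  · refine (Finset.sum_pos (fun i _ => ?_) hne).ne'
    apply div_pos_of_neg_of_neg (by norm_num)
    have h1 := hm _ (hω ⟨n, hi s n i⟩)
    have h2 := hm _ (hω ⟨n, lo s n i⟩)
    have h3 : |(ω ⟨n, hi s n i⟩ - t) * (ω ⟨n, lo s n i⟩ - t)| < 1 := by
      rw [abs_mul, abs_sub_comm, abs_sub_comm (ω ⟨n, lo s n i⟩)]
      nlinarith [abs_nonneg (t - ω ⟨n, hi s n i⟩), abs_nonneg (t - ω ⟨n, lo s n i⟩)]
    linarith [le_abs_self ((ω ⟨n, hi s n i⟩ - t) * (ω ⟨n, lo s n i⟩ - t))]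

/-- The Anderson model on the stretched antitree, when the numbers of pairs have summable
reciprocals. -/
theorem stretched_antitree (hν : IsCompact ν.support) (hs : ∀ n, 0 < s n)
    (hsum : Summable fun n => ((s n : ℝ))⁻¹) :
    ∀ᵐ ω ∂(potentialLaw (stretchedSizes s) ν), ∃ H, IsSchrodinger (stretchedAdj s) ω H ∧
      IsSelfAdjoint H ∧ (∀ t ∈ IS ν, (t : ℂ) ∈ spectrum ℂ H) ∧
      PurelyACOn H (IS ν \ (IPlus ν ∩ convexHull ℝ ν.support ∩ finSuppEigenvalues H)) := by
  obtain ⟨R, hR⟩ := hν.isBounded.exists_norm_le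
  filter_upwards [ae_forall_mem_support (ν := ν) (stretchedSizes s),
    ae_spectrum_of_isTransportInterval (ν := ν) isShellMatrix_matching hs
      fun t ht => exists_isTransportInterval_stretched hν hs hsum ht] with ω hω hsp
  obtain ⟨H, hH⟩ := isShellMatrix_matching.exists_isSchrodinger (v := ω)
    (fun n j i => Fin.pos i) (fun x => (hR _ (hω x)).trans (le_abs_self R)) (abs_nonneg R)
  obtain ⟨h1, h2⟩ := hsp H hH
  refine ⟨H, hH, isShellMatrix_matching.isSelfAdjoint hH, h1, ?_⟩
  convert h2 using 1
  ext t
  refine and_congr_right fun ht => not_congr ⟨fun h => h.2, fun h => ⟨?_, h⟩⟩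
  by_contra hcon
  exact notMem_finSuppEigenvalues_stretched hs ht hcon hω hH h

end StretchedTransport

/-! ### Harmonic means -/

section Harmonic

lemma exists_convexHull_eq_Icc {s : Set ℝ} (hs : IsCompact s) (hne : s.Nonempty) :
    ∃ p q, p ≤ q ∧ convexHull ℝ s = Icc p q := by
  have hp := hs.sInf_mem hne
  have hq := hs.sSup_mem hne
  have hle : ∀ x ∈ s, sInf s ≤ x ∧ x ≤ sSup s := fun x hx =>
    ⟨csInf_le hs.bddBelow hx, le_csSup hs.bddAbove hx⟩
  exact ⟨sInf s, sSup s, (hle _ hp).2, Subset.antisymm (convexHull_min hle (convex_Icc _ _))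
    ((convex_convexHull ℝ s).ordConnected.out (subset_convexHull ℝ s hp)
      (subset_convexHull ℝ s hq))⟩

variable {ν : Measure ℝ} {t : ℝ}

/-- Bounds for `(x - z)⁻¹` near an energy outside the support. -/
lemma exists_inv_bounds (hν : IsCompact ν.support) (ht : t ∉ ν.support) :
    ∃ ρ > 0, ∃ K : ℝ, 1 ≤ K ∧ ∀ z : ℂ, ‖z - t‖ ≤ ρ → ∀ x ∈ ν.support, (x : ℂ) - z ≠ 0 ∧
      ‖((x : ℂ) - z)⁻¹‖ ≤ K ∧ ∀ z' : ℂ, ‖z' - t‖ ≤ ρ →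
        ‖((x : ℂ) - z)⁻¹ - ((x : ℂ) - z')⁻¹‖ ≤ K * ‖z - z'‖ := by
  obtain ⟨ε, hε, hball⟩ := Metric.isOpen_iff.1 hν.isClosed.isOpen_compl t ht
  set d := ε / 2 with hd
  have hd0 : 0 < d := by positivity
  have hlow : ∀ z : ℂ, ‖z - t‖ ≤ d → ∀ x ∈ ν.support, d ≤ ‖(x : ℂ) - z‖ := by
    intro z hz x hx
    have h1 : ε ≤ |x - t| := by
      by_contra hcon
      exact hball (Metric.mem_ball.2 (by rw [Real.dist_eq]; linarith)) hx
    have h2 : ‖(x : ℂ) - t‖ ≤ ‖(x : ℂ) - z‖ + ‖z - t‖ := norm_sub_le_norm_sub_add_norm_sub _ _ _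
    rw [← Complex.ofReal_sub, Complex.norm_real, Real.norm_eq_abs] at h2
    linarith
  refine ⟨d, hd0, 1 + 1 / d + 1 / (d * d), by
    have : 0 ≤ 1 / d + 1 / (d * d) := by positivity
    linarith, fun z hz x hx => ⟨norm_pos_iff.1 (hd0.trans_le (hlow z hz x hx)), ?_,
    fun z' hz' => ?_⟩⟩
  · rw [norm_inv, inv_eq_one_div]
    have : 0 ≤ 1 / (d * d) := by positivity
    calc _ ≤ 1 / d := by gcongr; exact hlow z hz x hx
      _ ≤ _ := by linarith
  · have h := norm_div_sub_div_le (u := 1) (u' := 1) (U := 1) (x := 0) hd0 (by simp)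
      (hlow z hz x hx) (hlow z' hz' x hx) (by simp) (y := ‖z - z'‖)
      (by rw [sub_sub_sub_cancel_left, norm_sub_rev])
    rw [one_div, one_div, zero_div, zero_add, one_mul] at h
    refine h.trans ?_
    have : 0 ≤ (1 + 1 / d) * ‖z - z'‖ := by positivity
    have e : (1 + 1 / d + 1 / (d * d)) * ‖z - z'‖
        = (1 + 1 / d) * ‖z - z'‖ + ‖z - z'‖ / (d * d) := by
      ring
    linarith

variable [IsProbabilityMeasure ν]

lemma nonempty_support : ν.support.Nonempty := by
  have h : ∀ᵐ x ∂ν, x ∈ ν.support := Measure.support_mem_ae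
  exact h.exists

/-- Outside the convex hull of the support, the values `(x - t)⁻¹` lie in a compact interval
without zero whose inverse, translated by `t`, is that convex hull. -/
lemma exists_inv_interval (hν : IsCompact ν.support) (ht : t ∉ convexHull ℝ ν.support) :
    ∃ Y : Set ℝ, Convex ℝ Y ∧ IsClosed Y ∧ (∀ x ∈ ν.support, (x - t)⁻¹ ∈ Y) ∧
      ∃ g > 0, ∀ y ∈ Y, g ≤ |y| ∧ y⁻¹ + t ∈ convexHull ℝ ν.support := by
  obtain ⟨p, q, hle, hpq⟩ := exists_convexHull_eq_Icc hν nonempty_support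
  have hsub : ∀ x ∈ ν.support, x ∈ Icc p q := fun x hx => hpq ▸ subset_convexHull ℝ _ hx
  rw [hpq] at ht ⊢
  refine ⟨Icc (q - t)⁻¹ (p - t)⁻¹, convex_Icc _ _, isClosed_Icc, ?_⟩
  rcases lt_or_ge t p with h | h
  · have hp : 0 < p - t := by linarith
    have hq : 0 < q - t := by linarith
    refine ⟨fun x hx => ?_, (q - t)⁻¹, inv_pos.2 hq, fun y hy => ⟨hy.1.trans (le_abs_self y), ?_⟩⟩
    · obtain ⟨h1, h2⟩ := hsub x hx
      have h0 : 0 < x - t := by linarith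
      exact ⟨inv_anti₀ h0 (by linarith), inv_anti₀ hp (by linarith)⟩
    · have hy0 : 0 < y := (inv_pos.2 hq).trans_le hy.1
      have h1 := inv_anti₀ (inv_pos.2 hq) hy.1
      have h2 := inv_anti₀ hy0 hy.2
      rw [inv_inv] at h1 h2
      constructor <;> linarith
  · have hqt : q < t := by
      by_contra hcon
      exact ht ⟨h, not_lt.1 hcon⟩
    have hp : p - t < 0 := by linarith
    have hq : q - t < 0 := by linarith
    refine ⟨fun x hx => ?_, -(p - t)⁻¹, neg_pos.2 (inv_lt_zero.2 hp),
      fun y hy => ⟨?_, ?_⟩⟩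
    · obtain ⟨h1, h2⟩ := hsub x hx
      have h0 : x - t < 0 := by linarith
      exact ⟨(inv_le_inv_of_neg hq h0).2 (by linarith), (inv_le_inv_of_neg h0 hp).2 (by linarith)⟩
    · exact (neg_le_neg hy.2).trans (neg_le_abs y)
    · have hp' := inv_lt_zero.2 hp
      have hy0 : y < 0 := lt_of_le_of_lt hy.2 hp'
      have h1 := (inv_le_inv_of_neg hy0 (inv_lt_zero.2 hq)).2 hy.1
      have h2 := (inv_le_inv_of_neg hp' hy0).2 hy.2
      rw [inv_inv] at h1 h2
      constructor <;> linarith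

lemma integral_inv_mem {Y : Set ℝ} (hc : Convex ℝ Y) (hcl : IsClosed Y)
    (hY : ∀ x ∈ ν.support, (x - t)⁻¹ ∈ Y) (hi : Integrable (fun x => (x - t)⁻¹) ν) :
    ∫ x, (x - t)⁻¹ ∂ν ∈ Y := by
  refine hc.integral_mem hcl ?_ hi
  have h : ∀ᵐ x ∂ν, x ∈ ν.support := Measure.support_mem_ae
  exact h.mono fun x hx => hY x hx

end Harmonic

section ConcInv

variable {ι Ω : Type*} [MeasurableSpace Ω] {P : Measure Ω} {ε : ι → ℝ} {X Y : ι → Ω → ℂ}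
  {x : ι → ℂ}

lemma Conc.congr_ae (hX : Conc P ε X x) (hY : ∀ i, Measurable (Y i))
    (h : ∀ i, X i =ᵐ[P] Y i) : Conc P ε Y x := by
  obtain ⟨C, hC, H⟩ := hX.exists_bound
  refine ⟨hX.nonneg, hY, C, hC, fun i => ⟨(H i).1, ?_, ?_, ?_⟩⟩
  · filter_upwards [h i, (H i).2.1] with ω h1 h2
    rwa [← h1]
  · have e : ∫ ω, (X i ω - x i) ∂P = ∫ ω, (Y i ω - x i) ∂P :=
      integral_congr_ae ((h i).mono fun ω hω => congrArg (· - x i) hω)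
    rw [← e]
    exact (H i).2.2.1
  · have e : ∫ ω, ‖X i ω - x i‖ ^ 2 ∂P = ∫ ω, ‖Y i ω - x i‖ ^ 2 ∂P :=
      integral_congr_ae ((h i).mono fun ω hω => congrArg (fun y => ‖y - x i‖ ^ 2) hω)
    rw [← e]
    exact (H i).2.2.2

/-- No truncation is needed for random variables that stay away from zero. -/
lemma Conc.inv [IsProbabilityMeasure P] (hX : Conc P ε X x) {c : ℝ} (hc : 0 < c)
    (hx : ∀ i, c ≤ ‖x i‖) (hXc : ∀ i, ∀ᵐ ω ∂P, c ≤ ‖X i ω‖) :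
    Conc P ε (fun i ω => (X i ω)⁻¹) (fun i => (x i)⁻¹) := by
  refine (hX.truncInv (half_pos hc) fun i => by linarith [hx i]).congr_ae
    (fun i => (hX.measurable i).inv) fun i => ?_
  filter_upwards [hXc i] with ω hω
  have h0 : X i ω ≠ 0 := norm_pos_iff.1 (hc.trans_le hω)
  exact eq_inv_of_mul_eq_one_left (truncInv_mul (half_pos hc) (by linarith))

end ConcInv

/-! ### Shells with homogeneous connecting modes -/

section GreenForm

variable {M : Type*} [Fintype M] [DecidableEq M]

/-- The matrix with the complex diagonal `W` added to the real matrix `B`. -/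
def addDiag (B : Matrix M M ℝ) (W : M → ℂ) : Matrix M M ℂ :=
  Matrix.diagonal W + B.map Complex.ofReal

/-- The bilinear form of the adjugate of the matrix `W + B`. -/
def adjForm (B : Matrix M M ℝ) (x y : M → ℝ) (W : M → ℂ) : ℂ :=
  ∑ i, ∑ j, (x i : ℂ) * (addDiag B W).adjugate i j * y j

/-- The matrix element `xᵀ (W + B)⁻¹ y`, written with Cramer's rule. -/
def greenForm (B : Matrix M M ℝ) (x y : M → ℝ) (W : M → ℂ) : ℂ :=
  ((addDiag B W).det)⁻¹ * adjForm B x y W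

lemma greenForm_comm {B : Matrix M M ℝ} (hB : B.transpose = B) (x y : M → ℝ) (W : M → ℂ) :
    greenForm B x y W = greenForm B y x W := by
  have hA : (addDiag B W).transpose = addDiag B W := by
    rw [addDiag, Matrix.transpose_add, Matrix.diagonal_transpose, ← Matrix.transpose_map, hB]
  unfold greenForm adjForm
  rw [Finset.sum_comm]
  congr 1
  refine Finset.sum_congr rfl fun i _ => Finset.sum_congr rfl fun j _ => ?_
  rw [← Matrix.transpose_apply (addDiag B W).adjugate, Matrix.adjugate_transpose, hA]
  ring

/-- Solutions of the equation with the matrix `W + B`, paired with a vector, by Cramer's rule. -/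
lemma sum_mul_eq_greenForm {B : Matrix M M ℝ} {W : M → ℂ} (h : (addDiag B W).det ≠ 0)
    {g : M → ℂ} {y₁ y₂ : M → ℝ} {p q : ℂ}
    (hg : ∀ i, W i * g i + ∑ j, (B i j : ℂ) * g j = -(y₁ i * p + y₂ i * q)) (x : M → ℝ) :
    ∑ i, (x i : ℂ) * g i = -(greenForm B x y₁ W * p + greenForm B x y₂ W * q) := by
  have h1 : (addDiag B W).mulVec g = fun i => -((y₁ i : ℂ) * p + y₂ i * q) := by
    funext i
    rw [← hg i, addDiag, Matrix.add_mulVec, Pi.add_apply, Matrix.mulVec_diagonal]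
    rfl
  have h2 : (addDiag B W).adjugate.mulVec ((addDiag B W).mulVec g) = (addDiag B W).det • g := by
    rw [Matrix.mulVec_mulVec, Matrix.adjugate_mul, Matrix.smul_mulVec, Matrix.one_mulVec]
  rw [h1] at h2
  have h3 : ∀ i, (addDiag B W).det * g i
      = -∑ j, ((addDiag B W).adjugate i j * y₁ j * p + (addDiag B W).adjugate i j * y₂ j * q) := by
    intro i
    have := congrFun h2 i
    simp only [Matrix.mulVec, dotProduct, Pi.smul_apply, smul_eq_mul] at this
    rw [← this, ← Finset.sum_neg_distrib]
    exact Finset.sum_congr rfl fun j _ => by ring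
  have h4 : (addDiag B W).det * ∑ i, (x i : ℂ) * g i
      = -(adjForm B x y₁ W * p + adjForm B x y₂ W * q) := by
    unfold adjForm
    rw [Finset.mul_sum, Finset.sum_mul, Finset.sum_mul, ← Finset.sum_add_distrib,
      ← Finset.sum_neg_distrib]
    refine Finset.sum_congr rfl fun i _ => ?_
    rw [mul_left_comm, h3 i, Finset.sum_mul, Finset.sum_mul, ← Finset.sum_add_distrib, mul_neg,
      Finset.mul_sum]
    exact congrArg _ (Finset.sum_congr rfl fun j _ => by ring)
  unfold greenForm
  rw [← mul_right_inj' h, h4]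
  field_simp

end GreenForm

section ModeShell

variable {r : ℕ → Fin 3 → ℕ} {k : Fin 3 → ℕ} {part : ∀ n j, Fin (r n j) → Fin (k j)}
  {O : Matrix (Mode k) (Mode k) ℝ} {a : Mode k → ℝ}

/-- The weights of the edges inside the shells of the partial antitree. -/
def modeInner (r : ℕ → Fin 3 → ℕ) (k : Fin 3 → ℕ) (part : ∀ n j, Fin (r n j) → Fin (k j))
    (O : Matrix (Mode k) (Mode k) ℝ) (a : Mode k → ℝ) (x y : Vertex r) : ℝ :=
  if x.1 = y.1 then ∑ m, modeEntry r k part O x m * a m * modeEntry r k part O y m else 0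

/-- The size of the entries of the normalized indicators of the parts of a layer. -/
def modeWeight (r : ℕ → Fin 3 → ℕ) (k : Fin 3 → ℕ) (n : ℕ) (j : Fin 3) : ℝ :=
  √((k j : ℝ) / (r n j : ℝ))

/-- The part in which a vertex of a shell lies. -/
def modeOf (part : ∀ n j, Fin (r n j) → Fin (k j)) (n : ℕ) (x : Shell r n) : Mode k :=
  ⟨x.1, part n x.1 x.2⟩

/-- The vertices of a part. -/
def modePart (part : ∀ n j, Fin (r n j) → Fin (k j)) (n : ℕ) (m : Mode k) :
    Finset (Fin (r n m.1)) :=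
  Finset.univ.filter fun i => part n m.1 i = m.2

/-- The average of `(w - z)⁻¹` over a part. -/
def partAvg (part : ∀ n j, Fin (r n j) → Fin (k j)) (n : ℕ) (m : Mode k) (z : ℂ)
    (w : Shell r n → ℝ) : ℂ :=
  ((modePart part n m).card : ℂ)⁻¹ * ∑ i ∈ modePart part n m, ((w ⟨m.1, i⟩ : ℂ) - z)⁻¹

lemma modeMatrix_transpose : (modeMatrix k O a).transpose = modeMatrix k O a := by
  simp [modeMatrix, Matrix.transpose_mul, Matrix.mul_assoc]

lemma modeInner_eq (n : ℕ) (x y : Shell r n) : modeInner r k part O a ⟨n, x⟩ ⟨n, y⟩ =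
    modeWeight r k n x.1 * modeWeight r k n y.1 *
      modeMatrix k O a (modeOf part n x) (modeOf part n y) := by
  simp only [modeInner, if_true, modeEntry, modeMatrix]
  rw [Matrix.mul_apply, Finset.mul_sum]
  simp only [Matrix.mul_diagonal, Matrix.transpose_apply, modeWeight, modeOf]
  refine Finset.sum_congr rfl fun m _ => ?_
  ring

lemma sum_shell_eq_sum_mode {R : Type*} [AddCommMonoid R] (part : ∀ n j, Fin (r n j) → Fin (k j))
    (n : ℕ) (F : Shell r n → R) :
    ∑ x, F x = ∑ m : Mode k, ∑ i ∈ modePart part n m, F ⟨m.1, i⟩ := by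
  rw [Fintype.sum_sigma, Fintype.sum_sigma]
  refine Finset.sum_congr rfl fun j _ => ?_
  exact (Finset.sum_fiberwise Finset.univ (part n j) fun i => F ⟨j, i⟩).symm

lemma modeOf_eq {n : ℕ} {m : Mode k} {i : Fin (r n m.1)} (hi : i ∈ modePart part n m) :
    modeOf part n ⟨m.1, i⟩ = m := by
  have : part n m.1 i = m.2 := (Finset.mem_filter.1 hi).2
  simp only [modeOf, this]

lemma layerVec_eq {n : ℕ} {j : Fin 3} (hj : 0 < k j) (x : Shell r n) :
    layerVec r n j x
      = modeWeight r k n x.1 * if (modeOf part n x).1 = j then 1 / √(k j) else 0 := by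
  have h : 0 < √(k j : ℝ) := Real.sqrt_pos.2 (by exact_mod_cast hj)
  by_cases hx : x.1 = j
  · rw [layerVec, if_pos hx, if_pos (show (modeOf part n x).1 = j from hx), hx, modeWeight,
      Real.sqrt_div (Nat.cast_nonneg _)]
    field_simp
  · rw [layerVec, if_neg hx, if_neg (show ¬ (modeOf part n x).1 = j from hx), mul_zero]

lemma card_modePart_pos
    (hpart : ∀ n j l, k j * (Finset.univ.filter (fun i => part n j i = l)).card = r n j)
    (hr : ∀ n j, 0 < k j → 0 < r n j) (n : ℕ) (m : Mode k) : 0 < (modePart part n m).card := by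
  have h := hr n m.1 (Fin.pos m.2)
  rw [← hpart n m.1 m.2] at h
  exact Nat.pos_of_mul_pos_left h

lemma modeWeight_sq
    (hpart : ∀ n j l, k j * (Finset.univ.filter (fun i => part n j i = l)).card = r n j)
    (n : ℕ) (m : Mode k) :
    modeWeight r k n m.1 ^ 2 = ((modePart part n m).card : ℝ)⁻¹ := by
  have hk : (k m.1 : ℝ) ≠ 0 := by exact_mod_cast (Fin.pos m.2).ne'
  have h : (r n m.1 : ℝ) = k m.1 * (modePart part n m).card := by
    exact_mod_cast (hpart n m.1 m.2).symm
  rw [modeWeight, Real.sq_sqrt (by positivity), h]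
  exact div_mul_cancel_left₀ hk _

/-- On the span of the connecting modes, the equations of a shell reduce to those of a finite matrix
whose diagonal consists of the harmonic means over the parts. -/
lemma mode_shell_equations
    (hpart : ∀ n j l, k j * (Finset.univ.filter (fun i => part n j i = l)).card = r n j)
    (hk0 : 0 < k 0) (hk2 : 0 < k 2) {n : ℕ} {w : Shell r n → ℝ} {z p q : ℂ}
    (hw : ∀ x, (w x : ℂ) - z ≠ 0) (hG : ∀ m, partAvg part n m z w ≠ 0) {f : Shell r n → ℂ}
    (hf : ∀ x, ∑ y, (modeInner r k part O a ⟨n, x⟩ ⟨n, y⟩ : ℂ) * f y + w x * f x +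
      layerVec r n 0 x * p + layerVec r n 2 x * q = z * f x) {g : Mode k → ℂ}
    (hg : ∀ m, g m = ∑ i ∈ modePart part n m, (modeWeight r k n m.1 : ℂ) * f ⟨m.1, i⟩) :
    (∀ m, (partAvg part n m z w)⁻¹ * g m + ∑ m', (modeMatrix k O a m m' : ℂ) * g m'
      = -(upsilon k m * p + phi k m * q)) ∧
    ∀ x, f x = -(modeWeight r k n x.1 * (∑ m', (modeMatrix k O a (modeOf part n x) m' : ℂ) * g m'
      + upsilon k (modeOf part n x) * p + phi k (modeOf part n x) * q)) * ((w x : ℂ) - z)⁻¹ := by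
  set h : Mode k → ℂ := fun m => ∑ m', (modeMatrix k O a m m' : ℂ) * g m'
      + upsilon k m * p + phi k m * q with hh
  have hC : ∀ x, ∑ y, (modeInner r k part O a ⟨n, x⟩ ⟨n, y⟩ : ℂ) * f y
      = modeWeight r k n x.1 * ∑ m', (modeMatrix k O a (modeOf part n x) m' : ℂ) * g m' := by
    intro x
    rw [sum_shell_eq_sum_mode part, Finset.mul_sum]
    refine Finset.sum_congr rfl fun m _ => ?_
    rw [hg, Finset.mul_sum, Finset.mul_sum]
    refine Finset.sum_congr rfl fun i hi => ?_
    rw [modeInner_eq, modeOf_eq hi]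
    push_cast
    ring
  have hfx : ∀ x, f x = -(modeWeight r k n x.1 * h (modeOf part n x)) * ((w x : ℂ) - z)⁻¹ := by
    intro x
    have h1 := hf x
    rw [hC, layerVec_eq (part := part) hk0, layerVec_eq (part := part) hk2, Complex.ofReal_mul,
      Complex.ofReal_mul] at h1
    rw [← div_eq_mul_inv, eq_div_iff (hw x)]
    simp only [hh, upsilon, phi]
    linear_combination h1
  refine ⟨fun m => ?_, hfx⟩
  have hgm : g m = -(partAvg part n m z w) * h m := by
    have hsq : (modeWeight r k n m.1 : ℂ) * modeWeight r k n m.1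
        = ((modePart part n m).card : ℂ)⁻¹ := by
      rw [← Complex.ofReal_mul, ← pow_two, modeWeight_sq hpart n m]
      push_cast
      rfl
    rw [hg, partAvg, ← hsq, Finset.mul_sum, ← Finset.sum_neg_distrib, Finset.sum_mul]
    refine Finset.sum_congr rfl fun i hi => ?_
    rw [hfx, modeOf_eq hi]
    ring
  rw [hgm, neg_mul, mul_neg, inv_mul_cancel_left₀ (hG m)]
  simp only [hh]
  ring

lemma layerComp_eq_sum_mode {n : ℕ} {j : Fin 3} (hj : 0 < k j) (f : Shell r n → ℂ)
    {g : Mode k → ℂ}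
    (hg : ∀ m, g m = ∑ i ∈ modePart part n m, (modeWeight r k n m.1 : ℂ) * f ⟨m.1, i⟩) :
    layerComp r n j f = ∑ m, ((if m.1 = j then 1 / √(k j) else 0 : ℝ) : ℂ) * g m := by
  rw [layerComp, sum_shell_eq_sum_mode part]
  refine Finset.sum_congr rfl fun m _ => ?_
  rw [hg, Finset.mul_sum]
  refine Finset.sum_congr rfl fun i hi => ?_
  rw [layerVec_eq (part := part) hj, modeOf_eq hi]
  push_cast
  ring

/-- The Green numbers of the partial antitree. -/
def modeCoeff (r : ℕ → Fin 3 → ℕ) (k : Fin 3 → ℕ) (part : ∀ n j, Fin (r n j) → Fin (k j))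
    (B : Matrix (Mode k) (Mode k) ℝ) (x y : Mode k → ℝ) (n : ℕ) (z : ℂ) (w : Shell r n → ℝ) : ℂ :=
  greenForm B x y fun m => (partAvg part n m z w)⁻¹

/-- The Green numbers are those of the finite matrix of the connecting modes. -/
lemma isShellGreen_mode
    (hpart : ∀ n j l, k j * (Finset.univ.filter (fun i => part n j i = l)).card = r n j)
    (hk0 : 0 < k 0) (hk2 : 0 < k 2) {n : ℕ} {w : Shell r n → ℝ} {z : ℂ}
    (hw : ∀ x, (w x : ℂ) - z ≠ 0) (hG : ∀ m, partAvg part n m z w ≠ 0)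
    (hdet : (addDiag (modeMatrix k O a) fun m => (partAvg part n m z w)⁻¹).det ≠ 0) :
    IsShellGreen (modeInner r k part O a) n w z
      (modeCoeff r k part (modeMatrix k O a) (upsilon k) (upsilon k) n z w)
      (modeCoeff r k part (modeMatrix k O a) (upsilon k) (phi k) n z w)
      (modeCoeff r k part (modeMatrix k O a) (phi k) (phi k) n z w) := by
  intro f p q hf
  obtain ⟨h, -⟩ := mode_shell_equations hpart hk0 hk2 hw hG hf (g := fun m =>
    ∑ i ∈ modePart part n m, (modeWeight r k n m.1 : ℂ) * f ⟨m.1, i⟩) fun m => rfl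
  constructor
  · rw [layerComp_eq_sum_mode (part := part) hk0 f fun m => rfl]
    exact sum_mul_eq_greenForm hdet h (upsilon k)
  · rw [layerComp_eq_sum_mode (part := part) hk2 f fun m => rfl, modeCoeff, greenForm_comm
      modeMatrix_transpose (upsilon k)]
    exact sum_mul_eq_greenForm hdet h (phi k)

/-- Where the finite matrix of the connecting modes is invertible, the energy is not an
eigenvalue of the shell: the modes of a solution vanish, hence so does the solution. -/
lemma mode_shell_injective
    (hpart : ∀ n j l, k j * (Finset.univ.filter (fun i => part n j i = l)).card = r n j)
    (hk0 : 0 < k 0) (hk2 : 0 < k 2) {n : ℕ} {w : Shell r n → ℝ} {z : ℂ}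
    (hw : ∀ x, (w x : ℂ) - z ≠ 0) (hG : ∀ m, partAvg part n m z w ≠ 0)
    (hdet : (addDiag (modeMatrix k O a) fun m => (partAvg part n m z w)⁻¹).det ≠ 0)
    (f : Shell r n → ℂ)
    (hf : ∀ x, ∑ y, (modeInner r k part O a ⟨n, x⟩ ⟨n, y⟩ : ℂ) * f y + w x * f x = z * f x)
    (x : Shell r n) : f x = 0 := by
  obtain ⟨h1, h2⟩ := mode_shell_equations hpart hk0 hk2 hw hG (f := f) (p := 0) (q := 0)
    (by simpa using hf) (g := fun m =>
    ∑ i ∈ modePart part n m, (modeWeight r k n m.1 : ℂ) * f ⟨m.1, i⟩) fun m => rfl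
  have hg := fun m => sum_mul_eq_greenForm hdet h1 (Pi.single m 1)
  simp only [mul_zero, add_zero, neg_zero, Pi.single_apply, apply_ite Complex.ofReal,
    Complex.ofReal_one, Complex.ofReal_zero, ite_mul, one_mul, zero_mul, Finset.sum_ite_eq',
    Finset.mem_univ, if_true] at hg
  rw [h2 x]
  simp [hg]

/-- The Schur test applies with the inverse square roots of the layer sizes as weights. -/
lemma isShellMatrix_mode :
    IsShellMatrix r (modeInner r k part O a) := by
  refine ⟨fun x y => ?_, fun x y h => by simp [modeInner, h], ?_⟩
  · unfold modeInner
    by_cases h : x.1 = y.1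
    · rw [if_pos h, if_pos h.symm]
      exact Finset.sum_congr rfl fun m _ => by ring
    · rw [if_neg h, if_neg (Ne.symm h)]
  · set b : ℝ := ∑ m, ∑ m', |modeMatrix k O a m m'| with hb
    set κ : ℝ := ∑ j, √(k j : ℝ) with hκ
    have hb0 : 0 ≤ b := Finset.sum_nonneg fun _ _ => Finset.sum_nonneg fun _ _ => abs_nonneg _
    have hκ0 : 0 ≤ κ := Finset.sum_nonneg fun _ _ => Real.sqrt_nonneg _
    have hkκ : ∀ j, √(k j : ℝ) ≤ κ := fun j =>
      Finset.single_le_sum (f := fun j => √(k j : ℝ)) (fun _ _ => Real.sqrt_nonneg _)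
        (Finset.mem_univ j)
    have hBb : ∀ m m', |modeMatrix k O a m m'| ≤ b := fun m m' =>
      (Finset.single_le_sum (f := fun m' => |modeMatrix k O a m m'|) (fun _ _ => abs_nonneg _)
        (Finset.mem_univ m')).trans
        (Finset.single_le_sum (f := fun m => ∑ m', |modeMatrix k O a m m'|)
          (fun _ _ => Finset.sum_nonneg fun _ _ => abs_nonneg _) (Finset.mem_univ m))
    refine ⟨κ * κ * b * 3, by positivity, fun n s => ?_⟩
    have hwt : ∀ j, modeWeight r k n j ≤ κ * (√(r n j))⁻¹ := fun j => by
      rw [modeWeight, Real.sqrt_div (Nat.cast_nonneg _), div_eq_mul_inv]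
      exact mul_le_mul_of_nonneg_right (hkκ j) (by positivity)
    have hwt0 : ∀ j, 0 ≤ modeWeight r k n j := fun j => Real.sqrt_nonneg _
    have hterm : ∀ y : Shell r n, |modeInner r k part O a ⟨n, s⟩ ⟨n, y⟩| * (√(r n y.1))⁻¹
        ≤ κ * κ * b * (√(r n s.1))⁻¹ * (r n y.1 : ℝ)⁻¹ := by
      intro y
      have e : ((r n y.1 : ℕ) : ℝ)⁻¹ = (√(r n y.1))⁻¹ * (√(r n y.1))⁻¹ := by
        rw [← mul_inv, Real.mul_self_sqrt (Nat.cast_nonneg _)]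
      rw [modeInner_eq, abs_mul, abs_mul, abs_of_nonneg (hwt0 _), abs_of_nonneg (hwt0 _), e]
      calc _ ≤ (κ * (√(r n s.1))⁻¹) * (κ * (√(r n y.1))⁻¹) * b * (√(r n y.1))⁻¹ := by
            have h1 := hwt0 y.1
            gcongr
            · exact hwt _
            · exact hwt _
            · exact hBb _ _
        _ = _ := by ring
    have hsum : ∑ y : Shell r n, ((r n y.1 : ℕ) : ℝ)⁻¹ ≤ 3 := by
      rw [Fintype.sum_sigma]
      calc _ ≤ ∑ _j : Fin 3, (1 : ℝ) := by
            refine Finset.sum_le_sum fun j _ => ?_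
            simp only [Finset.sum_const, Finset.card_univ, Fintype.card_fin, nsmul_eq_mul]
            exact mul_inv_le_one
        _ = 3 := by simp
    refine (Finset.sum_le_sum fun y _ => hterm y).trans ?_
    rw [← Finset.mul_sum]
    calc _ ≤ κ * κ * b * (√(r n s.1))⁻¹ * 3 := by gcongr
      _ = _ := by ring

end ModeShell

/-! ### Bounds for the Green numbers of partial antitrees -/

section GreenFormContinuity

lemma continuous_addDiag {M : Type*} [DecidableEq M] (B : Matrix M M ℝ) :
    Continuous (addDiag B) := by
  unfold addDiag
  fun_prop

variable {M : Type*} [Fintype M] [DecidableEq M] (B : Matrix M M ℝ) (x y : M → ℝ)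

lemma continuous_adjForm : Continuous (adjForm B x y) := by
  unfold adjForm
  have h := (continuous_addDiag B).matrix_adjugate
  exact continuous_finsetSum _ fun i _ => continuous_finsetSum _ fun j _ =>
    (continuous_const.mul (h.matrix_elem i j)).mul continuous_const

lemma continuousAt_greenForm {W : M → ℂ} (h : (addDiag B W).det ≠ 0) :
    ContinuousAt (greenForm B x y) W :=
  ((continuous_addDiag B).matrix_det.continuousAt.inv₀ h).mul
    (continuous_adjForm B x y).continuousAt

lemma measurable_greenForm : Measurable (greenForm B x y) :=
  (continuous_addDiag B).matrix_det.measurable.inv.mul (continuous_adjForm B x y).measurable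

variable {B x y}

lemma addDiag_ofReal (D : M → ℝ) : addDiag B (fun m => (D m : ℂ))
    = Complex.ofRealHom.mapMatrix (Matrix.diagonal D + B) := by
  ext i j
  by_cases h : i = j <;> simp [addDiag, h]

lemma det_addDiag_ofReal (D : M → ℝ) :
    (addDiag B (fun m => (D m : ℂ))).det = (((Matrix.diagonal D + B).det : ℝ) : ℂ) := by
  rw [addDiag_ofReal, ← RingHom.map_det]
  rfl

lemma greenForm_ofReal (D : M → ℝ) : greenForm B x y (fun m => (D m : ℂ))
    = ((x ⬝ᵥ ((Matrix.diagonal D + B)⁻¹.mulVec y) : ℝ) : ℂ) := by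
  rw [greenForm, det_addDiag_ofReal, adjForm, addDiag_ofReal, ← RingHom.map_adjugate,
    Matrix.inv_def, Ring.inverse_eq_inv', Matrix.smul_mulVec, dotProduct_smul, smul_eq_mul,
    Complex.ofReal_mul, Complex.ofReal_inv]
  congr 1
  simp only [dotProduct, Matrix.mulVec, Finset.mul_sum, Complex.ofReal_sum]
  refine Finset.sum_congr rfl fun i _ => Finset.sum_congr rfl fun j _ => ?_
  rw [RingHom.mapMatrix_apply, Matrix.map_apply, Complex.ofRealHom_eq_coe]
  push_cast
  ring

variable {ι Ω : Type*} [MeasurableSpace Ω] {P : Measure Ω} [IsProbabilityMeasure P] {ε : ι → ℝ}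
  {W : ι → Ω → M → ℂ} {w : ι → M → ℂ}

lemma Conc.greenForm (hε : ∀ i, 0 ≤ ε i) (h : ∀ m, Conc P ε (fun i ω => W i ω m) fun i => w i m)
    (B : Matrix M M ℝ) (x y : M → ℝ) {c : ℝ} (hc : 0 < c)
    (hw : ∀ i, c ≤ ‖(addDiag B (w i)).det‖) (hW : ∀ i, ∀ᵐ ω ∂P, c ≤ ‖(addDiag B (W i ω)).det‖) :
    Conc P ε (fun i ω => greenForm B x y (W i ω)) (fun i => greenForm B x y (w i)) := by
  have hA : ∀ j k, Conc P ε (fun i ω => addDiag B (W i ω) j k) fun i => addDiag B (w i) j k := by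
    intro j k
    have hB : Conc P ε (fun _ _ => (B j k : ℂ)) fun _ => (B j k : ℂ) :=
      Conc.const hε (c := fun _ => (B j k : ℂ)) (K := ‖(B j k : ℂ)‖) fun _ => le_rfl
    by_cases hjk : j = k
    · subst hjk
      simpa [addDiag] using (h j).add hB
    · simpa [addDiag, hjk] using hB
  refine ((Conc.det hε hA).inv hc hw hW).mul ?_
  unfold adjForm
  refine Conc.sum _ hε fun j _ => Conc.sum _ hε fun k _ => ?_
  have h1 := (Conc.adjugate hε hA j k).const_mul (c := fun _ => (x j : ℂ) * y k)
    (K := ‖(x j : ℂ) * y k‖) fun _ => le_rfl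
  convert h1 using 2
  · funext ω
    ring
  · ring

end GreenFormContinuity

section ModeBounds

variable {ν : Measure ℝ} {k : Fin 3 → ℕ} {O : Matrix (Mode k) (Mode k) ℝ} {a : Mode k → ℝ}
  {t ρ K c : ℝ} {Y : Set ℝ}

/-- Near an energy `t` in `I_0`, the determinant and the Green number between the first and the last
layer are bounded away from zero, also for complex perturbations of the diagonal. -/
lemma exists_le_norm_det [IsProbabilityMeasure ν] (hν : IsCompact ν.support)
    (ht : t ∈ I0 ν k O a) : ∃ ε > 0, ∃ c > 0, ∀ (W : Mode k → ℂ) (D : Mode k → ℝ),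
      (∀ m, D m ∈ convexHull ℝ ν.support) → (∀ m, ‖W m - ((D m - t : ℝ) : ℂ)‖ ≤ ε) →
      c ≤ ‖(addDiag (modeMatrix k O a) W).det‖ ∧
      c ≤ ‖greenForm (modeMatrix k O a) (upsilon k) (phi k) W‖ := by
  obtain ⟨p, q, -, hpq⟩ := exists_convexHull_eq_Icc hν nonempty_support
  set B := modeMatrix k O a with hB
  set S : Set (Mode k → ℝ) := univ.pi fun _ => Icc p q with hS
  have hSc : IsCompact S := isCompact_univ_pi fun _ => isCompact_Icc
  have hSm : ∀ D ∈ S, ∀ m, D m ∈ convexHull ℝ ν.support := fun D hD m => by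
    rw [hpq]; exact hD m (mem_univ m)
  let J : (Mode k → ℝ) → (Mode k → ℂ) := fun D m => ((D m - t : ℝ) : ℂ)
  have hJ : Continuous J := by fun_prop
  have hdet : ∀ D ∈ S, (addDiag B (J D)).det ≠ 0 := by
    intro D hD
    have h := (ht.2 D (hSm D hD)).1
    rw [Matrix.isUnit_iff_isUnit_det, isUnit_iff_ne_zero] at h
    simp only [J]
    rw [det_addDiag_ofReal, Complex.ofReal_ne_zero]
    exact h
  have hgr : ∀ D ∈ S, greenForm B (upsilon k) (phi k) (J D) ≠ 0 := by
    intro D hD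
    have h := (ht.2 D (hSm D hD)).2
    simp only [J]
    rw [greenForm_ofReal, Complex.ofReal_ne_zero]
    exact h
  obtain ⟨c₁, hc₁, h₁⟩ := hSc.exists_forall_le' (f := fun D => ‖(addDiag B (J D)).det‖) (a := 0)
    (((continuous_addDiag B).comp hJ).matrix_det.norm.continuousOn)
    fun D hD => norm_pos_iff.2 (hdet D hD)
  obtain ⟨c₂, hc₂, h₂⟩ := hSc.exists_forall_le'
    (f := fun D => ‖greenForm B (upsilon k) (phi k) (J D)‖) (a := 0)
    (fun D hD => (ContinuousAt.comp (g := greenForm B (upsilon k) (phi k)) (f := J)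
      (continuousAt_greenForm B _ _ (hdet D hD)) hJ.continuousAt).norm.continuousWithinAt)
    fun D hD => norm_pos_iff.2 (hgr D hD)
  have hc : 0 < min c₁ c₂ / 2 := half_pos (lt_min hc₁ hc₂)
  have hlt₁ : min c₁ c₂ / 2 < c₁ := by linarith [min_le_left c₁ c₂]
  have hlt₂ : min c₁ c₂ / 2 < c₂ := by linarith [min_le_right c₁ c₂]
  have hev : ∀ᶠ E : Mode k → ℂ in 𝓝 0, ∀ D ∈ S,
      min c₁ c₂ / 2 < ‖(addDiag B (J D + E)).det‖ ∧
      min c₁ c₂ / 2 < ‖greenForm B (upsilon k) (phi k) (J D + E)‖ := by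
    refine hSc.eventually_forall_of_forall_eventually fun D hD => ?_
    have hcont : Continuous fun p : (Mode k → ℂ) × (Mode k → ℝ) => J p.2 + p.1 :=
      (hJ.comp continuous_snd).add continuous_fst
    refine Eventually.and ?_ ?_
    · have h : ContinuousAt (fun p : (Mode k → ℂ) × (Mode k → ℝ) =>
          ‖(addDiag B (J p.2 + p.1)).det‖) (0, D) :=
        (((continuous_addDiag B).comp hcont).matrix_det.norm).continuousAt
      exact h.eventually_const_lt (by simpa only [add_zero] using hlt₁.trans_le (h₁ D hD))
    · have h : ContinuousAt (fun p : (Mode k → ℂ) × (Mode k → ℝ) =>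
          ‖greenForm B (upsilon k) (phi k) (J p.2 + p.1)‖) (0, D) :=
        ContinuousAt.norm (ContinuousAt.comp (g := greenForm B (upsilon k) (phi k))
          (f := fun p : (Mode k → ℂ) × (Mode k → ℝ) => J p.2 + p.1)
          (by simp only [add_zero]; exact continuousAt_greenForm B _ _ (hdet D hD))
          hcont.continuousAt)
      exact h.eventually_const_lt (by simpa only [add_zero] using hlt₂.trans_le (h₂ D hD))
  obtain ⟨δ, hδ, hball⟩ := Metric.eventually_nhds_iff_ball.1 hev
  refine ⟨δ / 2, half_pos hδ, _, hc, fun W D hD hWD => ?_⟩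
  have hDS : D ∈ S := fun m _ => hpq ▸ hD m
  have hE : W - J D ∈ Metric.ball (0 : Mode k → ℂ) δ := by
    rw [mem_ball_zero_iff, pi_norm_lt_iff hδ]
    intro m
    exact (hWD m).trans_lt (half_lt_self hδ)
  have h := hball _ hE D hDS
  rw [add_sub_cancel] at h
  exact ⟨h.1.le, h.2.le⟩

/-- The bounds used near an energy `t`: for `(x - z)⁻¹`, and lower bounds for its averages and for
the determinant and the Green number made from them. -/
structure IsModeNbhd (ν : Measure ℝ) (B : Matrix (Mode k) (Mode k) ℝ) (t ρ K c : ℝ)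
    (Y : Set ℝ) : Prop where
  pos : 0 < ρ
  one_le : 1 ≤ K
  c_pos : 0 < c
  convex : Convex ℝ Y
  closed : IsClosed Y
  inv_mem : ∀ x ∈ ν.support, (x - t)⁻¹ ∈ Y
  inv_bound : ∀ z : ℂ, ‖z - t‖ ≤ ρ → ∀ x ∈ ν.support, (x : ℂ) - z ≠ 0 ∧
      ‖((x : ℂ) - z)⁻¹‖ ≤ K ∧ ∀ z' : ℂ, ‖z' - t‖ ≤ ρ →
        ‖((x : ℂ) - z)⁻¹ - ((x : ℂ) - z')⁻¹‖ ≤ K * ‖z - z'‖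
  lower : ∀ z : ℂ, ‖z - t‖ ≤ ρ → ∀ (G : Mode k → ℂ) (G₀ : Mode k → ℝ), (∀ m, G₀ m ∈ Y) →
    (∀ m, ‖G m - G₀ m‖ ≤ K * ‖z - t‖) → (∀ m, c ≤ ‖G m‖) ∧
      c ≤ ‖(addDiag B fun m => (G m)⁻¹).det‖ ∧
      c ≤ ‖greenForm B (upsilon k) (phi k) fun m => (G m)⁻¹‖

/-- Averages of `(x - t)⁻¹` over the support lie in a compact interval `Y` without zero, and their
inverses are of the form `D - t` with `D` in the convex hull of the support. Hence the condition
defining `I_0` covers all harmonic means, whatever the values of the potential. -/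
lemma exists_isModeNbhd [IsProbabilityMeasure ν] (hν : IsCompact ν.support)
    (ht : t ∈ I0 ν k O a) : ∃ ρ K c Y, IsModeNbhd ν (modeMatrix k O a) t ρ K c Y := by
  obtain ⟨ε, hε, c, hc, H⟩ := exists_le_norm_det hν ht
  obtain ⟨ρ, hρ, K, hK, hinv⟩ := exists_inv_bounds hν
    fun h => ht.1 (subset_convexHull ℝ _ h)
  obtain ⟨Y, hYc, hYcl, hY, g, hg, hYg⟩ := exists_inv_interval hν ht.1
  have hK0 : 0 < K := by linarith
  set ρ' := min ρ (min (g / (2 * K)) (ε * g ^ 2 / (2 * K))) with hρ'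
  have hρ'0 : 0 < ρ' := lt_min hρ (lt_min (by positivity) (by positivity))
  have hle1 : ρ' ≤ ρ := min_le_left _ _
  have hle2 : K * ρ' ≤ g / 2 := by
    have : ρ' ≤ g / (2 * K) := (min_le_right _ _).trans (min_le_left _ _)
    rw [le_div_iff₀ (by positivity)] at this
    linarith
  have hle3 : K * ρ' ≤ ε * g ^ 2 / 2 := by
    have : ρ' ≤ ε * g ^ 2 / (2 * K) := (min_le_right _ _).trans (min_le_right _ _)
    rw [le_div_iff₀ (by positivity)] at this
    linarith
  refine ⟨ρ', K, min c (g / 2), Y, ⟨hρ'0, hK, lt_min hc (half_pos hg), hYc, hYcl, hY,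
    fun z hz x hx => ?_, fun z hz G G₀ hG₀ hG => ?_⟩⟩
  · obtain ⟨h1, h2, h3⟩ := hinv z (hz.trans hle1) x hx
    exact ⟨h1, h2, fun z' hz' => h3 z' (hz'.trans hle1)⟩
  · have hd : ∀ m, ‖G m - G₀ m‖ ≤ K * ρ' := fun m =>
      (hG m).trans (mul_le_mul_of_nonneg_left hz hK0.le)
    have hG₀g : ∀ m, g ≤ ‖(G₀ m : ℂ)‖ := fun m => by
      rw [Complex.norm_real]; exact (hYg _ (hG₀ m)).1
    have hGg : ∀ m, g / 2 ≤ ‖G m‖ := fun m => by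
      have h1 : ‖(G₀ m : ℂ)‖ ≤ ‖G m‖ + ‖G m - G₀ m‖ := by
        rw [norm_sub_rev]
        exact norm_le_norm_add_norm_sub' _ _
      linarith [hG₀g m, hd m]
    obtain ⟨h1, h2⟩ := H (fun m => (G m)⁻¹) (fun m => (G₀ m)⁻¹ + t) (fun m => (hYg _ (hG₀ m)).2)
      fun m => by
        have n1 : G m ≠ 0 := norm_pos_iff.1 ((half_pos hg).trans_le (hGg m))
        have n2 : (G₀ m : ℂ) ≠ 0 := norm_pos_iff.1 (hg.trans_le (hG₀g m))
        have e : (G m)⁻¹ - (((G₀ m)⁻¹ + t - t : ℝ) : ℂ) = -(G m - G₀ m) / (G m * G₀ m) := by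
          rw [add_sub_cancel_right, Complex.ofReal_inv]
          field_simp
          ring
        rw [e, norm_div, norm_neg, norm_mul, div_le_iff₀ (by positivity)]
        calc ‖G m - G₀ m‖ ≤ ε * g ^ 2 / 2 := (hd m).trans hle3
          _ = ε * (g / 2 * g) := by ring
          _ ≤ _ := by gcongr; exacts [hGg m, hG₀g m]
    exact ⟨fun m => (min_le_right _ _).trans (hGg m), (min_le_left _ _).trans h1,
      (min_le_left _ _).trans h2⟩

variable {r : ℕ → Fin 3 → ℕ} {part : ∀ n j, Fin (r n j) → Fin (k j)}
  {B : Matrix (Mode k) (Mode k) ℝ}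

/-- In `I_0` the lower bounds hold in every shell and for every potential with values in the
support, not only with large probability. -/
lemma IsModeNbhd.part_bounds (h : IsModeNbhd ν B t ρ K c Y) {n : ℕ}
    (hcard : ∀ m, 0 < (modePart part n m).card) {w : Shell r n → ℝ} (hw : ∀ x, w x ∈ ν.support)
    {z : ℂ} (hz : ‖z - t‖ ≤ ρ) : (∀ m, c ≤ ‖partAvg part n m z w‖) ∧
      c ≤ ‖(addDiag B fun m => (partAvg part n m z w)⁻¹).det‖ ∧
      c ≤ ‖modeCoeff r k part B (upsilon k) (phi k) n z w‖ := by
  have hρ := h.pos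
  refine h.lower z hz _ (fun m => ((modePart part n m).card : ℝ)⁻¹ *
    ∑ i ∈ modePart part n m, (w ⟨m.1, i⟩ - t)⁻¹) (fun m => ?_) fun m => ?_
  · rw [Finset.mul_sum]
    refine h.convex.sum_mem (fun _ _ => by positivity) ?_ fun i _ => h.inv_mem _ (hw _)
    rw [Finset.sum_const, nsmul_eq_mul]
    exact mul_inv_cancel₀ (by exact_mod_cast (hcard m).ne')
  · have e : partAvg part n m z w - ((((modePart part n m).card : ℝ)⁻¹ *
        ∑ i ∈ modePart part n m, (w ⟨m.1, i⟩ - t)⁻¹ : ℝ) : ℂ) =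
        ((modePart part n m).card : ℂ)⁻¹ * ∑ i ∈ modePart part n m,
          (((w ⟨m.1, i⟩ : ℂ) - z)⁻¹ - ((w ⟨m.1, i⟩ : ℂ) - t)⁻¹) := by
      rw [partAvg, Finset.sum_sub_distrib, mul_sub]
      push_cast
      rfl
    rw [e]
    exact norm_average_le (hcard m) fun i _ =>
      (h.inv_bound z hz _ (hw _)).2.2 t (by simpa using hρ.le)

end ModeBounds

/-! ### Partial antitrees with homogeneous connecting modes -/

section ModeMean

variable {ν : Measure ℝ} {k : Fin 3 → ℕ} {B : Matrix (Mode k) (Mode k) ℝ} {t ρ K c : ℝ} {Y : Set ℝ}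

lemma ae_mem_support : ∀ᵐ x ∂ν, x ∈ ν.support := Measure.support_mem_ae

lemma ofReal_mean (l : ℝ) :
    ((∫ x, (x - l)⁻¹ ∂ν : ℝ) : ℂ) = ∫ x : ℝ, ((x : ℂ) - l)⁻¹ ∂ν := by
  rw [← integral_complex_ofReal]
  push_cast
  rfl

lemma ofReal_harmonicAvg (l : ℝ) :
    (harmonicAvg ν l : ℂ) = (∫ x : ℝ, ((x : ℂ) - l)⁻¹ ∂ν)⁻¹ := by
  rw [harmonicAvg, Complex.ofReal_inv, ofReal_mean]

lemma greenForm_harmonicAvg (O : Matrix (Mode k) (Mode k) ℝ) (a : Mode k → ℝ)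
    (x y : Mode k → ℝ) (l : ℝ) :
    greenForm (modeMatrix k O a) x y (fun _ => (∫ x : ℝ, ((x : ℂ) - l)⁻¹ ∂ν)⁻¹)
      = ((x ⬝ᵥ (greenA ν k O a l).mulVec y : ℝ) : ℂ) := by
  rw [← ofReal_harmonicAvg, greenForm_ofReal, greenA, Matrix.smul_one_eq_diagonal]

variable [IsProbabilityMeasure ν]

lemma IsModeNbhd.integrable (h : IsModeNbhd ν B t ρ K c Y) {z : ℂ} (hz : ‖z - t‖ ≤ ρ) :
    Integrable (fun x : ℝ => ((x : ℂ) - z)⁻¹) ν :=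
  integrable_of_ae_bound (by fun_prop) (ae_mem_support.mono fun x hx => (h.inv_bound z hz x hx).2.1)

lemma IsModeNbhd.norm_mean_sub_le (h : IsModeNbhd ν B t ρ K c Y) {z z' : ℂ} (hz : ‖z - t‖ ≤ ρ)
    (hz' : ‖z' - t‖ ≤ ρ) : ‖∫ x : ℝ, ((x : ℂ) - z)⁻¹ ∂ν - ∫ x : ℝ, ((x : ℂ) - z')⁻¹ ∂ν‖
      ≤ K * ‖z - z'‖ := by
  rw [← integral_sub (h.integrable hz) (h.integrable hz')]
  refine (norm_integral_le_of_norm_le_const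
    (ae_mem_support.mono fun x hx => (h.inv_bound z hz x hx).2.2 z' hz')).trans ?_
  simp

/-- The limit of the averages lies in the same convex set as the averages themselves. -/
lemma IsModeNbhd.mean_mem (h : IsModeNbhd ν B t ρ K c Y) : ∫ x, (x - t)⁻¹ ∂ν ∈ Y := by
  have hi := (h.integrable (z := t) (by simpa using h.pos.le)).re
  refine integral_inv_mem h.convex h.closed h.inv_mem (hi.congr (ae_of_all _ fun x => ?_))
  change (((x : ℂ) - t)⁻¹).re = _
  rw [← Complex.ofReal_sub, ← Complex.ofReal_inv, Complex.ofReal_re]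

lemma IsModeNbhd.mean_bounds (h : IsModeNbhd ν B t ρ K c Y) {z : ℂ} (hz : ‖z - t‖ ≤ ρ) :
    (Nonempty (Mode k) → c ≤ ‖∫ x : ℝ, ((x : ℂ) - z)⁻¹ ∂ν‖) ∧
      c ≤ ‖(addDiag B fun _ => (∫ x : ℝ, ((x : ℂ) - z)⁻¹ ∂ν)⁻¹).det‖ ∧
      c ≤ ‖greenForm B (upsilon k) (phi k) fun _ => (∫ x : ℝ, ((x : ℂ) - z)⁻¹ ∂ν)⁻¹‖ := by
  have h1 := h.lower z hz (fun _ => ∫ x : ℝ, ((x : ℂ) - z)⁻¹ ∂ν) (fun _ => ∫ x, (x - t)⁻¹ ∂ν)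
    (fun _ => h.mean_mem) fun _ => by
      rw [ofReal_mean]
      exact h.norm_mean_sub_le hz (by simpa using h.pos.le)
  exact ⟨fun ⟨m⟩ => h1.1 m, h1.2⟩

lemma IsModeNbhd.continuousAt {O : Matrix (Mode k) (Mode k) ℝ} {a : Mode k → ℝ}
    (h : IsModeNbhd ν (modeMatrix k O a) t ρ K c Y) (hne : Nonempty (Mode k))
    (x y : Mode k → ℝ) :
    ContinuousAt (fun l => x ⬝ᵥ (greenA ν k O a l).mulVec y) t := by
  have ht : ‖(t : ℂ) - t‖ ≤ ρ := by simpa using h.pos.le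
  have hm : ContinuousAt (fun l : ℝ => ∫ x : ℝ, ((x : ℂ) - l)⁻¹ ∂ν) t := by
    refine continuousAt_of_locally_lipschitz h.pos K fun l hl => ?_
    have e : ‖(l : ℂ) - t‖ = dist l t := by
      rw [← Complex.ofReal_sub, Complex.norm_real, Real.dist_eq, Real.norm_eq_abs]
    rw [dist_eq_norm, ← e]
    exact h.norm_mean_sub_le (by rw [e]; exact hl.le) ht
  obtain ⟨h1, h2, -⟩ := h.mean_bounds ht
  have hm0 : ∫ x : ℝ, ((x : ℂ) - t)⁻¹ ∂ν ≠ 0 := norm_pos_iff.1 (h.c_pos.trans_le (h1 hne))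
  let W : ℝ → Mode k → ℂ := fun l _ => (∫ x : ℝ, ((x : ℂ) - l)⁻¹ ∂ν)⁻¹
  have hW : ContinuousAt W t := continuousAt_pi.2 fun _ => hm.inv₀ hm0
  have hg : ContinuousAt (fun l => greenForm (modeMatrix k O a) x y (W l)) t :=
    ContinuousAt.comp (f := W) (g := greenForm (modeMatrix k O a) x y)
      (continuousAt_greenForm _ x y (norm_pos_iff.1 (h.c_pos.trans_le h2))) hW
  have e : ∀ l, greenForm (modeMatrix k O a) x y (W l)
      = ((x ⬝ᵥ (greenA ν k O a l).mulVec y : ℝ) : ℂ) := fun l => greenForm_harmonicAvg O a x y l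
  simp only [e] at hg
  exact Complex.continuous_re.continuousAt.comp hg

end ModeMean

section ModeTransport

variable {ν : Measure ℝ} [IsProbabilityMeasure ν] {r : ℕ → Fin 3 → ℕ} {k : Fin 3 → ℕ}
  {part : ∀ n j, Fin (r n j) → Fin (k j)} {O : Matrix (Mode k) (Mode k) ℝ} {a : Mode k → ℝ}
  {t ρ K c : ℝ} {Y : Set ℝ}

lemma measurable_partAvg (n : ℕ) (m : Mode k) :
    Measurable fun p : ℂ × (Shell r n → ℝ) => partAvg part n m p.1 p.2 := by
  unfold partAvg
  fun_prop

lemma measurable_modeCoeff (B : Matrix (Mode k) (Mode k) ℝ) (x y : Mode k → ℝ) (n : ℕ) :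
    Measurable fun p : ℂ × (Shell r n → ℝ) => modeCoeff r k part B x y n p.1 p.2 :=
  (measurable_greenForm B x y).comp
    (measurable_pi_lambda _ fun m => (measurable_partAvg n m).inv)

/-- The Green numbers of the partial antitree, for all shells. -/
def modeShellCoeff (part : ∀ n j, Fin (r n j) → Fin (k j)) (B : Matrix (Mode k) (Mode k) ℝ) :
    ShellCoeff r where
  al := modeCoeff r k part B (upsilon k) (upsilon k)
  be := modeCoeff r k part B (upsilon k) (phi k)
  de := modeCoeff r k part B (phi k) (phi k)
  measurable_al := measurable_modeCoeff B _ _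
  measurable_be := measurable_modeCoeff B _ _
  measurable_de := measurable_modeCoeff B _ _

/-- The averages over a part concentrate at the rate of its size plus the imaginary part of the
energy; the latter accounts for the limit being taken on the real axis. -/
lemma IsModeNbhd.conc_partAvg {B : Matrix (Mode k) (Mode k) ℝ} (h : IsModeNbhd ν B t ρ K c Y)
    (hpart : ∀ n j l, k j * (Finset.univ.filter (fun i => part n j i = l)).card = r n j)
    (hr : ∀ n j, 0 < k j → 0 < r n j) {e : ℕ → ℝ} (he0 : ∀ n, 0 ≤ e n)
    (he : ∀ n j, 0 < k j → ((r n j : ℝ))⁻¹ ≤ e n) (m : Mode k) :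
    Conc (potentialLaw r ν) (fun p : Param (t - ρ / 2) (t + ρ / 2) (ρ / 2) => e p.n + p.η)
      (fun p ω => partAvg part p.n m p.z (shellPart p.n ω))
      (fun p => ∫ x : ℝ, ((x : ℂ) - p.l)⁻¹ ∂ν) := by
  have hK := h.one_le
  have hkm : (1 : ℝ) ≤ k m.1 := by exact_mod_cast Fin.pos m.2
  have hε : ∀ p : Param (t - ρ / 2) (t + ρ / 2) (ρ / 2), 0 ≤ e p.n + p.η := fun p =>
    add_nonneg (he0 _) p.η_pos.le
  have hme : ∀ z : ℂ, Measurable fun x : ℝ => ((x : ℂ) - z)⁻¹ := fun z => by fun_prop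
  refine Conc.average (P := potentialLaw r ν) hε (J := fun p => Fin (r p.n m.1))
    (T := fun p => modePart part p.n m)
    (X := fun p i ω => ((shellPart p.n ω ⟨m.1, i⟩ : ℂ) - p.z)⁻¹) (K := K * k m.1)
    (fun p => Finset.card_pos.1 (card_modePart_pos hpart hr p.n m)) (by positivity)
    (fun p i => (hme _).comp (measurable_pi_apply _)) (fun p i _ => ?_) (fun p => ?_)
    (fun p i _ j _ hij => ?_) (fun p => ?_) (fun p i _ => ?_)
  · filter_upwards [ae_forall_mem_support (ν := ν) r] with ω hω
    exact (h.inv_bound _ p.norm_z_sub_le _ (hω _)).2.1.trans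
      (le_mul_of_one_le_right (by linarith) hkm)
  · refine (norm_integral_le_of_norm_le_const (ae_mem_support.mono fun x hx =>
      (h.inv_bound _ p.norm_l_sub_le x hx).2.1)).trans ?_
    simpa using le_mul_of_one_le_right (by linarith : (0 : ℝ) ≤ K) hkm
  · have hind : iIndepFun (fun (x : Vertex r) (ω : Vertex r → ℝ) => ω x) (potentialLaw r ν) :=
      iIndepFun_infinitePi (X := fun _ t => t) (fun _ => measurable_id)
    refine (hind.indepFun (i := ⟨p.n, m.1, i⟩) (j := ⟨p.n, m.1, j⟩) fun e => hij ?_).comp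
      (hme p.z) (hme p.z)
    exact eq_of_heq (Sigma.mk.inj (eq_of_heq (Sigma.mk.inj e).2)).2
  · rw [← modeWeight_sq hpart p.n m, modeWeight, Real.sq_sqrt (by positivity), div_eq_mul_inv]
    have h1 := he p.n m.1 (Fin.pos m.2)
    have h2 := p.η_pos
    have h3 : (0 : ℝ) ≤ k m.1 := by positivity
    calc (k m.1 : ℝ) * ((r p.n m.1 : ℝ))⁻¹ ≤ k m.1 * (e p.n + p.η) := by
          apply mul_le_mul_of_nonneg_left _ h3
          linarith
      _ ≤ K * k m.1 * (e p.n + p.η) := by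
          apply mul_le_mul_of_nonneg_right _ (hε p)
          exact le_mul_of_one_le_left h3 hK
  · have hmap : ∫ ω, ((shellPart p.n ω ⟨m.1, i⟩ : ℂ) - p.z)⁻¹ ∂(potentialLaw r ν)
        = ∫ x : ℝ, ((x : ℂ) - p.z)⁻¹ ∂ν := by
      have h0 := integral_map (μ := potentialLaw r ν) (φ := fun ω => ω ⟨p.n, m.1, i⟩)
        (measurable_pi_apply _).aemeasurable (hme p.z).aestronglyMeasurable
      rw [Measure.infinitePi_map_eval] at h0
      exact h0.symm
    rw [hmap]
    refine (h.norm_mean_sub_le p.norm_z_sub_le p.norm_l_sub_le).trans ?_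
    rw [p.norm_z_sub_l]
    have h1 : K * p.η ≤ K * (e p.n + p.η) := by
      apply mul_le_mul_of_nonneg_left _ (by linarith)
      linarith [he0 p.n]
    refine h1.trans ?_
    apply mul_le_mul_of_nonneg_right _ (hε p)
    exact le_mul_of_one_le_right (by linarith) hkm

/-- Energies of `I_𝔸` lie in transport intervals. The rate `e n` bounds the reciprocals of the sizes
of all layers of the shell `n` that are present. -/
lemma exists_isTransportInterval_mode (hν : IsCompact ν.support)
    (hpart : ∀ n j l, k j * (Finset.univ.filter (fun i => part n j i = l)).card = r n j)
    (hk0 : 0 < k 0) (hk2 : 0 < k 2) (hr : ∀ n j, 0 < k j → 0 < r n j) {e : ℕ → ℝ}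
    (he0 : ∀ n, 0 ≤ e n) (hsum : Summable e) (he : ∀ n j, 0 < k j → ((r n j : ℝ))⁻¹ ≤ e n)
    (ht : t ∈ IA ν k O a) :
    ∃ a' b', t ∈ Ioo a' b' ∧ IsTransportInterval (modeInner r k part O a) ν a' b' := by
  obtain ⟨ρ, K, c, Y, h⟩ := exists_isModeNbhd hν ht.1
  have hρ := h.pos
  have hc := h.c_pos
  have hne : Nonempty (Mode k) := ⟨⟨0, ⟨0, hk0⟩⟩⟩
  have hG : ∀ m, _ := h.conc_partAvg hpart hr he0 he
  have hε : ∀ p : Param (t - ρ / 2) (t + ρ / 2) (ρ / 2), 0 ≤ e p.n + p.η := fun p =>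
    add_nonneg (he0 _) p.η_pos.le
  have hcard := card_modePart_pos hpart hr
  have hpb : ∀ p : Param (t - ρ / 2) (t + ρ / 2) (ρ / 2), ∀ᵐ ω ∂(potentialLaw r ν),
      (∀ m, c ≤ ‖partAvg part p.n m p.z (shellPart p.n ω)‖) ∧
      c ≤ ‖(addDiag (modeMatrix k O a) fun m =>
        (partAvg part p.n m p.z (shellPart p.n ω))⁻¹).det‖ := by
    intro p
    filter_upwards [ae_forall_mem_support (ν := ν) r] with ω hω
    have := h.part_bounds (hcard p.n) (fun x => hω ⟨p.n, x⟩) p.norm_z_sub_le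
    exact ⟨this.1, this.2.1⟩
  have hW : ∀ m, Conc (potentialLaw r ν)
      (fun p : Param (t - ρ / 2) (t + ρ / 2) (ρ / 2) => e p.n + p.η)
      (fun p ω => (partAvg part p.n m p.z (shellPart p.n ω))⁻¹)
      (fun p => (∫ x : ℝ, ((x : ℂ) - p.l)⁻¹ ∂ν)⁻¹) := fun m =>
    (hG m).inv hc (fun p => (h.mean_bounds p.norm_l_sub_le).1 hne)
      fun p => (hpb p).mono fun ω hω => hω.1 m
  have hcoef : ∀ x y : Mode k → ℝ, Conc (potentialLaw r ν)
      (fun p : Param (t - ρ / 2) (t + ρ / 2) (ρ / 2) => e p.n + p.η)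
      (fun p ω => modeCoeff r k part (modeMatrix k O a) x y p.n p.z (shellPart p.n ω))
      (fun p => ((x ⬝ᵥ (greenA ν k O a p.l).mulVec y : ℝ) : ℂ)) := by
    intro x y
    have := Conc.greenForm hε hW (modeMatrix k O a) x y hc
      (fun p => (h.mean_bounds p.norm_l_sub_le).2.1) fun p => (hpb p).mono fun ω hω => hω.2
    simp only [greenForm_harmonicAvg] at this
    exact this
  have hconc : CoeffConc (modeShellCoeff part (modeMatrix k O a)) ν (t - ρ / 2) (t + ρ / 2)
      (ρ / 2) e (alphaA ν k O a) (betaA ν k O a) (deltaA ν k O a) :=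
    ⟨hcoef _ _, hcoef _ _, hcoef _ _⟩
  have hbe : betaA ν k O a t ≠ 0 := by
    have h1 := (h.mean_bounds (z := t) (by simpa using hρ.le)).2.2
    rw [greenForm_harmonicAvg] at h1
    exact Complex.ofReal_ne_zero.1 (norm_pos_iff.1 (hc.trans_le h1))
  refine exists_isTransportInterval (h.continuousAt hne _ _) (h.continuousAt hne _ _)
    (h.continuousAt hne _ _) hbe ht.2 he0 hsum (a := t - ρ / 2) (b := t + ρ / 2)
    ⟨by linarith, by linarith⟩ hconc ?_
  intro a' b' ha hb c' hc' _
  refine ⟨min c c', ρ / 2, lt_min hc hc', min_le_right _ _, by positivity, le_rfl, ?_⟩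
  filter_upwards [ae_forall_mem_support (ν := ν) r] with ω hω
  refine ⟨0, fun n _ l hl η hη hηle => ?_⟩
  let p : Param (t - ρ / 2) (t + ρ / 2) (ρ / 2) :=
    ⟨n, l, η, ⟨ha.trans hl.1, hl.2.trans hb⟩, hη, hηle⟩
  obtain ⟨h1, h2, h3⟩ := h.part_bounds (hcard n) (fun x => hω ⟨n, x⟩) p.norm_z_sub_le
  exact ⟨isShellGreen_mode hpart hk0 hk2 (fun x => (h.inv_bound _ p.norm_z_sub_le _ (hω _)).1)
    (fun m => norm_pos_iff.1 (hc.trans_le (h1 m))) (norm_pos_iff.1 (hc.trans_le h2)),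
    (min_le_left _ _).trans h3⟩

/-- In `I_𝔸` the Green number `β` does not vanish in any shell, which excludes eigenfunctions with
finite support. -/
lemma notMem_finSuppEigenvalues_mode (hν : IsCompact ν.support)
    (hpart : ∀ n j l, k j * (Finset.univ.filter (fun i => part n j i = l)).card = r n j)
    (hk0 : 0 < k 0) (hk2 : 0 < k 2) (hr : ∀ n j, 0 < k j → 0 < r n j) (ht : t ∈ IA ν k O a)
    {ω : Vertex r → ℝ} (hω : ∀ x, ω x ∈ ν.support) {H : L2 (Vertex r) →L[ℂ] L2 (Vertex r)}
    (hH : IsSchrodinger (fun x y => coupling r x y + modeInner r k part O a x y) ω H) :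
    t ∉ finSuppEigenvalues H := by
  obtain ⟨ρ, K, c, Y, h⟩ := exists_isModeNbhd hν ht.1
  have hc := h.c_pos
  have hz : ‖(t : ℂ) - t‖ ≤ ρ := by simpa using h.pos.le
  have hb := fun n => h.part_bounds (card_modePart_pos hpart hr n) (fun x => hω ⟨n, x⟩) hz
  have hw : ∀ n x, (ω ⟨n, x⟩ : ℂ) - t ≠ 0 := fun n x => (h.inv_bound _ hz _ (hω _)).1
  have hG := fun n m => norm_pos_iff.1 (hc.trans_le ((hb n).1 m))
  have hdet := fun n => norm_pos_iff.1 (hc.trans_le (hb n).2.1)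
  exact notMem_finSuppEigenvalues isShellMatrix_mode hH
    (fun n => isShellGreen_mode hpart hk0 hk2 (hw n) (hG n) (hdet n))
    (fun n => norm_pos_iff.1 (hc.trans_le (hb n).2.2))
    fun n => mode_shell_injective hpart hk0 hk2 (hw n) (hG n) (hdet n)

/-- The Anderson model on partial antitrees, when the reciprocals of the layer sizes are bounded by
a summable sequence. The middle layers are present exactly if they have modes. -/
theorem partial_antitree (hν : IsCompact ν.support)
    (hpart : ∀ n j l, k j * (Finset.univ.filter (fun i => part n j i = l)).card = r n j)
    (hk0 : 0 < k 0) (hk2 : 0 < k 2) (hr : ∀ n j, 0 < k j → 0 < r n j) {e : ℕ → ℝ}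
    (he0 : ∀ n, 0 ≤ e n) (hsum : Summable e) (he : ∀ n j, 0 < k j → ((r n j : ℝ))⁻¹ ≤ e n) :
    ∀ᵐ ω ∂(potentialLaw r ν), ∃ H, IsSchrodinger (modeAdj r k part O a) ω H ∧
      IsSelfAdjoint H ∧ (∀ t ∈ IA ν k O a, (t : ℂ) ∈ spectrum ℂ H) ∧
      PurelyACOn H (IA ν k O a) := by
  obtain ⟨R, hR⟩ := hν.isBounded.exists_norm_le
  have hC : IsShellMatrix r (modeInner r k part O a) := isShellMatrix_mode
  filter_upwards [ae_forall_mem_support (ν := ν) r,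
    ae_spectrum_of_isTransportInterval (ν := ν) hC (fun n => hr n 2 hk2) fun t ht =>
      exists_isTransportInterval_mode hν hpart hk0 hk2 hr he0 hsum he ht] with ω hω hsp
  obtain ⟨H, hH⟩ := hC.exists_isSchrodinger (v := ω)
    (fun n j i => Fin.pos i) (fun x => (hR _ (hω x)).trans (le_abs_self R)) (abs_nonneg R)
  obtain ⟨h1, h2⟩ := hsp H hH
  refine ⟨H, hH, hC.isSelfAdjoint hH, h1, ?_⟩
  rwa [sdiff_eq_left.2] at h2
  rw [disjoint_left]
  exact fun t ht => notMem_finSuppEigenvalues_mode hν hpart hk0 hk2 hr ht hω hH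

end ModeTransport

end PartialAntitree

end

theorem mainTheorem1 (ν : Measure ℝ) [IsProbabilityMeasure ν] (hν : IsCompact ν.support) :
    -- (i) the stretched antitree
    (∀ s : ℕ → ℕ, (∀ n, 0 < s n) → Summable (fun n => ((s n : ℝ))⁻¹) →
      ∀ᵐ ω ∂(Measure.infinitePi
          (fun _ : PartialAntitree.Vertex (PartialAntitree.stretchedSizes s) => ν)),
        ∃ H, PartialAntitree.IsSchrodinger (PartialAntitree.stretchedAdj s) ω H ∧
          IsSelfAdjoint H ∧
          (∀ t ∈ PartialAntitree.IS ν, (t : ℂ) ∈ spectrum ℂ H) ∧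
          PartialAntitree.PurelyACOn H
            (PartialAntitree.IS ν \
              (PartialAntitree.IPlus ν ∩ convexHull ℝ ν.support ∩
                PartialAntitree.finSuppEigenvalues H))) ∧
    -- (ii) the partial antitrees with homogeneous connecting modes
    (∀ (k : Fin 3 → ℕ) (O : Matrix (PartialAntitree.Mode k) (PartialAntitree.Mode k) ℝ)
        (a : PartialAntitree.Mode k → ℝ) (r : ℕ → Fin 3 → ℕ)
        (part : ∀ n j, Fin (r n j) → Fin (k j)),
      0 < k 0 → 0 < k 2 → O ∈ Matrix.orthogonalGroup (PartialAntitree.Mode k) ℝ →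
      (∀ n, 0 < r n 0) → (∀ n, 0 < r n 2) →
      -- the layer `(n, j)` is split into `k j` parts of equal size
      (∀ n j l, k j * (Finset.univ.filter (fun i => part n j i = l)).card = r n j) →
      ((k 1 = 0 ∧ (∀ n, r n 1 = 0) ∧
          Summable (fun n => ((min (r n 0) (r n 2) : ℕ) : ℝ)⁻¹)) ∨
        (0 < k 1 ∧ (∀ n, 0 < r n 1) ∧
          Summable (fun n => ((min (r n 0) (min (r n 1) (r n 2)) : ℕ) : ℝ)⁻¹))) →
      ∀ᵐ ω ∂(Measure.infinitePi (fun _ : PartialAntitree.Vertex r => ν)),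
        ∃ H, PartialAntitree.IsSchrodinger (PartialAntitree.modeAdj r k part O a) ω H ∧
          IsSelfAdjoint H ∧
          (∀ t ∈ PartialAntitree.IA ν k O a, (t : ℂ) ∈ spectrum ℂ H) ∧
          PartialAntitree.PurelyACOn H (PartialAntitree.IA ν k O a)) := by
  refine ⟨fun s hs hsum => PartialAntitree.stretched_antitree hν hs hsum, ?_⟩
  intro k O a r part hk0 hk2 _ hr0 hr2 hpart hcase
  have hinv : ∀ {m n : ℕ}, 0 < m → m ≤ n → ((n : ℝ))⁻¹ ≤ ((m : ℝ))⁻¹ := fun hm hmn =>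
    inv_anti₀ (by exact_mod_cast hm) (by exact_mod_cast hmn)
  rcases hcase with ⟨hk1, -, hsum⟩ | ⟨-, hr1, hsum⟩
  · refine PartialAntitree.partial_antitree hν hpart hk0 hk2 (fun n j hj => ?_)
      (fun n => by positivity) hsum fun n j hj => ?_
    · fin_cases j
      · exact hr0 n
      · exact absurd hj (by simp [hk1])
      · exact hr2 n
    · refine hinv (lt_min (hr0 n) (hr2 n)) ?_
      fin_cases j
      · exact min_le_left _ _
      · exact absurd hj (by simp [hk1])
      · exact min_le_right _ _
  · refine PartialAntitree.partial_antitree hν hpart hk0 hk2 (fun n j _ => ?_)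
      (fun n => by positivity) hsum fun n j _ => ?_
    · fin_cases j
      · exact hr0 n
      · exact hr1 n
      · exact hr2 n
    · refine hinv (lt_min (hr0 n) (lt_min (hr1 n) (hr2 n))) ?_
      fin_cases j
      · exact min_le_left _ _
      · exact (min_le_right _ _).trans (min_le_left _ _)
      · exact (min_le_right _ _).trans (min_le_right _ _)
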